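/- Let $\ell\ge 2$ be an integer, let $W$ be a non-negative random variable with $E[W]=1$, and let $(W_\varepsilon)$ be a family of independent copies of $W$ indexed by the finite words $\varepsilon$ over the alphabet $\{0,\dots,\ell-1\}$. For a word $\varepsilon=\varepsilon_1\cdots\varepsilon_n$ put $I_\varepsilon=\left[\sum_{k=1}^n\frac{\varepsilon_k}{\ell^k},\ \sum_{k=1}^n\frac{\varepsilon_k}{\ell^k}+\frac1{\ell^n}\right)$, and for $x\in[0,1)$ let $I_n(x)$ be the interval $I_\varepsilon$, with $\varepsilon$ of length $n$, that contains $x$. Let $m_n=f_n\lambda$, where $\lambda$ is Lebesgue measure and $$f_n=\sum_{\varepsilon_1\cdots\varepsilon_n}W_{\varepsilon_1}W_{\varepsilon_1\varepsilon_2}\cdots W_{\varepsilon_1\cdots\varepsilon_n}\,\mathbf 1_{I_{\varepsilon_1\cdots\varepsilon_n}},$$ and let $m$ be the Mandelbrot cascade associated to $W$, that is, the almost sure weak limit of $(m_n)$. For $\beta\in\mathbb R$ let $$E_\beta=\left\{x\in[0,1)\ ;\ \lim_{n\to\infty}\frac{\log m(I_n(x))}{\log|I_n(x)|}=\beta\right\},$$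 where $|I|$ is the length of $I$ and $\log 0=-\infty$. Assume that $P[W=0]=0$, that $E[W^q]<\infty$ for every real $q$, and that the cascade is non-degenerate, i.e. $E[m([0,1])]>0$. Let $$\tau(q)=\log_\ell E[W^q]-(q-1)\quad(q\in\mathbb R),\qquad \tau^*(\beta)=\inf_{t\in\mathbb R}\,(t\beta+\tau(t)),$$ and let $q_{\min},q_{\max}\in[-\infty,+\infty]$ be the endpoints (infimum and supremum) of the interval $\{q\in\mathbb R\ ;\ \tau^*(-\tau'(q))>0\}$. If $q_{\max}=+\infty$ (respectively $q_{\min}=-\infty$), then $\tau'(q_{\max})$ (respectively $\tau'(q_{\min})$) denotes the limit in $[-\infty,+\infty]$ of the nondecreasing function $\tau'$ at $+\infty$ (respectively $-\infty$). Then, for each fixed real $\beta$ with $-\tau'(q_{\max})<\beta<-\tau'(q_{\min})$, almost surely the Hausdorff dimension of $E_\beta$ equals $\tau^*(\beta)$. -/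

import Mathlib

open MeasureTheory ProbabilityTheory Filter Topology

namespace MandelbrotCascade

/-- The `ℓ`-adic interval of generation `n` attached to a word `ε` of length `n`:
`[∑ ε_k / ℓ^k, ∑ ε_k / ℓ^k + 1 / ℓ^n)`, the letters being numbered from `1`. -/
noncomputable def adicInterval (ℓ n : ℕ) (ε : Fin n → Fin ℓ) : Set ℝ :=
  Set.Ico (∑ k : Fin n, (ε k : ℝ) / (ℓ : ℝ) ^ ((k : ℕ) + 1))
    ((∑ k : Fin n, (ε k : ℝ) / (ℓ : ℝ) ^ ((k : ℕ) + 1)) + 1 / (ℓ : ℝ) ^ n)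

/-- `I_n(x)`: the `ℓ`-adic interval of generation `n` that contains `x` (the intervals of
generation `n` are a partition of `[0, 1)`, so for `x ∈ [0, 1)` the union has one term). -/
noncomputable def adicIntervalAt (ℓ n : ℕ) (x : ℝ) : Set ℝ :=
  ⋃ (ε : Fin n → Fin ℓ) (_ : x ∈ adicInterval ℓ n ε), adicInterval ℓ n ε

section Cascade

variable {Ω : Type*} {ℓ : ℕ}

/-- The product `W_{ε_1} W_{ε_1 ε_2} ⋯ W_{ε_1 ⋯ ε_n}` over the nonempty prefixes of `ε`. -/
noncomputable def prefixProd (W : List (Fin ℓ) → Ω → ℝ) (n : ℕ) (ε : Fin n → Fin ℓ) (ω : Ω) : ℝ :=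
  ∏ k ∈ Finset.range n, W ((List.ofFn ε).take (k + 1)) ω

/-- The density `f_n = ∑ W_{ε_1} ⋯ W_{ε_1 ⋯ ε_n} 1_{I_ε}`, summed over words of length `n`. -/
noncomputable def density (W : List (Fin ℓ) → Ω → ℝ) (n : ℕ) (ω : Ω) (x : ℝ) : ℝ :=
  ∑ ε : Fin n → Fin ℓ, (adicInterval ℓ n ε).indicator (fun _ => prefixProd W n ε ω) x

theorem integrable_density (W : List (Fin ℓ) → Ω → ℝ) (n : ℕ) (ω : Ω) :
    Integrable (density W n ω) volume := by
  unfold density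
  refine integrable_finsetSum _ fun ε _ => ?_
  refine (integrable_indicator_iff measurableSet_Ico).2 ?_
  exact integrableOn_const (by simp)

/-- The random measure `m_n = f_n λ`. It is carried by `[0, 1)`, and is regarded as a finite Borel
measure on the real line. -/
noncomputable def approx (W : List (Fin ℓ) → Ω → ℝ) (n : ℕ) (ω : Ω) : FiniteMeasure ℝ :=
  ⟨volume.withDensity (fun x => ENNReal.ofReal (density W n ω x)),
    isFiniteMeasure_withDensity_ofReal (integrable_density W n ω).2⟩

/-- The Mandelbrot cascade: the limit of `(m_n)` in the topology of weak convergence of finite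
measures (an unspecified finite measure for the `ω` where there is no limit). -/
noncomputable def cascade (W : List (Fin ℓ) → Ω → ℝ) (ω : Ω) : FiniteMeasure ℝ :=
  limUnder atTop (fun n : ℕ => approx W n ω)

/-- The cascade is non-degenerate when its total mass `Y_∞` satisfies `E[Y_∞] > 0`. -/
def Nondegenerate [MeasurableSpace Ω] (P : Measure Ω) (W : List (Fin ℓ) → Ω → ℝ) : Prop :=
  0 < ∫⁻ ω, (cascade W ω : Measure ℝ) Set.univ ∂P

end Cascade

/-- The level set `E_β` of the points `x` of `[0, 1)` such that `log m(I_n(x)) / log |I_n(x)|`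
tends to `β`. If `m(I_n(x)) = 0` for some `n`, then `log m(I_n(x)) = -∞` from there on and the
quotient is `+∞`, so that such an `x` lies in no `E_β` with `β` real. -/
def levelSet (ℓ : ℕ) (m : Measure ℝ) (β : ℝ) : Set ℝ :=
  {x | x ∈ Set.Ico (0 : ℝ) 1 ∧ (∀ n : ℕ, m (adicIntervalAt ℓ n x) ≠ 0) ∧
    Tendsto (fun n : ℕ => Real.log (m (adicIntervalAt ℓ n x)).toReal /
      Real.log (volume (adicIntervalAt ℓ n x)).toReal) atTop (𝓝 β)}

/-- The structure function `τ(q) = log_ℓ E[W^q] - (q - 1)`. -/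
noncomputable def tau {Ω : Type*} [MeasurableSpace Ω] (P : Measure Ω) (ℓ : ℕ) (W : Ω → ℝ)
    (q : ℝ) : ℝ :=
  Real.logb (ℓ : ℝ) (∫ ω, W ω ^ q ∂P) - (q - 1)

/-- The Legendre transform `τ*(β) = inf_t (t β + τ(t))`, with values in `[-∞, +∞]`. -/
noncomputable def legendre (τ : ℝ → ℝ) (β : ℝ) : EReal :=
  ⨅ t : ℝ, ((t * β + τ t : ℝ) : EReal)

/-- The set `{q ∈ ℝ ; τ*(-τ'(q)) > 0}`, which is the interval `(q_min, q_max)`. -/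
def qSet (τ : ℝ → ℝ) : Set ℝ :=
  {q | 0 < legendre τ (-deriv τ q)}

/-- The left endpoint `q_min ∈ [-∞, +∞]` of the interval `{q ; τ*(-τ'(q)) > 0}`. -/
noncomputable def qMin (τ : ℝ → ℝ) : EReal := ⨅ q ∈ qSet τ, (q : EReal)

/-- The right endpoint `q_max ∈ [-∞, +∞]` of the interval `{q ; τ*(-τ'(q)) > 0}`. -/
noncomputable def qMax (τ : ℝ → ℝ) : EReal := ⨆ q ∈ qSet τ, (q : EReal)

/-- The derivative `τ'(q)` for `q ∈ [-∞, +∞]`. For convex `τ` the function `τ'` is nondecreasing,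
so its limits at `-∞` and `+∞` are its infimum and its supremum. -/
noncomputable def extDeriv (τ : ℝ → ℝ) : EReal → EReal
  | ⊥ => ⨅ q : ℝ, ((deriv τ q : ℝ) : EReal)
  | ⊤ => ⨆ q : ℝ, ((deriv τ q : ℝ) : EReal)
  | (q : ℝ) => ((deriv τ q : ℝ) : EReal)

end MandelbrotCascade

/-!
The proof is the multifractal formalism for a random measure with a multiplicative structure. Let
`τ` be the structure function of the weight. Since `β` lies strictly between `-τ'(q_max)` and
`-τ'(q_min)` and `τ'` is continuous and monotone, `β = -τ'(q)` for some `q` with `τ*(β) > 0`, and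
by convexity `τ*(β) = τ(q) - q τ'(q)` (`exists_mem_qSet_eq_neg_deriv`, `legendre_neg_deriv`).

All randomness is transported to the canonical space of trees `List (Fin ℓ) → ℝ` with its product
law `treeLaw`. There the total masses of the approximations form a martingale with an almost sure
limit `limMass`, and the limit masses of the subtrees give the values of the cascade measure on the
`ℓ`-adic intervals (`ae_isRegular`). Several cascades live on the same tree: next to the weight `x`
itself the tilted weight `x ^ q / E[x ^ q]` (`tilt`), whose structure function is
`r ↦ τ(q r) - r τ(q)`, with slope `-τ*(β) < 0` at `1`.

*Upper bound.* The partition function `∑ m(I_ε) ^ q` over the words of length `n` has expectation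
`ℓ^{n τ(q)} E[Y ^ q]`, where `Y` is the total mass, so it is almost surely at most
`ℓ^{n (τ(q) + δ)}` for large `n`. Covering the level set by the intervals with `m(I_ε) ≈ ℓ^{-nβ}`
gives dimension at most `q β + τ(q) = τ*(β)` (`dimH_levelSet_le`, `ae_dimH_levelSet_le`).

*Lower bound.* Let `μ` be the tilted cascade. The expectations of `∑ m(I_ε) ^ (±η) μ(I_ε)` and of
`∑ μ(I_ε) ^ (1 + η)` are powers of `ℓ` whose exponents have first order terms `∓ηβ` and
`-η τ*(β)`. By the Borel–Cantelli lemma, at `μ`-almost every point the mass `m(I_n)` is about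
`ℓ^{-nβ}` and `μ(I_n)` is at most about `ℓ^{-n τ*(β)}`, so that the mass distribution principle
applies to the level set (`le_dimH_levelSet`, `ae_le_dimH_levelSet`).

Both bounds rest on moments of total masses. Positive moments of order `r` are finite when the
structure function is negative on `(1, r]` (`lintegral_limMass_rpow_ne_top`); negative moments are
all finite, because `Y` can only be small when two independent subtrees are small
(`lintegral_limMass_rpow_neg_ne_top`). Non-degeneracy is used through `τ'(1) < 0`
(`exists_one_add_le_scaling`, `one_mem_qSet`).
-/

namespace MandelbrotCascade

open scoped ENNReal NNReal

/-! ### The canonical tree of weights -/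

/-- A realisation of the weights: one real number for each finite word over `Fin ℓ`. -/
abbrev Tree (ℓ : ℕ) : Type := List (Fin ℓ) → ℝ

section Tree

variable {ℓ : ℕ}

/-- The law of a tree of independent weights with common law `ν`. -/
noncomputable def treeLaw (ℓ : ℕ) (ν : Measure ℝ) : Measure (Tree ℓ) :=
  Measure.infinitePi fun _ : List (Fin ℓ) => ν

/-- The subtree rooted at the letter `i`. -/
def sub (i : Fin ℓ) (w : Tree ℓ) : Tree ℓ := fun δ => w (i :: δ)

/-- The subtree rooted at the word `ε`. -/
def subAt (ε : List (Fin ℓ)) (w : Tree ℓ) : Tree ℓ := fun δ => w (ε ++ δ)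

/-- The tree with the root weight replaced by `0`. -/
def eraseRoot (w : Tree ℓ) : Tree ℓ
  | [] => 0
  | i :: δ => w (i :: δ)

/-- A function of the tree is root-free when it does not depend on the weight of the empty word. -/
def RootFree {α : Type*} (f : Tree ℓ → α) : Prop := ∀ w, f (eraseRoot w) = f w

/-- The σ-algebra generated by the weights of the words in `S`. -/
@[reducible]
def wordSigma (S : Set (List (Fin ℓ))) : MeasurableSpace (Tree ℓ) :=
  ⨆ ε ∈ S, MeasurableSpace.comap (fun w : Tree ℓ => w ε) inferInstance

theorem wordSigma_mono {S T : Set (List (Fin ℓ))} (h : S ⊆ T) : wordSigma S ≤ wordSigma T :=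
  biSup_mono h

theorem wordSigma_le (S : Set (List (Fin ℓ))) : wordSigma S ≤ MeasurableSpace.pi :=
  iSup₂_le fun ε _ => (measurable_pi_apply ε).comap_le

theorem measurable_eval_wordSigma {S : Set (List (Fin ℓ))} {ε : List (Fin ℓ)} (h : ε ∈ S) :
    Measurable[wordSigma S] fun w : Tree ℓ => w ε :=
  Measurable.of_comap_le (le_iSup₂_of_le (f := fun ε (_ : ε ∈ S) =>
    MeasurableSpace.comap (fun w : Tree ℓ => w ε) inferInstance) ε h le_rfl)

@[fun_prop]
theorem measurable_sub (i : Fin ℓ) : Measurable (sub i) := by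
  unfold sub; fun_prop

@[fun_prop]
theorem measurable_subAt (ε : List (Fin ℓ)) : Measurable (subAt ε) := by
  unfold subAt; fun_prop

theorem measurable_sub_wordSigma {S : Set (List (Fin ℓ))} {i : Fin ℓ} (h : ∀ δ, i :: δ ∈ S) :
    Measurable[wordSigma S] (sub i) :=
  (@measurable_pi_iff _ _ _ (wordSigma S) _ _).2 fun δ => measurable_eval_wordSigma (h δ)

theorem measurable_eraseRoot_wordSigma :
    Measurable[wordSigma {ε : List (Fin ℓ) | ε ≠ []}] eraseRoot := by
  refine (@measurable_pi_iff _ _ _ (wordSigma _) _ _).2 fun δ => ?_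
  cases δ with
  | nil => exact @measurable_const _ _ _ (wordSigma _) _
  | cons i δ => exact measurable_eval_wordSigma (by simp)

theorem RootFree.measurable_wordSigma {α : Type*} [MeasurableSpace α] {f : Tree ℓ → α}
    (hf : RootFree f) (hm : Measurable f) :
    Measurable[wordSigma {ε : List (Fin ℓ) | ε ≠ []}] f := by
  have : f = f ∘ eraseRoot := funext fun w => (hf w).symm
  rw [this]
  exact hm.comp measurable_eraseRoot_wordSigma

section Law

variable (ν : Measure ℝ) [IsProbabilityMeasure ν]

instance : IsProbabilityMeasure (treeLaw ℓ ν) := by unfold treeLaw; infer_instance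

theorem measurePreserving_subAt (ε : List (Fin ℓ)) :
    MeasurePreserving (subAt ε) (treeLaw ℓ ν) (treeLaw ℓ ν) :=
  ⟨measurable_subAt ε, Measure.map_infinitePi_infinitePi_of_inj
    (P := fun _ : List (Fin ℓ) => ν) (f := fun δ => ε ++ δ) (List.append_right_injective ε)⟩

theorem measurePreserving_sub (i : Fin ℓ) :
    MeasurePreserving (sub i) (treeLaw ℓ ν) (treeLaw ℓ ν) :=
  measurePreserving_subAt ν [i]

theorem measurePreserving_eval (ε : List (Fin ℓ)) :
    MeasurePreserving (fun w : Tree ℓ => w ε) (treeLaw ℓ ν) ν :=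
  measurePreserving_eval_infinitePi _ ε

theorem indep_wordSigma {S T : Set (List (Fin ℓ))} (h : Disjoint S T) :
    Indep (wordSigma S) (wordSigma T) (treeLaw ℓ ν) := by
  have h1 : iIndepFun (fun (ε : List (Fin ℓ)) (w : Tree ℓ) => w ε) (treeLaw ℓ ν) :=
    iIndepFun_infinitePi (P := fun _ : List (Fin ℓ) => ν) (X := fun _ x => x)
      fun _ => measurable_id
  exact indep_iSup_of_disjoint (fun ε => (measurable_pi_apply ε).comap_le) h1 h

/-- Functions of the weights on two disjoint sets of words are independent. -/
theorem lintegral_mul_of_disjoint {S T : Set (List (Fin ℓ))} (h : Disjoint S T)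
    {f g : Tree ℓ → ℝ≥0∞} (hf : Measurable[wordSigma S] f) (hg : Measurable[wordSigma T] g) :
    ∫⁻ w, f w * g w ∂treeLaw ℓ ν = (∫⁻ w, f w ∂treeLaw ℓ ν) * ∫⁻ w, g w ∂treeLaw ℓ ν :=
  lintegral_mul_eq_lintegral_mul_lintegral_of_independent_measurableSpace
    (wordSigma_le S) (wordSigma_le T) (indep_wordSigma ν h) hf hg

theorem lintegral_root_mul {K : ℝ → ℝ≥0∞} (hK : Measurable K) {f : Tree ℓ → ℝ≥0∞}
    (hf : Measurable f) (hr : RootFree f) :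
    ∫⁻ w, K (w []) * f w ∂treeLaw ℓ ν = (∫⁻ x, K x ∂ν) * ∫⁻ w, f w ∂treeLaw ℓ ν := by
  rw [lintegral_mul_of_disjoint ν (S := {[]}) (T := {ε | ε ≠ []})
    (f := fun w => K (w [])) (by simp)
    (hK.comp (measurable_eval_wordSigma (Set.mem_singleton _))) (hr.measurable_wordSigma hf),
    (measurePreserving_eval ν ([] : List (Fin ℓ))).lintegral_comp hK]

theorem lintegral_sub_mul_sub {i j : Fin ℓ} (hij : i ≠ j) {f g : Tree ℓ → ℝ≥0∞}
    (hf : Measurable f) (hg : Measurable g) :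
    ∫⁻ w, f (sub i w) * g (sub j w) ∂treeLaw ℓ ν
      = (∫⁻ w, f w ∂treeLaw ℓ ν) * ∫⁻ w, g w ∂treeLaw ℓ ν := by
  rw [lintegral_mul_of_disjoint ν (S := {ε | ε.head? = some i}) (T := {ε | ε.head? = some j})
    (f := fun w => f (sub i w)) (g := fun w => g (sub j w)) (by
      rw [Set.disjoint_left]
      intro ε h1 h2
      simp only [Set.mem_ofPred_eq] at h1 h2
      exact hij (by simpa [h1] using h2))
    (hf.comp (measurable_sub_wordSigma (by simp)))
    (hg.comp (measurable_sub_wordSigma (by simp))),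
    (measurePreserving_sub ν i).lintegral_comp hf, (measurePreserving_sub ν j).lintegral_comp hg]

theorem lintegral_sub_mul_sum_sub (i : Fin ℓ) {f g : Tree ℓ → ℝ≥0∞}
    (hf : Measurable f) (hg : Measurable g) {φ : ℝ≥0∞ → ℝ≥0∞} (hφ : Measurable φ) :
    ∫⁻ w, f (sub i w) * φ (∑ j ∈ Finset.univ.erase i, g (sub j w)) ∂treeLaw ℓ ν
      = (∫⁻ w, f w ∂treeLaw ℓ ν) *
        ∫⁻ w, φ (∑ j ∈ Finset.univ.erase i, g (sub j w)) ∂treeLaw ℓ ν := by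
  rw [lintegral_mul_of_disjoint ν (S := {ε | ε.head? = some i}) (T := {ε | ε.head? ≠ some i})
    (f := fun w => f (sub i w))
    (g := fun w => φ (∑ j ∈ Finset.univ.erase i, g (sub j w))) (by
      rw [Set.disjoint_left]
      intro ε h1 h2
      exact h2 h1)
    (hf.comp (measurable_sub_wordSigma (by simp))) ?_,
    (measurePreserving_sub ν i).lintegral_comp hf]
  refine hφ.comp (Finset.measurable_fun_sum _ fun j hj => hg.comp (measurable_sub_wordSigma ?_))
  intro δ
  simpa using (Finset.ne_of_mem_erase hj)

end Law

end Tree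

/-! ### Total masses and the mass martingale -/

section Mass

variable {ℓ : ℕ}

/-- The value at the word `ε` of the cascade with weights `c (w ε)` and with `f` as the mass of a
subtree: `ℓ⁻ⁿ c (w ε₁) ⋯ c (w (ε₁⋯εₙ)) f (w (ε ·))`. -/
noncomputable def cyl (c : ℝ → ℝ≥0) (f : Tree ℓ → ℝ≥0∞) : List (Fin ℓ) → Tree ℓ → ℝ≥0∞
  | [], w => f w
  | i :: δ, w => (ℓ : ℝ≥0∞)⁻¹ * c (w [i]) * cyl c f δ (sub i w)

/-- The total mass of the density of generation `n` of the cascade with weights `c (w ε)`. -/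
noncomputable def mass (c : ℝ → ℝ≥0) : ℕ → Tree ℓ → ℝ≥0∞
  | 0, _ => 1
  | n + 1, w => ∑ i : Fin ℓ, (ℓ : ℝ≥0∞)⁻¹ * c (w [i]) * mass c n (sub i w)

/-- The limit of the total masses; the lower limit makes it meaningful everywhere. -/
noncomputable def limMass (c : ℝ → ℝ≥0) (w : Tree ℓ) : ℝ≥0∞ :=
  liminf (fun n => mass c n w) atTop

theorem sum_words_succ {M : Type*} [AddCommMonoid M] (n : ℕ) (F : List (Fin ℓ) → M) :
    ∑ ε : Fin (n + 1) → Fin ℓ, F (List.ofFn ε)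
      = ∑ i : Fin ℓ, ∑ δ : Fin n → Fin ℓ, F (i :: List.ofFn δ) := by
  rw [← Fintype.sum_prod_type', ← (Fin.consEquiv fun _ => Fin ℓ).sum_comp]
  refine Finset.sum_congr rfl fun p _ => ?_
  congr 1
  simp [Fin.consEquiv, List.ofFn_succ]

variable (c : ℝ → ℝ≥0)

theorem cyl_eq_mul (f : Tree ℓ → ℝ≥0∞) (ε : List (Fin ℓ)) (w : Tree ℓ) :
    cyl c f ε w = cyl c 1 ε w * f (subAt ε w) := by
  induction ε generalizing w with
  | nil => simp only [cyl, Pi.one_apply, one_mul]; rfl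
  | cons i δ ih => simp only [cyl, ih (sub i w), mul_assoc]; rfl

/-- The mass of generation `n + r` is the sum over the words of length `n` of their weight times the
mass of generation `r` of their subtree. For `r = 0` it expresses `mass c n` through products of
weights. -/
theorem mass_add (n r : ℕ) (w : Tree ℓ) :
    mass c (n + r) w = ∑ ε : Fin n → Fin ℓ, cyl c (mass c r) (List.ofFn ε) w := by
  induction n generalizing w with
  | zero => simp [cyl]
  | succ n ih =>
    rw [sum_words_succ n (fun ε => cyl c (mass c r) ε w), Nat.add_right_comm]
    simp only [mass, cyl, ih, Finset.mul_sum]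

theorem mass_ne_top (hℓ : 0 < ℓ) (n : ℕ) (w : Tree ℓ) : mass c n w ≠ ∞ := by
  induction n generalizing w with
  | zero => simp [mass]
  | succ n ih =>
    simp only [mass]
    refine ENNReal.sum_ne_top.2 fun i _ => ?_
    refine ENNReal.mul_ne_top (ENNReal.mul_ne_top ?_ ENNReal.coe_ne_top) (ih _)
    simp; omega

variable {c}

theorem rootFree_mass (n : ℕ) : RootFree (ℓ := ℓ) (mass c n) := by
  intro w
  cases n <;> rfl

theorem rootFree_limMass : RootFree (ℓ := ℓ) (limMass c) := by
  intro w
  simp only [limMass, rootFree_mass _ w]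

theorem RootFree.cyl {f : Tree ℓ → ℝ≥0∞} (hf : RootFree f) (ε : List (Fin ℓ)) :
    RootFree (cyl c f ε) := by
  intro w
  cases ε with
  | nil => exact hf w
  | cons i δ => rfl

theorem measurable_wordSigma_iff {m : MeasurableSpace (Tree ℓ)} {T : Set (List (Fin ℓ))}
    {f : Tree ℓ → Tree ℓ} :
    Measurable[m, wordSigma T] f ↔ ∀ ε ∈ T, Measurable[m] fun w => f w ε := by
  simp only [measurable_iff_comap_le, wordSigma, MeasurableSpace.comap_iSup, iSup_le_iff,
    MeasurableSpace.comap_comp]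
  rfl

theorem measurable_cyl (hc : Measurable c) {f : Tree ℓ → ℝ≥0∞} (hf : Measurable f)
    (ε : List (Fin ℓ)) : Measurable (cyl c f ε) := by
  induction ε with
  | nil => exact hf
  | cons i δ ih =>
    have : Measurable fun w : Tree ℓ => cyl c f δ (sub i w) := ih.comp (measurable_sub i)
    change Measurable fun w : Tree ℓ => (ℓ : ℝ≥0∞)⁻¹ * c (w [i]) * cyl c f δ (sub i w)
    fun_prop

theorem measurable_mass (hc : Measurable c) (n : ℕ) : Measurable (mass (ℓ := ℓ) c n) := by
  induction n with
  | zero => exact measurable_const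
  | succ n ih =>
    have (i : Fin ℓ) : Measurable fun w : Tree ℓ => mass c n (sub i w) :=
      ih.comp (measurable_sub i)
    change Measurable fun w : Tree ℓ => ∑ i : Fin ℓ, (ℓ : ℝ≥0∞)⁻¹ * c (w [i]) * mass c n (sub i w)
    fun_prop

theorem measurable_limMass (hc : Measurable c) : Measurable (limMass (ℓ := ℓ) c) :=
  Measurable.liminf fun n => measurable_mass hc n

theorem measurable_sub_length (n : ℕ) (i : Fin ℓ) :
    Measurable[wordSigma {ε | ε.length ≤ n + 1}, wordSigma {ε | ε.length ≤ n}] (sub i) :=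
  measurable_wordSigma_iff.2 fun ε hε => measurable_eval_wordSigma (by simpa using hε)

theorem measurable_weight_wordSigma (hc : Measurable c) {S : Set (List (Fin ℓ))}
    {ε : List (Fin ℓ)} (h : ε ∈ S) :
    Measurable[wordSigma S] fun w : Tree ℓ => (ℓ : ℝ≥0∞)⁻¹ * c (w ε) :=
  (measurable_const.mul (measurable_coe_nnreal_ennreal.comp hc)).comp
    (measurable_eval_wordSigma h)

theorem measurable_cyl_wordSigma (hc : Measurable c) (n : ℕ) (ε : List (Fin ℓ))
    (hε : ε.length ≤ n) : Measurable[wordSigma {ε | ε.length ≤ n}] (cyl c 1 ε) := by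
  induction ε generalizing n with
  | nil => exact @measurable_const _ _ _ (wordSigma _) 1
  | cons i δ ih =>
    obtain ⟨n, rfl⟩ : ∃ m, n = m + 1 := ⟨n - 1, by simp at hε; omega⟩
    have h1 := (ih n (by simpa using hε)).comp (measurable_sub_length n i)
    exact (measurable_weight_wordSigma (S := {ε | ε.length ≤ n + 1}) (ε := [i]) hc
      (by simp)).mul h1

theorem measurable_mass_wordSigma (hc : Measurable c) (n : ℕ) :
    Measurable[wordSigma {ε | ε.length ≤ n}] (mass (ℓ := ℓ) c n) := by
  have : mass (ℓ := ℓ) c n = fun w => ∑ ε : Fin n → Fin ℓ, cyl c 1 (List.ofFn ε) w := by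
    funext w; exact mass_add c n 0 w
  rw [this]
  exact @Finset.measurable_fun_sum _ _ _ _ _ _ (wordSigma _) _ _
    fun ε _ => measurable_cyl_wordSigma hc n _ (by simp)

section Law

variable {ν : Measure ℝ} [IsProbabilityMeasure ν]

theorem lintegral_mass (hℓ : 0 < ℓ) (hc : Measurable c) (h1 : ∫⁻ x, c x ∂ν = 1) (n : ℕ) :
    ∫⁻ w, mass c n w ∂treeLaw ℓ ν = 1 := by
  have hℓ0 : (ℓ : ℝ≥0∞) ≠ 0 := by simp; omega
  induction n with
  | zero => simp [mass]
  | succ n ih =>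
    have hm := measurable_mass (ℓ := ℓ) hc n
    have key (i : Fin ℓ) : ∫⁻ w, (ℓ : ℝ≥0∞)⁻¹ * c (w [i]) * mass c n (sub i w) ∂treeLaw ℓ ν
        = (ℓ : ℝ≥0∞)⁻¹ := by
      have := (measurePreserving_sub (ℓ := ℓ) ν i).lintegral_comp
        (f := fun w => (ℓ : ℝ≥0∞)⁻¹ * c (w []) * mass c n w) (by fun_prop)
      refine this.trans ?_
      rw [lintegral_root_mul ν (K := fun x => (ℓ : ℝ≥0∞)⁻¹ * c x) (by fun_prop) hm
        (rootFree_mass n), ih, lintegral_const_mul _ (by fun_prop), h1]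
      simp
    have hm' (i : Fin ℓ) : Measurable fun w : Tree ℓ => mass c n (sub i w) :=
      hm.comp (measurable_sub i)
    simp only [mass]
    rw [lintegral_finsetSum _ fun i _ => by fun_prop]
    simp only [key]
    simp [ENNReal.mul_inv_cancel hℓ0]

/-- The filtration of the weights of the words of length at most `n`. -/
def lengthFiltration (ℓ : ℕ) : Filtration ℕ (MeasurableSpace.pi : MeasurableSpace (Tree ℓ)) where
  seq n := wordSigma {ε | ε.length ≤ n}
  mono' _ _ h := wordSigma_mono fun _ hε => le_trans hε h
  le' _ := wordSigma_le _

/-- The martingale property. Conditionally on the weights of the words of length at most `n`, the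
subtree of a word of length `n` has expected mass `1` in its first generation. -/
theorem setLIntegral_mass_succ (hℓ : 0 < ℓ) (hc : Measurable c) (h1 : ∫⁻ x, c x ∂ν = 1) (n : ℕ)
    {s : Set (Tree ℓ)} (hs : MeasurableSet[wordSigma {ε | ε.length ≤ n}] s) :
    ∫⁻ w in s, mass c (n + 1) w ∂treeLaw ℓ ν = ∫⁻ w in s, mass c n w ∂treeLaw ℓ ν := by
  have hs' : MeasurableSet s := wordSigma_le _ _ hs
  have hcyl (ε : List (Fin ℓ)) : Measurable (cyl c 1 ε) := measurable_cyl hc measurable_const ε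
  have hm1 := measurable_mass (ℓ := ℓ) hc 1
  have hcyl1 (ε : List (Fin ℓ)) : Measurable (cyl c (mass c 1) ε) := measurable_cyl hc hm1 ε
  have e1 : mass c n = fun w : Tree ℓ => ∑ ε : Fin n → Fin ℓ, cyl c 1 (List.ofFn ε) w := by
    funext w; exact mass_add c n 0 w
  have e2 : mass c (n + 1)
      = fun w : Tree ℓ => ∑ ε : Fin n → Fin ℓ, cyl c (mass c 1) (List.ofFn ε) w := by
    funext w; exact mass_add c n 1 w
  rw [e1, e2, lintegral_finsetSum _ fun _ _ => hcyl1 _, lintegral_finsetSum _ fun _ _ => hcyl _]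
  refine Finset.sum_congr rfl fun ε _ => ?_
  rw [← lintegral_indicator hs', ← lintegral_indicator hs']
  have hf : Measurable[wordSigma {ε | ε.length ≤ n}] (s.indicator (cyl c 1 (List.ofFn ε))) :=
    (measurable_cyl_wordSigma hc n _ (by simp)).indicator hs
  have hg : Measurable[wordSigma {ε | ε.length = n + 1}]
      (fun w : Tree ℓ => mass c 1 (subAt (List.ofFn ε) w)) := by
    simp only [mass, mul_one]
    exact @Finset.measurable_fun_sum _ _ _ _ _ _ (wordSigma _) _ _
      fun i _ => measurable_weight_wordSigma hc (by simp)
  have hdisj : Disjoint {ε : List (Fin ℓ) | ε.length ≤ n} {ε | ε.length = n + 1} := by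
    rw [Set.disjoint_left]
    intro ε h2 h3
    simp only [Set.mem_ofPred_eq] at h2 h3
    omega
  have := lintegral_mul_of_disjoint ν hdisj hf hg
  rw [(measurePreserving_subAt ν (List.ofFn ε)).lintegral_comp hm1, lintegral_mass hℓ hc h1,
    mul_one] at this
  rw [← this]
  refine lintegral_congr fun w => ?_
  by_cases hw : w ∈ s <;> simp [hw, cyl_eq_mul c (mass c 1)]

theorem martingale_mass (hℓ : 0 < ℓ) (hc : Measurable c) (h1 : ∫⁻ x, c x ∂ν = 1) :
    Martingale (fun n (w : Tree ℓ) => (mass c n w).toReal) (lengthFiltration ℓ) (treeLaw ℓ ν) := by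
  have hmeas := fun n => measurable_mass (ℓ := ℓ) hc n
  refine martingale_of_setIntegral_eq_succ ?_ ?_ ?_
  · intro n
    exact (measurable_mass_wordSigma hc n).ennreal_toReal.stronglyMeasurable
  · intro n
    refine integrable_toReal_of_lintegral_ne_top (hmeas n).aemeasurable ?_
    simp [lintegral_mass hℓ hc h1]
  · intro n s hs
    rw [integral_toReal (hmeas n).aemeasurable (ae_of_all _ fun w => (mass_ne_top c hℓ n w).lt_top),
      integral_toReal (hmeas (n + 1)).aemeasurable
        (ae_of_all _ fun w => (mass_ne_top c hℓ (n + 1) w).lt_top),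
      setLIntegral_mass_succ hℓ hc h1 n hs]

theorem ae_tendsto_mass (hℓ : 0 < ℓ) (hc : Measurable c) (h1 : ∫⁻ x, c x ∂ν = 1) :
    ∀ᵐ w ∂treeLaw ℓ ν, limMass c w ≠ ∞ ∧
      Tendsto (fun n => mass c n w) atTop (𝓝 (limMass c w)) := by
  have hM := (martingale_mass hℓ hc h1).submartingale.exists_ae_tendsto_of_bdd (R := 1) fun n => by
    rw [eLpNorm_one_eq_lintegral_enorm]
    refine le_of_eq ?_
    rw [ENNReal.coe_one, ← lintegral_mass hℓ hc h1 n]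
    refine lintegral_congr fun w => ?_
    rw [Real.enorm_eq_ofReal ENNReal.toReal_nonneg, ENNReal.ofReal_toReal (mass_ne_top c hℓ n w)]
  filter_upwards [hM] with w ⟨x, hx⟩
  have : Tendsto (fun n => mass c n w) atTop (𝓝 (ENNReal.ofReal x)) := by
    refine (ENNReal.tendsto_ofReal hx).congr fun n => ?_
    rw [ENNReal.ofReal_toReal (mass_ne_top c hℓ n w)]
  have h2 : limMass c w = ENNReal.ofReal x := this.liminf_eq
  rw [h2]
  exact ⟨ENNReal.ofReal_ne_top, this⟩

/-- The masses of all subtrees converge to finite limits. -/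
def Converges (c : ℝ → ℝ≥0) (w : Tree ℓ) : Prop :=
  ∀ ε, limMass c (subAt ε w) ≠ ∞ ∧
    Tendsto (fun n => mass c n (subAt ε w)) atTop (𝓝 (limMass c (subAt ε w)))

theorem ae_converges (hℓ : 0 < ℓ) (hc : Measurable c) (h1 : ∫⁻ x, c x ∂ν = 1) :
    ∀ᵐ w ∂treeLaw ℓ ν, Converges c w :=
  ae_all_iff.2 fun ε =>
    (measurePreserving_subAt ν ε).quasiMeasurePreserving.ae (ae_tendsto_mass hℓ hc h1)

end Law

theorem Converges.limMass_eq {w : Tree ℓ} (hℓ : 0 < ℓ) (h : Converges c w) :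
    limMass c w = ∑ i : Fin ℓ, (ℓ : ℝ≥0∞)⁻¹ * c (w [i]) * limMass c (sub i w) := by
  have h1 : Tendsto (fun n => mass c (n + 1) w) atTop (𝓝 (limMass c w)) :=
    (h []).2.comp (tendsto_add_atTop_nat 1)
  refine tendsto_nhds_unique h1 (tendsto_finsetSum _ fun i _ => ?_)
  refine ENNReal.Tendsto.const_mul (h [i]).2 (Or.inr ?_)
  refine ENNReal.mul_ne_top ?_ ENNReal.coe_ne_top
  simp; omega

theorem lintegral_limMass_le {ν : Measure ℝ} [IsProbabilityMeasure ν] (hℓ : 0 < ℓ)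
    (hc : Measurable c) (h1 : ∫⁻ x, c x ∂ν = 1) :
    ∫⁻ w, limMass c w ∂treeLaw ℓ ν ≤ 1 := by
  refine (lintegral_liminf_le fun n => measurable_mass hc n).trans ?_
  simp [lintegral_mass hℓ hc h1]

end Mass

/-! ### Positive moments of the total mass -/

/-- For every `η > 0`, `(x + y) ^ r ≤ (1 + η) x ^ r + C y ^ r` with a constant `C`. -/
theorem exists_add_rpow_le (r : ℝ) (hr : 0 ≤ r) (η : ℝ≥0) (hη : 0 < η) :
    ∃ C : ℝ≥0, ∀ x y : ℝ≥0∞, (x + y) ^ r ≤ (1 + η) * x ^ r + C * y ^ r := by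
  obtain ⟨θ, hθ0, hθ⟩ : ∃ θ : ℝ≥0, 0 < θ ∧ (1 + θ) ^ r ≤ 1 + η := by
    have h1 : Tendsto (fun θ : ℝ≥0 => (1 + θ) ^ r) (𝓝 0) (𝓝 ((1 + 0) ^ r)) :=
      ((NNReal.continuous_rpow_const hr).comp (continuous_const.add continuous_id)).tendsto 0
    have h2 : ∀ᶠ θ : ℝ≥0 in 𝓝 0, (1 + θ) ^ r < 1 + η :=
      h1.eventually (gt_mem_nhds (by simpa using hη))
    obtain ⟨θ, h3, h4⟩ := ((h2.filter_mono nhdsWithin_le_nhds).and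
      (self_mem_nhdsWithin (s := Set.Ioi (0 : ℝ≥0)))).exists
    exact ⟨θ, h4, h3.le⟩
  refine ⟨(θ⁻¹ + 1) ^ r, fun x y => ?_⟩
  rcases le_total y (θ * x) with h | h
  · calc (x + y) ^ r ≤ ((1 + θ : ℝ≥0) * x) ^ r := by
          refine ENNReal.rpow_le_rpow ?_ hr
          push_cast
          rw [add_mul, one_mul]
          gcongr
      _ = ((1 + θ) ^ r : ℝ≥0) * x ^ r := by
          rw [ENNReal.mul_rpow_of_nonneg _ _ hr, ENNReal.coe_rpow_of_nonneg _ hr]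
      _ ≤ (1 + η) * x ^ r := by
          gcongr
          exact_mod_cast hθ
      _ ≤ _ := le_self_add
  · have hx : x ≤ (θ⁻¹ : ℝ≥0) * y := by
      calc x = (θ⁻¹ * θ : ℝ≥0) * x := by rw [inv_mul_cancel₀ hθ0.ne']; simp
        _ = (θ⁻¹ : ℝ≥0) * (θ * x) := by push_cast; ring
        _ ≤ _ := by gcongr
    calc (x + y) ^ r ≤ ((θ⁻¹ + 1 : ℝ≥0) * y) ^ r := by
          refine ENNReal.rpow_le_rpow ?_ hr
          push_cast
          rw [add_mul, one_mul]
          gcongr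
      _ = ((θ⁻¹ + 1) ^ r : ℝ≥0) * y ^ r := by
          rw [ENNReal.mul_rpow_of_nonneg _ _ hr, ENNReal.coe_rpow_of_nonneg _ hr]
      _ ≤ _ := le_add_self

theorem rpow_le_rpow_of_nonpos {x y : ℝ≥0∞} {z : ℝ} (h : x ≤ y) (hz : z ≤ 0) :
    y ^ z ≤ x ^ z := by
  obtain ⟨s, rfl⟩ : ∃ s, z = -s := ⟨-z, by ring⟩
  rw [ENNReal.rpow_neg, ENNReal.rpow_neg, ENNReal.inv_le_inv]
  exact ENNReal.rpow_le_rpow h (by linarith)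

theorem rpow_le_one_add {r : ℝ} (h0 : 0 ≤ r) (h1 : r ≤ 1) (x : ℝ≥0∞) : x ^ r ≤ 1 + x := by
  rcases le_total x 1 with h | h
  · exact (ENNReal.rpow_le_one h h0).trans le_self_add
  · refine (ENNReal.rpow_le_rpow_of_exponent_le h h1).trans ?_
    rw [ENNReal.rpow_one]
    exact le_add_self

theorem exists_bound_of_affine_recursion {u : ℕ → ℝ≥0∞} {ρ D : ℝ≥0∞} (hρ : ρ < 1) (hD : D ≠ ∞)
    (h0 : u 0 ≠ ∞) (h : ∀ n, u (n + 1) ≤ ρ * u n + D) : ∃ B ≠ ∞, ∀ n, u n ≤ B := by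
  have h1 : 1 - ρ ≠ 0 := (tsub_pos_of_lt hρ).ne'
  have h1' : 1 - ρ ≠ ∞ := ENNReal.sub_ne_top ENNReal.one_ne_top
  refine ⟨u 0 + D / (1 - ρ), ENNReal.add_ne_top.2 ⟨h0, ENNReal.div_ne_top hD h1⟩, fun n => ?_⟩
  induction n with
  | zero => exact le_self_add
  | succ n ih =>
    refine (h n).trans ?_
    calc ρ * u n + D ≤ ρ * (u 0 + D / (1 - ρ)) + (1 - ρ) * (D / (1 - ρ)) := by
          gcongr
          rw [ENNReal.mul_div_cancel h1 h1']
      _ = ρ * u 0 + (ρ + (1 - ρ)) * (D / (1 - ρ)) := by ring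
      _ = ρ * u 0 + D / (1 - ρ) := by rw [add_tsub_cancel_of_le hρ.le, one_mul]
      _ ≤ u 0 + D / (1 - ρ) := by
          gcongr
          exact mul_le_of_le_one_left zero_le hρ.le

section

variable {ℓ : ℕ}

/-- The weighted mass `ℓ⁻¹ c (w ∅) f w` which a subtree contributes to the tree. -/
noncomputable def weighted (c : ℝ → ℝ≥0) (f : Tree ℓ → ℝ≥0∞) (w : Tree ℓ) : ℝ≥0∞ :=
  (ℓ : ℝ≥0∞)⁻¹ * c (w []) * f w

/-- The sum `ℓ E[(ℓ⁻¹ c) ^ r]` of the `r`-th moments of the weights of the first generation, which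
is `ℓ ^ τ(r)`. -/
noncomputable def scaling (ℓ : ℕ) (ν : Measure ℝ) (c : ℝ → ℝ≥0) (r : ℝ) : ℝ≥0∞ :=
  (ℓ : ℝ≥0∞) * ∫⁻ x, ((ℓ : ℝ≥0∞)⁻¹ * c x) ^ r ∂ν

variable {c : ℝ → ℝ≥0}

@[fun_prop]
theorem measurable_weighted (hc : Measurable c) {f : Tree ℓ → ℝ≥0∞} (hf : Measurable f) :
    Measurable (weighted c f) := by
  unfold weighted; fun_prop

theorem mass_succ_eq (n : ℕ) (w : Tree ℓ) :
    mass c (n + 1) w = ∑ i : Fin ℓ, weighted c (mass c n) (sub i w) := rfl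

theorem inv_mul_coe_ne_top (hℓ : 0 < ℓ) (x : ℝ) : (ℓ : ℝ≥0∞)⁻¹ * c x ≠ ∞ := by
  refine ENNReal.mul_ne_top ?_ ENNReal.coe_ne_top
  simp; omega

theorem inv_mul_coe_ne_zero (hpos : ∀ x, 0 < c x) (x : ℝ) : (ℓ : ℝ≥0∞)⁻¹ * c x ≠ 0 := by
  refine mul_ne_zero (by simp) (by simpa using (hpos x).ne')

/-- Multiplicativity of real powers in `ℝ≥0∞`, for all exponents, when one factor is positive and
finite. -/
theorem mul_rpow_of_pos_of_finite {x : ℝ≥0∞} (h0 : x ≠ 0) (ht : x ≠ ∞) (y : ℝ≥0∞) (r : ℝ) :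
    (x * y) ^ r = x ^ r * y ^ r := by
  rw [ENNReal.mul_rpow_eq_ite]
  simp [h0, ht]

section Law

variable {ν : Measure ℝ} [IsProbabilityMeasure ν]

theorem lintegral_weighted_rpow (hℓ : 0 < ℓ) (hc : Measurable c) (hpos : ∀ x, 0 < c x)
    {f : Tree ℓ → ℝ≥0∞} (hf : Measurable f) (hr : RootFree f) (r : ℝ) :
    ∫⁻ w, weighted c f w ^ r ∂treeLaw ℓ ν
      = (∫⁻ x, ((ℓ : ℝ≥0∞)⁻¹ * c x) ^ r ∂ν) * ∫⁻ w, f w ^ r ∂treeLaw ℓ ν := by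
  rw [← lintegral_root_mul ν (by fun_prop) (hf.pow_const r) (fun w => by rw [hr w])]
  refine lintegral_congr fun w => ?_
  exact mul_rpow_of_pos_of_finite (inv_mul_coe_ne_zero hpos _) (inv_mul_coe_ne_top hℓ _) _ _

/-- Writing the mass as a sum of independent terms `A_i`, one has `(∑ A_i) ^ r = ∑ A_i (A_i + ∑_{j
≠ i} A_j) ^ (r - 1)`. The diagonal part is `(1 + η) ∑ A_i ^ r`, which brings in the factor `scaling
ℓ ν c r`, and by independence the rest only involves moments of order `1` and `r - 1`. -/
theorem lintegral_mass_succ_rpow_le (hℓ : 0 < ℓ) (hc : Measurable c) (hpos : ∀ x, 0 < c x)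
    (h1 : ∫⁻ x, c x ∂ν = 1) {r : ℝ} (hr : 1 ≤ r) (η : ℝ≥0) (C : ℝ≥0)
    (hC : ∀ x y : ℝ≥0∞, (x + y) ^ (r - 1) ≤ (1 + η) * x ^ (r - 1) + C * y ^ (r - 1)) (n : ℕ) :
    ∫⁻ w, mass c (n + 1) w ^ r ∂treeLaw ℓ ν
      ≤ (1 + η) * scaling ℓ ν c r * ∫⁻ w, mass c n w ^ r ∂treeLaw ℓ ν
        + C * ∫⁻ w, mass c (n + 1) w ^ (r - 1) ∂treeLaw ℓ ν := by
  classical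
  have hr1 : 0 ≤ r - 1 := by linarith
  have hℓ0 : (ℓ : ℝ≥0∞) ≠ 0 := by simp; omega
  set A : Tree ℓ → ℝ≥0∞ := weighted c (mass c n) with hA
  have hAm : Measurable A := measurable_weighted hc (measurable_mass hc n)
  have hAs (i : Fin ℓ) : Measurable fun w : Tree ℓ => A (sub i w) := hAm.comp (measurable_sub i)
  have hpow (x : ℝ≥0∞) : x * x ^ (r - 1) = x ^ r := by
    conv_lhs => rw [← ENNReal.rpow_one x]
    rw [← ENNReal.rpow_mul, one_mul, ← ENNReal.rpow_add_of_nonneg _ _ zero_le_one hr1]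
    congr 1; ring
  have hpt (w : Tree ℓ) : mass c (n + 1) w ^ r ≤ ∑ i : Fin ℓ, ((1 + η) * A (sub i w) ^ r
      + C * (A (sub i w) * (∑ j ∈ Finset.univ.erase i, A (sub j w)) ^ (r - 1))) := by
    rw [mass_succ_eq, ← hpow, Finset.sum_mul]
    refine Finset.sum_le_sum fun i _ => ?_
    calc A (sub i w) * (∑ j, A (sub j w)) ^ (r - 1)
        = A (sub i w) * (A (sub i w) + ∑ j ∈ Finset.univ.erase i, A (sub j w)) ^ (r - 1) := by
          rw [Finset.add_sum_erase _ (fun j => A (sub j w)) (Finset.mem_univ i)]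
      _ ≤ A (sub i w) * ((1 + η) * A (sub i w) ^ (r - 1)
          + C * (∑ j ∈ Finset.univ.erase i, A (sub j w)) ^ (r - 1)) := by
          gcongr
          exact hC _ _
      _ = _ := by rw [← hpow]; ring
  have hEA : ∫⁻ w, A w ∂treeLaw ℓ ν = (ℓ : ℝ≥0∞)⁻¹ := by
    have : ∫⁻ w, A w ∂treeLaw ℓ ν = _ :=
      lintegral_root_mul ν (K := fun x => (ℓ : ℝ≥0∞)⁻¹ * c x) (by fun_prop)
        (measurable_mass (ℓ := ℓ) hc n) (rootFree_mass n)
    rw [this, lintegral_mass hℓ hc h1, lintegral_const_mul _ (by fun_prop), h1, mul_one, mul_one]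
  refine (lintegral_mono hpt).trans ?_
  rw [lintegral_finsetSum _ fun i _ => by fun_prop]
  have key (i : Fin ℓ) : ∫⁻ w, ((1 + η) * A (sub i w) ^ r
      + C * (A (sub i w) * (∑ j ∈ Finset.univ.erase i, A (sub j w)) ^ (r - 1))) ∂treeLaw ℓ ν
      ≤ (1 + η) * ((∫⁻ x, ((ℓ : ℝ≥0∞)⁻¹ * c x) ^ r ∂ν) * ∫⁻ w, mass c n w ^ r ∂treeLaw ℓ ν)
        + C * ((ℓ : ℝ≥0∞)⁻¹ * ∫⁻ w, mass c (n + 1) w ^ (r - 1) ∂treeLaw ℓ ν) := by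
    rw [lintegral_add_left (by fun_prop), lintegral_const_mul _ (by fun_prop),
      lintegral_const_mul _ (by fun_prop),
      (measurePreserving_sub (ℓ := ℓ) ν i).lintegral_comp (f := fun w => A w ^ r) (by fun_prop),
      lintegral_weighted_rpow hℓ hc hpos (measurable_mass hc n) (rootFree_mass n),
      lintegral_sub_mul_sum_sub ν i hAm hAm (φ := fun x => x ^ (r - 1)) (by fun_prop), hEA]
    gcongr with w
    rw [mass_succ_eq]
    exact Finset.sum_le_sum_of_subset (Finset.erase_subset _ _)
  refine (Finset.sum_le_sum fun i _ => key i).trans (le_of_eq ?_)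
  rw [Finset.sum_const, Finset.card_univ, Fintype.card_fin, nsmul_eq_mul, scaling, mul_add]
  congr 1
  · ring
  · rw [mul_left_comm, ← mul_assoc (ℓ : ℝ≥0∞), ENNReal.mul_inv_cancel hℓ0 (by simp), one_mul]

/-- By induction on the integer part of `r`: the bound for `r - 1` turns the moments of order `r`
into a sequence with an affine recursion of ratio less than `1`. -/
theorem exists_bound_lintegral_mass_rpow (hℓ : 0 < ℓ) (hc : Measurable c) (hpos : ∀ x, 0 < c x)
    (h1 : ∫⁻ x, c x ∂ν = 1) {r : ℝ} (hr : 0 ≤ r)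
    (hρ : ∀ s, 1 < s → s ≤ r → scaling ℓ ν c s < 1) :
    ∃ B ≠ ∞, ∀ n, ∫⁻ w, mass c n w ^ r ∂treeLaw ℓ ν ≤ B := by
  obtain ⟨N, hN⟩ := exists_nat_ge r
  induction N generalizing r with
  | zero =>
    have : r = 0 := le_antisymm (by simpa using hN) hr
    exact ⟨1, by simp, fun n => by simp [this]⟩
  | succ N ih =>
    rcases le_or_gt r 1 with h | h
    · refine ⟨2, by simp, fun n => ?_⟩
      refine (lintegral_mono fun w => rpow_le_one_add hr h _).trans ?_
      rw [lintegral_add_left measurable_const, lintegral_mass hℓ hc h1]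
      simp [one_add_one_eq_two]
    obtain ⟨B, hB, hBn⟩ := ih (r := r - 1) (by linarith) (fun s hs1 hs2 => hρ s hs1 (by linarith))
      (by push_cast at hN; linarith)
    have hlt := hρ r h le_rfl
    obtain ⟨η, hη0, hη⟩ : ∃ η : ℝ≥0, 0 < η ∧ (1 + η) * scaling ℓ ν c r < 1 := by
      set κ := (scaling ℓ ν c r).toNNReal
      have hκ : scaling ℓ ν c r = κ := (ENNReal.coe_toNNReal hlt.ne_top).symm
      rw [hκ] at hlt ⊢
      have hκ1 : κ < 1 := by exact_mod_cast hlt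
      have h1 : Tendsto (fun η : ℝ≥0 => (1 + η) * κ) (𝓝 0) (𝓝 ((1 + 0) * κ)) :=
        ((continuous_const.add continuous_id).mul continuous_const).tendsto 0
      have h2 : ∀ᶠ η : ℝ≥0 in 𝓝 0, (1 + η) * κ < 1 :=
        h1.eventually (gt_mem_nhds (by simpa using hκ1))
      obtain ⟨η, h3, h4⟩ := ((h2.filter_mono nhdsWithin_le_nhds).and
        (self_mem_nhdsWithin (s := Set.Ioi (0 : ℝ≥0)))).exists
      exact ⟨η, h4, by exact_mod_cast h3⟩
    obtain ⟨C, hC⟩ := exists_add_rpow_le (r - 1) (by linarith) η hη0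
    refine exists_bound_of_affine_recursion hη (D := C * B) (ENNReal.mul_ne_top (by simp) hB)
      (by simp [mass]) fun n => ?_
    refine (lintegral_mass_succ_rpow_le hℓ hc hpos h1 h.le η C hC n).trans ?_
    gcongr
    exact hBn _

theorem lintegral_limMass_rpow_ne_top (hℓ : 0 < ℓ) (hc : Measurable c) (hpos : ∀ x, 0 < c x)
    (h1 : ∫⁻ x, c x ∂ν = 1) {r : ℝ} (hr : 0 ≤ r)
    (hρ : ∀ s, 1 < s → s ≤ r → scaling ℓ ν c s < 1) :
    ∫⁻ w, limMass c w ^ r ∂treeLaw ℓ ν ≠ ∞ := by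
  obtain ⟨B, hB, hBn⟩ := exists_bound_lintegral_mass_rpow hℓ hc hpos h1 hr hρ
  refine ne_top_of_le_ne_top hB ?_
  calc ∫⁻ w, limMass c w ^ r ∂treeLaw ℓ ν
      = ∫⁻ w, liminf (fun n => mass c n w ^ r) atTop ∂treeLaw ℓ ν := by
        refine lintegral_congr_ae ?_
        filter_upwards [ae_tendsto_mass hℓ hc h1] with w hw
        exact (((ENNReal.continuous_rpow_const).tendsto _).comp hw.2).liminf_eq.symm
    _ ≤ liminf (fun n => ∫⁻ w, mass c n w ^ r ∂treeLaw ℓ ν) atTop :=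
        lintegral_liminf_le fun n => (measurable_mass hc n).pow_const r
    _ ≤ B := by
        refine (liminf_le_liminf (Eventually.of_forall hBn)).trans ?_
        simp

/-- Boundedness of the total masses in `L^p` for some `p > 1` forces a nonzero limit. -/
theorem not_ae_limMass_eq_zero (hℓ : 0 < ℓ) (hc : Measurable c) (hpos : ∀ x, 0 < c x)
    (h1 : ∫⁻ x, c x ∂ν = 1) {p : ℝ} (hp : 1 < p)
    (hρ : ∀ s, 1 < s → s ≤ p → scaling ℓ ν c s < 1) :
    ¬ ∀ᵐ w ∂treeLaw ℓ ν, limMass (ℓ := ℓ) c w = 0 := by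
  intro h0
  obtain ⟨B, hB, hBn⟩ :=
    exists_bound_lintegral_mass_rpow hℓ hc hpos h1 (zero_le_one.trans hp.le) hρ
  -- If the masses tended to `0`, so would their truncations at `K`, and the whole expectation `1`
  -- would be carried by the part above `K`, which is at most `K ^ (1 - p) B`.
  have hK (K : ℝ≥0) (hK0 : 0 < K) : 1 ≤ (K : ℝ≥0∞) ^ (1 - p) * B := by
    have hlim : Tendsto (fun n => ∫⁻ w, min (mass c n w) K ∂treeLaw ℓ ν) atTop
        (𝓝 (∫⁻ w, (0 : ℝ≥0∞) ∂treeLaw ℓ ν)) := by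
      refine tendsto_lintegral_of_dominated_convergence (fun _ => (K : ℝ≥0∞))
        (fun n => (measurable_mass hc n).min measurable_const)
        (fun n => ae_of_all _ fun w => min_le_right _ _) (by simp) ?_
      filter_upwards [h0, ae_tendsto_mass hℓ hc h1] with w hw1 hw2
      have := hw2.2.min (tendsto_const_nhds (x := (K : ℝ≥0∞)))
      simpa [hw1] using this
    have hle (n : ℕ) : 1 ≤ (∫⁻ w, min (mass c n w) K ∂treeLaw ℓ ν)
        + (K : ℝ≥0∞) ^ (1 - p) * B := by
      calc 1 = ∫⁻ w, mass c n w ∂treeLaw ℓ ν := (lintegral_mass hℓ hc h1 n).symm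
        _ ≤ ∫⁻ w, (min (mass c n w) K + (K : ℝ≥0∞) ^ (1 - p) * mass c n w ^ p)
            ∂treeLaw ℓ ν := by
            refine lintegral_mono fun w => ?_
            rcases le_total (mass c n w) K with h | h
            · rw [min_eq_left h]; exact le_self_add
            · refine le_trans ?_ le_add_self
              have hx0 : mass c n w ≠ 0 := fun h' => by simp [h', hK0.ne'] at h
              calc mass c n w = mass c n w ^ (1 - p) * mass c n w ^ p := by
                    rw [← ENNReal.rpow_add _ _ hx0 (mass_ne_top c hℓ n w)]
                    simp
                _ ≤ _ := by
                    refine mul_le_mul_left ?_ _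
                    exact rpow_le_rpow_of_nonpos h (by linarith)
        _ = (∫⁻ w, min (mass c n w) K ∂treeLaw ℓ ν)
            + (K : ℝ≥0∞) ^ (1 - p) * ∫⁻ w, mass c n w ^ p ∂treeLaw ℓ ν := by
            rw [lintegral_add_left ((measurable_mass hc n).min measurable_const),
              lintegral_const_mul _ ((measurable_mass hc n).pow_const p)]
        _ ≤ _ := by
            gcongr
            exact hBn n
    have := ge_of_tendsto' (hlim.add tendsto_const_nhds) hle
    simpa using this
  have hlim : Tendsto (fun n : ℕ => (n : ℝ≥0∞) ^ (1 - p) * B) atTop (𝓝 (∞ ^ (1 - p) * B)) :=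
    ENNReal.Tendsto.mul_const
      ((ENNReal.continuous_rpow_const.tendsto _).comp ENNReal.tendsto_nat_nhds_top) (Or.inr hB)
  rw [ENNReal.top_rpow_of_neg (by linarith), zero_mul] at hlim
  have := ge_of_tendsto hlim ((eventually_gt_atTop 0).mono fun n hn => by
    simpa using hK n (by exact_mod_cast hn))
  simp at this

/-- The limit mass vanishes with probability `0` or `1`: if it vanishes, it vanishes on two
independent subtrees. -/
theorem ae_limMass_ne_zero (hℓ : 2 ≤ ℓ) (hc : Measurable c) (hpos : ∀ x, 0 < c x)
    (h1 : ∫⁻ x, c x ∂ν = 1) (h0 : ¬ ∀ᵐ w ∂treeLaw ℓ ν, limMass (ℓ := ℓ) c w = 0) :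
    ∀ᵐ w ∂treeLaw ℓ ν, limMass (ℓ := ℓ) c w ≠ 0 := by
  set S : Set (Tree ℓ) := {w | limMass c w = 0} with hS
  have hSm : MeasurableSet S := measurable_limMass hc (measurableSet_singleton 0)
  let i : Fin ℓ := ⟨0, by omega⟩
  let j : Fin ℓ := ⟨1, by omega⟩
  have hle : treeLaw ℓ ν S ≤ treeLaw ℓ ν S * treeLaw ℓ ν S := by
    have h2 := lintegral_sub_mul_sub ν (i := i) (j := j) (by simp [i, j])
      (f := S.indicator 1) (g := S.indicator 1) (measurable_one.indicator hSm)
      (measurable_one.indicator hSm)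
    rw [lintegral_indicator_one hSm] at h2
    rw [← h2, ← lintegral_indicator_one hSm]
    refine lintegral_mono_ae ?_
    filter_upwards [ae_converges (by omega) hc h1] with w hw
    by_cases hwS : w ∈ S
    · have h3 := hw.limMass_eq (by omega)
      rw [show limMass c w = 0 from hwS, eq_comm, Finset.sum_eq_zero_iff] at h3
      have h4 (k : Fin ℓ) : sub k w ∈ S := by
        have := h3 k (Finset.mem_univ k)
        exact (mul_eq_zero.1 this).resolve_left (inv_mul_coe_ne_zero hpos _)
      simp [h4, Set.indicator_of_mem hwS]
    · simp [hwS]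
  have hp1 : treeLaw ℓ ν S ≠ 1 := by
    rw [Ne, ← mem_ae_iff_prob_eq_one hSm]
    exact h0
  have hp0 : treeLaw ℓ ν S = 0 := by
    by_contra hne
    have hfin : treeLaw ℓ ν S ≠ ∞ := measure_ne_top _ _
    have : 1 ≤ treeLaw ℓ ν S := by
      rw [← ENNReal.mul_le_mul_iff_right hne hfin, mul_one]
      exact hle
    exact hp1 (le_antisymm prob_le_one this)
  exact measure_eq_zero_iff_ae_notMem.1 hp0

end Law
end

/-! ### Negative moments of the total mass -/

section

variable {ℓ : ℕ} {c : ℝ → ℝ≥0}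

theorem lintegral_sub_comp {ν : Measure ℝ} [IsProbabilityMeasure ν] (i : Fin ℓ)
    {f : Tree ℓ → ℝ≥0∞} (hf : Measurable f) :
    ∫⁻ w, f (sub i w) ∂treeLaw ℓ ν = ∫⁻ w, f w ∂treeLaw ℓ ν :=
  (measurePreserving_sub ν i).lintegral_comp hf

theorem Converges.limMass_eq_sum_weighted {w : Tree ℓ} (hℓ : 0 < ℓ) (h : Converges c w) :
    limMass c w = ∑ i : Fin ℓ, weighted c (limMass c) (sub i w) :=
  h.limMass_eq hℓ

theorem Converges.weighted_le_limMass {w : Tree ℓ} (hℓ : 0 < ℓ) (h : Converges c w) (i : Fin ℓ) :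
    weighted c (limMass c) (sub i w) ≤ limMass c w := by
  rw [h.limMass_eq_sum_weighted hℓ]
  exact Finset.single_le_sum (f := fun i => weighted c (limMass c) (sub i w))
    (fun _ _ => zero_le) (Finset.mem_univ i)

theorem measure_sub_inter_sub {ν : Measure ℝ} [IsProbabilityMeasure ν] {i j : Fin ℓ} (hij : i ≠ j)
    {S T : Set (Tree ℓ)} (hS : MeasurableSet S) (hT : MeasurableSet T) :
    treeLaw ℓ ν (sub i ⁻¹' S ∩ sub j ⁻¹' T) = treeLaw ℓ ν S * treeLaw ℓ ν T := by
  have h := lintegral_sub_mul_sub ν hij (f := S.indicator 1) (g := T.indicator 1)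
    (measurable_one.indicator hS) (measurable_one.indicator hT)
  rw [lintegral_indicator_one hS, lintegral_indicator_one hT] at h
  rw [← h, ← lintegral_indicator_one ((measurable_sub i hS).inter (measurable_sub j hT))]
  refine lintegral_congr fun w => ?_
  by_cases h1 : sub i w ∈ S <;> by_cases h2 : sub j w ∈ T <;> simp [h1, h2, Set.indicator]

variable {ν : Measure ℝ} [IsProbabilityMeasure ν]

/-- The recursive estimate for the distribution function of the limit mass near `0`. It expresses
that the limit mass can only be small when two independent subtrees are both small. -/
theorem measure_limMass_le_sq (hℓ : 2 ≤ ℓ) (hc : Measurable c) (h1 : ∫⁻ x, c x ∂ν = 1)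
    {y : ℝ≥0∞} (hy0 : y ≠ 0) (hyt : y ≠ ∞) :
    treeLaw ℓ ν {w | limMass c w ≤ (ℓ : ℝ≥0∞) ^ 2 * y ^ 2}
      ≤ (treeLaw ℓ ν {w | limMass c w ≤ (ℓ : ℝ≥0∞) ^ 2 * y}
        + (ℓ * ∫⁻ x, (c x : ℝ≥0∞)⁻¹ ∂ν) * y) ^ 2 := by
  have hℓ0 : (ℓ : ℝ≥0∞) ≠ 0 := by simp; omega
  have hℓt : (ℓ : ℝ≥0∞) ≠ ∞ := by simp
  have hYm := measurable_limMass (ℓ := ℓ) hc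
  set A : Tree ℓ → ℝ≥0∞ := weighted c (limMass c) with hA
  have hAm : Measurable A := measurable_weighted hc hYm
  set S : Set (Tree ℓ) := {w | A w ≤ (ℓ : ℝ≥0∞) ^ 2 * y ^ 2}
  have hSm : MeasurableSet S := measurableSet_le hAm measurable_const
  let i : Fin ℓ := ⟨0, by omega⟩
  let j : Fin ℓ := ⟨1, by omega⟩
  have step1 : treeLaw ℓ ν {w | limMass c w ≤ (ℓ : ℝ≥0∞) ^ 2 * y ^ 2} ≤ treeLaw ℓ ν S ^ 2 := by
    rw [sq (treeLaw ℓ ν S), ← measure_sub_inter_sub (i := i) (j := j) (by simp [i, j]) hSm hSm]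
    refine measure_mono_ae ?_
    filter_upwards [ae_converges (by omega) hc h1] with w hw hwle
    exact ⟨(hw.weighted_le_limMass (by omega) i).trans hwle,
      (hw.weighted_le_limMass (by omega) j).trans hwle⟩
  refine step1.trans (pow_le_pow_left₀ zero_le ?_ 2)
  have step2 : S ⊆ {w | limMass c w ≤ (ℓ : ℝ≥0∞) ^ 2 * y}
      ∪ (fun w : Tree ℓ => w []) ⁻¹' {x | (ℓ * y)⁻¹ ≤ (c x : ℝ≥0∞)⁻¹} := by
    intro w hw
    by_cases hcw : (c (w []) : ℝ≥0∞) ≤ ℓ * y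
    · exact Or.inr (ENNReal.inv_le_inv.2 hcw)
    left
    rw [not_le] at hcw
    have hly0 : (ℓ : ℝ≥0∞) * y ≠ 0 := mul_ne_zero hℓ0 hy0
    have hlyt : (ℓ : ℝ≥0∞) * y ≠ ∞ := ENNReal.mul_ne_top hℓt hyt
    have h2 : y * limMass c w ≤ y * ((ℓ : ℝ≥0∞) ^ 2 * y) := by
      calc y * limMass c w = (ℓ : ℝ≥0∞)⁻¹ * (ℓ * y) * limMass c w := by
            rw [← mul_assoc, ENNReal.inv_mul_cancel hℓ0 hℓt, one_mul]
        _ ≤ (ℓ : ℝ≥0∞)⁻¹ * c (w []) * limMass c w := by gcongr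
        _ ≤ (ℓ : ℝ≥0∞) ^ 2 * y ^ 2 := hw
        _ = _ := by ring
    exact (ENNReal.mul_le_mul_iff_right hy0 hyt).1 h2
  refine (measure_mono step2).trans ((measure_union_le _ _).trans ?_)
  gcongr
  have hcm : Measurable fun x => (c x : ℝ≥0∞)⁻¹ := by fun_prop
  rw [(measurePreserving_eval ν ([] : List (Fin ℓ))).measure_preimage
    (measurableSet_le measurable_const hcm).nullMeasurableSet]
  have hM := meas_ge_le_lintegral_div (μ := ν) hcm.aemeasurable (ε := (ℓ * y)⁻¹)
    (by simp [ENNReal.mul_eq_top, hyt, hy0]) (by simp [hℓ0, hy0])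
  refine hM.trans (le_of_eq ?_)
  rw [div_eq_mul_inv, inv_inv]
  ring

/-- Iterating the quadratic estimate from a sufficiently small `z` makes the distribution function
of the limit mass decay doubly exponentially along `ℓ² z ^ (2 ^ n)`. -/
theorem exists_doubly_exponential_bound (hℓ : 2 ≤ ℓ) (hc : Measurable c)
    (h1 : ∫⁻ x, c x ∂ν = 1) (hinv : ∫⁻ x, (c x : ℝ≥0∞)⁻¹ ∂ν ≠ ∞)
    (hY : ∀ᵐ w ∂treeLaw ℓ ν, limMass (ℓ := ℓ) c w ≠ 0) :
    ∃ z : ℝ≥0∞, z ≠ 0 ∧ z ≤ 2⁻¹ ∧ ∀ n : ℕ,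
      treeLaw ℓ ν {w | limMass c w ≤ (ℓ : ℝ≥0∞) ^ 2 * z ^ 2 ^ n} ≤ 4⁻¹ * 2⁻¹ ^ 2 ^ n := by
  have hℓt : (ℓ : ℝ≥0∞) ^ 2 ≠ ∞ := by simp
  set C : ℝ≥0∞ := ℓ * ∫⁻ x, (c x : ℝ≥0∞)⁻¹ ∂ν with hC
  have hCt : C ≠ ∞ := ENNReal.mul_ne_top (by simp) hinv
  have hYm := measurable_limMass (ℓ := ℓ) hc
  -- For `z = 1 / N` with `N` large, the probability of `Y ≤ ℓ² z` and the number `2 C z` are small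
  -- enough to start the induction and to absorb the error term in each step.
  have hz1 : Tendsto (fun n : ℕ => treeLaw ℓ ν {w | limMass c w ≤ (ℓ : ℝ≥0∞) ^ 2 * (n : ℝ≥0∞)⁻¹})
      atTop (𝓝 0) := by
    have h0 : treeLaw ℓ ν (⋂ n : ℕ, {w | limMass c w ≤ (ℓ : ℝ≥0∞) ^ 2 * (n : ℝ≥0∞)⁻¹}) = 0 := by
      refine measure_mono_null ?_ (ae_iff.1 hY)
      intro w hw
      simp only [Set.mem_iInter, Set.mem_ofPred_eq] at hw
      have : Tendsto (fun n : ℕ => (ℓ : ℝ≥0∞) ^ 2 * (n : ℝ≥0∞)⁻¹) atTop (𝓝 ((ℓ : ℝ≥0∞) ^ 2 * 0)) :=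
        ENNReal.Tendsto.const_mul ENNReal.tendsto_inv_nat_nhds_zero (Or.inr hℓt)
      rw [mul_zero] at this
      simpa using ge_of_tendsto' this hw
    rw [← h0]
    refine tendsto_measure_iInter_atTop
      (fun n => (measurableSet_le hYm measurable_const).nullMeasurableSet) ?_
      ⟨0, measure_ne_top _ _⟩
    intro m n hmn w hw
    exact le_trans (show limMass c w ≤ _ from hw) (by gcongr)
  have hz2 : Tendsto (fun n : ℕ => C * (2 * (n : ℝ≥0∞)⁻¹)) atTop (𝓝 (C * (2 * 0))) :=
    ENNReal.Tendsto.const_mul (ENNReal.Tendsto.const_mul ENNReal.tendsto_inv_nat_nhds_zero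
      (Or.inr (by simp))) (Or.inr hCt)
  rw [mul_zero, mul_zero] at hz2
  have e1 := hz1.eventually (gt_mem_nhds (show (0 : ℝ≥0∞) < 4⁻¹ * 2⁻¹ by simp))
  have e2 := hz2.eventually (gt_mem_nhds (show (0 : ℝ≥0∞) < 4⁻¹ by simp))
  obtain ⟨N, ⟨hN1, hN2⟩, hN3⟩ := ((e1.and e2).and (eventually_ge_atTop 2)).exists
  set z : ℝ≥0∞ := (N : ℝ≥0∞)⁻¹ with hz
  have hzle : z ≤ 2⁻¹ := ENNReal.inv_le_inv.2 (by exact_mod_cast hN3)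
  have hz0 : z ≠ 0 := by simp [hz]
  have hzt : z ≠ ∞ := ne_top_of_le_ne_top (by simp) hzle
  refine ⟨z, hz0, hzle, fun n => ?_⟩
  have h2z : 2 * z ≤ 1 := by
    calc 2 * z ≤ 2 * 2⁻¹ := by gcongr
      _ = 1 := ENNReal.mul_inv_cancel (by simp) (by simp)
  have hCz (n : ℕ) : C * z ^ 2 ^ n ≤ 4⁻¹ * 2⁻¹ ^ 2 ^ n := by
    have h3 : z = 2⁻¹ * (2 * z) := by
      rw [← mul_assoc, ENNReal.inv_mul_cancel (by simp) (by simp), one_mul]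
    calc C * z ^ 2 ^ n = (C * (2 * z) ^ 2 ^ n) * 2⁻¹ ^ 2 ^ n := by
          conv_lhs => rw [h3, mul_pow]
          ring
      _ ≤ (C * (2 * z)) * 2⁻¹ ^ 2 ^ n := by
          gcongr
          exact pow_le_of_le_one zero_le h2z (by positivity)
      _ ≤ _ := by gcongr
  induction n with
  | zero => simpa using hN1.le
  | succ n ih =>
    have := measure_limMass_le_sq (ν := ν) hℓ hc h1 (y := z ^ 2 ^ n) (by simp [hz0])
      (by simp [hzt])
    rw [← pow_mul, ← pow_succ] at this
    refine this.trans ?_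
    calc _ ≤ ((4⁻¹ * 2⁻¹ ^ 2 ^ n + 4⁻¹ * 2⁻¹ ^ 2 ^ n) ^ 2 : ℝ≥0∞) := by
          exact pow_le_pow_left₀ zero_le (add_le_add ih (hCz n)) 2
      _ = 4⁻¹ * 2⁻¹ ^ 2 ^ (n + 1) := by
          have h4 : (4⁻¹ : ℝ≥0∞) = 2⁻¹ * 2⁻¹ := by
            rw [← ENNReal.mul_inv (by simp) (by simp)]; norm_num
          have h5 : (2⁻¹ : ℝ≥0∞) + 2⁻¹ = 1 := ENNReal.inv_two_add_inv_two
          rw [← add_mul, h4, ← mul_add, h5, mul_one, mul_pow, ← pow_mul, ← pow_succ]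
          ring

/-- Some negative moment is finite: along `x_n = ℓ² z ^ (2 ^ n)` the factor `x_{n+1} ^ (-s)` grows
slower than the probabilities of `Y ≤ x_n` decay, if `s` is small. -/
theorem exists_neg_moment (hℓ : 2 ≤ ℓ) (hc : Measurable c)
    (h1 : ∫⁻ x, c x ∂ν = 1) (hinv : ∫⁻ x, (c x : ℝ≥0∞)⁻¹ ∂ν ≠ ∞)
    (hY : ∀ᵐ w ∂treeLaw ℓ ν, limMass (ℓ := ℓ) c w ≠ 0) :
    ∃ s : ℝ, 0 < s ∧ ∫⁻ w, limMass c w ^ (-s) ∂treeLaw ℓ ν ≠ ∞ := by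
  obtain ⟨z, hz0, hz2, hG⟩ := exists_doubly_exponential_bound hℓ hc h1 hinv hY
  have hzt : z ≠ ∞ := ne_top_of_le_ne_top (by simp) hz2
  have hℓ0 : (ℓ : ℝ≥0∞) ^ 2 ≠ 0 := by simp; omega
  have hℓt : (ℓ : ℝ≥0∞) ^ 2 ≠ ∞ := by simp
  have hYm := measurable_limMass (ℓ := ℓ) hc
  obtain ⟨s, hs0, hs⟩ : ∃ s : ℝ, 0 < s ∧ z ^ (-(2 * s)) ≤ 3 / 2 := by
    lift z to ℝ≥0 using hzt
    have hz0' : z ≠ 0 := by simpa using hz0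
    have h1 : Tendsto (fun s : ℝ => z ^ (-(2 * s))) (𝓝 0) (𝓝 (z ^ (-(2 * (0 : ℝ))))) :=
      tendsto_const_nhds.nnrpow (Continuous.tendsto (by fun_prop) 0) (Or.inl hz0')
    have h2 := h1.eventually (gt_mem_nhds (show z ^ (-(2 * (0 : ℝ))) < 3 / 2 by
      simp only [mul_zero, neg_zero, NNReal.rpow_zero]
      rw [← NNReal.coe_lt_coe]; norm_num))
    obtain ⟨s, h3, h4⟩ := ((h2.filter_mono nhdsWithin_le_nhds).and
      (self_mem_nhdsWithin (s := Set.Ioi (0 : ℝ)))).exists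
    refine ⟨s, h4, ?_⟩
    rw [← ENNReal.coe_rpow_of_ne_zero hz0']
    have : ((3 / 2 : ℝ≥0) : ℝ≥0∞) = 3 / 2 := by
      rw [ENNReal.coe_div (by simp)]; simp
    rw [← this]
    exact_mod_cast h3.le
  refine ⟨s, hs0, ?_⟩
  set x : ℕ → ℝ≥0∞ := fun n => (ℓ : ℝ≥0∞) ^ 2 * z ^ 2 ^ n with hx
  have hx0 (n : ℕ) : x n ≠ 0 := mul_ne_zero hℓ0 (by simp [hz0])
  have hxt (n : ℕ) : x n ≠ ∞ := ENNReal.mul_ne_top hℓt (by simp [hzt])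
  have hxlim : Tendsto x atTop (𝓝 0) := by
    have h3 : Tendsto (fun n : ℕ => z ^ 2 ^ n) atTop (𝓝 0) :=
      (ENNReal.tendsto_pow_atTop_nhds_zero_of_lt_one (lt_of_le_of_lt hz2 (by simp))).comp
        (tendsto_pow_atTop_atTop_of_one_lt (by norm_num))
    simpa using ENNReal.Tendsto.const_mul h3 (Or.inr hℓt)
  have hpt (w : Tree ℓ) (hw : limMass c w ≠ 0) : limMass c w ^ (-s) ≤ x 0 ^ (-s)
      + ∑' n, {w | limMass c w ≤ x n}.indicator (fun _ => x (n + 1) ^ (-s)) w := by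
    by_cases h0 : x 0 < limMass c w
    · exact (rpow_le_rpow_of_nonpos h0.le (by linarith)).trans le_self_add
    have hex : ∃ n, x n < limMass c w :=
      (hxlim.eventually (gt_mem_nhds (pos_iff_ne_zero.2 hw))).exists
    classical
    obtain ⟨n, hn⟩ : ∃ n, Nat.find hex = n + 1 :=
      ⟨Nat.find hex - 1, by
        have : Nat.find hex ≠ 0 := fun h => h0 (by have := Nat.find_spec hex; rwa [h] at this)
        omega⟩
    have hn1 : x (n + 1) < limMass c w := hn ▸ Nat.find_spec hex
    have hn2 : limMass c w ≤ x n := not_lt.1 (Nat.find_min hex (by omega))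
    refine le_trans ?_ le_add_self
    refine le_trans ?_ (ENNReal.le_tsum n)
    rw [Set.indicator_of_mem (by exact hn2)]
    exact rpow_le_rpow_of_nonpos hn1.le (by linarith)
  have hSm (n : ℕ) : MeasurableSet {w : Tree ℓ | limMass c w ≤ x n} :=
    measurableSet_le hYm measurable_const
  refine ne_top_of_le_ne_top ?_ (lintegral_mono_ae (hY.mono hpt))
  rw [lintegral_add_left measurable_const, lintegral_tsum fun n =>
    (measurable_const.indicator (hSm n)).aemeasurable]
  refine ENNReal.add_ne_top.2 ⟨by
    simpa using ENNReal.rpow_ne_top_of_ne_zero (y := -s) (hx0 0) (hxt 0), ?_⟩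
  have hterm (n : ℕ) : ∫⁻ w, {w | limMass c w ≤ x n}.indicator (fun _ => x (n + 1) ^ (-s)) w
      ∂treeLaw ℓ ν ≤ (3 / 4) ^ n := by
    rw [lintegral_indicator_const (hSm n)]
    have hxpow : x (n + 1) ^ (-s) ≤ (3 / 2) ^ 2 ^ n := by
      rw [hx, mul_rpow_of_pos_of_finite hℓ0 hℓt]
      have h4 : ((ℓ : ℝ≥0∞) ^ 2) ^ (-s) ≤ 1 := by
        refine ENNReal.rpow_le_one_of_one_le_of_neg ?_ (by linarith)
        exact one_le_pow₀ (by exact_mod_cast (by omega : 1 ≤ ℓ))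
      have h5 : (z ^ 2 ^ (n + 1)) ^ (-s) = (z ^ (-(2 * s))) ^ 2 ^ n := by
        rw [← ENNReal.rpow_natCast, ← ENNReal.rpow_natCast, ← ENNReal.rpow_mul, ← ENNReal.rpow_mul]
        congr 1
        push_cast
        ring
      rw [h5]
      calc _ ≤ 1 * (3 / 2 : ℝ≥0∞) ^ 2 ^ n := by gcongr
        _ = _ := one_mul _
    calc x (n + 1) ^ (-s) * treeLaw ℓ ν {w | limMass c w ≤ x n}
        ≤ (3 / 2) ^ 2 ^ n * (4⁻¹ * 2⁻¹ ^ 2 ^ n) := mul_le_mul' hxpow (hG n)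
      _ = 4⁻¹ * (3 / 4) ^ 2 ^ n := by
          have h6 : (3 / 4 : ℝ≥0∞) = 3 / 2 * 2⁻¹ := by
            rw [div_eq_mul_inv, div_eq_mul_inv, mul_assoc, ← ENNReal.mul_inv (by simp) (by simp)]
            norm_num
          rw [h6, mul_pow]; ring
      _ ≤ 1 * (3 / 4) ^ n := by
          gcongr ?_ * ?_
          · simp
          · refine pow_le_pow_right_of_le_one' ?_ Nat.lt_two_pow_self.le
            exact ENNReal.div_le_of_le_mul (by norm_num)
      _ = _ := one_mul _
  refine ne_top_of_le_ne_top ?_ (ENNReal.tsum_le_tsum hterm)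
  rw [ENNReal.tsum_geometric]
  simp only [ne_eq, ENNReal.inv_eq_top, tsub_eq_zero_iff_le, not_le]
  refine ENNReal.div_lt_of_lt_mul' ?_
  norm_num

/-- Since the limit mass dominates the contributions of two independent subtrees, a finite moment of
order `-s` gives one of order `-2s`. -/
theorem neg_moment_double (hℓ : 2 ≤ ℓ) (hc : Measurable c) (hpos : ∀ x, 0 < c x)
    (h1 : ∫⁻ x, c x ∂ν = 1) (hY : ∀ᵐ w ∂treeLaw ℓ ν, limMass (ℓ := ℓ) c w ≠ 0) {s : ℝ} (hs : 0 < s)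
    (hcs : ∫⁻ x, ((ℓ : ℝ≥0∞)⁻¹ * c x) ^ (-s) ∂ν ≠ ∞)
    (h : ∫⁻ w, limMass c w ^ (-s) ∂treeLaw ℓ ν ≠ ∞) :
    ∫⁻ w, limMass c w ^ (-(2 * s)) ∂treeLaw ℓ ν ≠ ∞ := by
  have hYm := measurable_limMass (ℓ := ℓ) hc
  let i : Fin ℓ := ⟨0, by omega⟩
  let j : Fin ℓ := ⟨1, by omega⟩
  have hAm : Measurable fun w : Tree ℓ => weighted c (limMass c) w ^ (-s) :=
    (measurable_weighted hc hYm).pow_const _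
  have hA : ∫⁻ w, weighted c (limMass (ℓ := ℓ) c) w ^ (-s) ∂treeLaw ℓ ν ≠ ∞ := by
    rw [lintegral_weighted_rpow (by omega) hc hpos hYm rootFree_limMass]
    exact ENNReal.mul_ne_top hcs h
  have h2 := lintegral_sub_mul_sub ν (i := i) (j := j) (by simp [i, j]) hAm hAm
  refine ne_top_of_le_ne_top (ENNReal.mul_ne_top hA hA) ?_
  rw [← h2]
  refine lintegral_mono_ae ?_
  filter_upwards [hY, ae_converges (by omega) hc h1] with w hw0 hw
  rw [show -(2 * s) = -s + -s by ring, ENNReal.rpow_add _ _ hw0 (hw []).1]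
  refine mul_le_mul' ?_ ?_
  · exact rpow_le_rpow_of_nonpos (hw.weighted_le_limMass (by omega) i) (by linarith)
  · exact rpow_le_rpow_of_nonpos (hw.weighted_le_limMass (by omega) j) (by linarith)

theorem rpow_neg_le_one_add {s S : ℝ} (h0 : 0 ≤ s) (h : s ≤ S) (x : ℝ≥0∞) :
    x ^ (-s) ≤ 1 + x ^ (-S) := by
  rcases le_total x 1 with hx | hx
  · exact (ENNReal.rpow_le_rpow_of_exponent_ge hx (by linarith)).trans le_add_self
  · refine le_trans ?_ le_self_add
    calc x ^ (-s) ≤ 1 ^ (-s) := rpow_le_rpow_of_nonpos hx (by linarith)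
      _ = 1 := by simp

theorem lintegral_limMass_rpow_neg_ne_top (hℓ : 2 ≤ ℓ) (hc : Measurable c) (hpos : ∀ x, 0 < c x)
    (h1 : ∫⁻ x, c x ∂ν = 1) (hcs : ∀ s : ℝ, ∫⁻ x, (c x : ℝ≥0∞) ^ s ∂ν ≠ ∞)
    (hY : ∀ᵐ w ∂treeLaw ℓ ν, limMass (ℓ := ℓ) c w ≠ 0) {s : ℝ} (hs : 0 ≤ s) :
    ∫⁻ w, limMass c w ^ (-s) ∂treeLaw ℓ ν ≠ ∞ := by
  have hℓ0 : (ℓ : ℝ≥0∞)⁻¹ ≠ 0 := by simp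
  have hℓt : (ℓ : ℝ≥0∞)⁻¹ ≠ ∞ := by simp; omega
  obtain ⟨s₀, hs₀, hfin⟩ := exists_neg_moment hℓ hc h1
    (by simpa [ENNReal.rpow_neg_one] using hcs (-1)) hY
  have hpow (n : ℕ) : ∫⁻ w, limMass c w ^ (-(2 ^ n * s₀)) ∂treeLaw ℓ ν ≠ ∞ := by
    induction n with
    | zero => simpa using hfin
    | succ n ih =>
      have := neg_moment_double hℓ hc hpos h1 hY (s := 2 ^ n * s₀) (by positivity) ?_ ih
      · rwa [pow_succ', mul_assoc]
      · simp_rw [mul_rpow_of_pos_of_finite hℓ0 hℓt]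
        rw [lintegral_const_mul _ (by fun_prop)]
        exact ENNReal.mul_ne_top (ENNReal.rpow_ne_top_of_ne_zero hℓ0 hℓt) (hcs _)
  obtain ⟨n, hn⟩ := pow_unbounded_of_one_lt (s / s₀) one_lt_two
  have hle : s ≤ 2 ^ n * s₀ := by rw [div_lt_iff₀ hs₀] at hn; exact hn.le
  refine ne_top_of_le_ne_top ?_ (lintegral_mono fun w => rpow_neg_le_one_add hs hle _)
  rw [lintegral_add_left measurable_const]
  exact ENNReal.add_ne_top.2 ⟨by simp, hpow n⟩

end

/-! ### Non-degeneracy and the slope of the moment function at `1` -/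

/-- A quantitative form of the subadditivity of `x ↦ x ^ h`: for `y ≤ x` it follows from Bernoulli's
inequality `(1 + y / x) ^ h ≤ 1 + h y / x` and `x ^ h (y / x) ≤ y ^ h`. -/
theorem add_rpow_add_min_rpow_le {h : ℝ} (h0 : 0 < h) (h1 : h ≤ 1) (x y : ℝ≥0∞) :
    (x + y) ^ h + ENNReal.ofReal (1 - h) * min x y ^ h ≤ x ^ h + y ^ h := by
  wlog hxy : y ≤ x generalizing x y
  · rw [add_comm x y, min_comm, add_comm (x ^ h)]
    exact this y x (le_of_not_ge hxy)
  rw [min_eq_right hxy]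
  rcases eq_or_ne x ∞ with rfl | hxt
  · simp [h0]
  have hyt : y ≠ ∞ := ne_top_of_le_ne_top hxt hxy
  rcases eq_or_ne x 0 with rfl | hx0
  · have : y = 0 := by simpa using hxy
    simp [this, h0]
  lift x to ℝ≥0 using hxt
  lift y to ℝ≥0 using hyt
  have hx : (0 : ℝ) < x := by
    rw [NNReal.coe_pos]; exact pos_iff_ne_zero.2 (by simpa using hx0)
  have hyx : (y : ℝ) ≤ x := by exact_mod_cast hxy
  have key : ((x : ℝ) + y) ^ h + (1 - h) * (y : ℝ) ^ h ≤ (x : ℝ) ^ h + (y : ℝ) ^ h := by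
    have hyx0 : (0 : ℝ) ≤ y / x := by positivity
    have hb : (1 + (y : ℝ) / x) ^ h ≤ 1 + h * (y / x) :=
      rpow_one_add_le_one_add_mul_self (by linarith) h0.le h1
    have e1 : ((x : ℝ) + y) ^ h = (x : ℝ) ^ h * (1 + y / x) ^ h := by
      rw [← Real.mul_rpow hx.le (by positivity)]
      congr 1; field_simp
    have e2 : (x : ℝ) ^ h * (y / x) ≤ (y : ℝ) ^ h := by
      rcases eq_or_lt_of_le (NNReal.coe_nonneg y) with hy | hy
      · rw [← hy]; simp [h0.ne']
      have e3 : (y / x : ℝ) ≤ (y / x) ^ h := by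
        conv_lhs => rw [← Real.rpow_one (y / x : ℝ)]
        exact Real.rpow_le_rpow_of_exponent_ge (by positivity) ((div_le_one hx).2 hyx) h1
      calc (x : ℝ) ^ h * (y / x) ≤ (x : ℝ) ^ h * (y / x) ^ h := by gcongr
        _ = (y : ℝ) ^ h := by
          rw [← Real.mul_rpow hx.le (by positivity)]
          congr 1; field_simp
    have e4 : (x : ℝ) ^ h * (1 + y / x) ^ h ≤ (x : ℝ) ^ h * (1 + h * (y / x)) := by gcongr
    rw [e1]
    nlinarith [mul_le_mul_of_nonneg_left e2 h0.le]
  have e5 : ENNReal.ofReal (1 - h) = ((1 - h).toNNReal : ℝ≥0∞) := rfl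
  rw [e5, ← ENNReal.coe_add, ← ENNReal.coe_rpow_of_nonneg _ h0.le,
    ← ENNReal.coe_rpow_of_nonneg _ h0.le, ← ENNReal.coe_rpow_of_nonneg _ h0.le,
    ← ENNReal.coe_mul, ← ENNReal.coe_add, ← ENNReal.coe_add, ENNReal.coe_le_coe,
    ← NNReal.coe_le_coe]
  push_cast
  rwa [Real.coe_toNNReal _ (by linarith)]

theorem sum_rpow_le {ι : Type*} (s : Finset ι) (a : ι → ℝ≥0∞) {h : ℝ} (h0 : 0 < h) (h1 : h ≤ 1) :
    (∑ i ∈ s, a i) ^ h ≤ ∑ i ∈ s, a i ^ h :=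
  Finset.le_sum_of_subadditive (fun x : ℝ≥0∞ => x ^ h) (by simp [h0])
    (fun x y => ENNReal.rpow_add_le_add_rpow x y h0.le h1) s a

theorem sum_rpow_add_min_rpow_le {ι : Type*} [DecidableEq ι] {s : Finset ι} (a : ι → ℝ≥0∞)
    {i j : ι} (hi : i ∈ s) (hj : j ∈ s) (hij : i ≠ j) {h : ℝ} (h0 : 0 < h) (h1 : h ≤ 1) :
    (∑ k ∈ s, a k) ^ h + ENNReal.ofReal (1 - h) * min (a i) (a j) ^ h ≤ ∑ k ∈ s, a k ^ h := by
  have hj' : j ∈ s.erase i := Finset.mem_erase.2 ⟨hij.symm, hj⟩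
  rw [← Finset.add_sum_erase s a hi, ← Finset.add_sum_erase _ a hj', ← add_assoc,
    ← Finset.add_sum_erase s (fun k => a k ^ h) hi,
    ← Finset.add_sum_erase _ (fun k => a k ^ h) hj', ← add_assoc]
  calc _ ≤ ((a i + a j) ^ h + (∑ k ∈ (s.erase i).erase j, a k) ^ h)
        + ENNReal.ofReal (1 - h) * min (a i) (a j) ^ h := by
        gcongr
        exact ENNReal.rpow_add_le_add_rpow _ _ h0.le h1
    _ = ((a i + a j) ^ h + ENNReal.ofReal (1 - h) * min (a i) (a j) ^ h)
        + (∑ k ∈ (s.erase i).erase j, a k) ^ h := by ring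
    _ ≤ _ := add_le_add (add_rpow_add_min_rpow_le h0 h1 _ _) (sum_rpow_le _ _ h0 h1)

section

variable {ℓ : ℕ} {c : ℝ → ℝ≥0} {ν : Measure ℝ} [IsProbabilityMeasure ν]

/-- If the limit mass `Y` does not vanish, then `ℓ ^ τ(h)` is at least `1 + (1 - h) v` for a fixed
`v > 0`, which makes the slope of `τ` at `1` negative. One compares the expectations in
`(∑ A_i) ^ h + (1 - h) min(A_0, A_1) ^ h ≤ ∑ A_i ^ h`, where `Y = ∑ A_i`. -/
theorem exists_one_add_le_scaling (hℓ : 2 ≤ ℓ) (hc : Measurable c) (hpos : ∀ x, 0 < c x)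
    (h1 : ∫⁻ x, c x ∂ν = 1) (h0 : ¬ ∀ᵐ w ∂treeLaw ℓ ν, limMass (ℓ := ℓ) c w = 0) :
    ∃ v : ℝ, 0 < v ∧ ∀ h : ℝ, 0 < h → h < 1 →
      1 + ENNReal.ofReal ((1 - h) * v) ≤ scaling ℓ ν c h := by
  have hYm := measurable_limMass (ℓ := ℓ) hc
  have hY := ae_limMass_ne_zero hℓ hc hpos h1 h0
  set A : Tree ℓ → ℝ≥0∞ := weighted c (limMass c) with hA
  have hAm : Measurable A := measurable_weighted hc hYm
  have hAs (i : Fin ℓ) : Measurable fun w : Tree ℓ => A (sub i w) := hAm.comp (measurable_sub i)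
  let i : Fin ℓ := ⟨0, by omega⟩
  let j : Fin ℓ := ⟨1, by omega⟩
  have hij : i ≠ j := by simp [i, j]
  set V : ℝ≥0∞ := ∫⁻ w, min (min (A (sub i w)) (A (sub j w))) 1 ∂treeLaw ℓ ν with hV
  have hVm : Measurable fun w : Tree ℓ => min (min (A (sub i w)) (A (sub j w))) 1 :=
    ((hAs i).min (hAs j)).min measurable_const
  have hV1 : V ≤ 1 := by
    calc V ≤ ∫⁻ _, 1 ∂treeLaw ℓ ν := lintegral_mono fun w => min_le_right _ _
      _ = 1 := by simp
  have hAne (k : Fin ℓ) : ∀ᵐ w ∂treeLaw ℓ ν, A (sub k w) ≠ 0 := by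
    filter_upwards [(measurePreserving_sub ν k).quasiMeasurePreserving.ae hY] with w hw
    exact mul_ne_zero (inv_mul_coe_ne_zero hpos _) hw
  have hV0 : V ≠ 0 := by
    rw [hV, Ne, lintegral_eq_zero_iff hVm]
    intro hz
    have : ∀ᵐ w ∂treeLaw ℓ ν, False := by
      filter_upwards [hz, hAne i, hAne j] with w hw hw1 hw2
      have h3 : min (min (A (sub i w)) (A (sub j w))) 1 = 0 := hw
      rcases min_eq_iff.1 h3 with h4 | h4
      · rcases min_eq_iff.1 h4.1 with h5 | h5
        · exact hw1 h5.1
        · exact hw2 h5.1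
      · exact one_ne_zero h4.1
    simp [IsProbabilityMeasure.ne_zero] at this
  have hVt : V ≠ ∞ := ne_top_of_le_ne_top ENNReal.one_ne_top hV1
  refine ⟨V.toReal / 2, by have := ENNReal.toReal_pos hV0 hVt; positivity, fun h hh0 hh1 => ?_⟩
  set u : ℝ≥0∞ := ∫⁻ w, limMass c w ^ h ∂treeLaw ℓ ν with hu
  have hu2 : u ≤ 2 := by
    calc u ≤ ∫⁻ w, (1 + limMass c w) ∂treeLaw ℓ ν :=
          lintegral_mono fun w => rpow_le_one_add hh0.le hh1.le _
      _ ≤ 1 + 1 := by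
          rw [lintegral_add_left measurable_const]
          gcongr
          · simp
          · exact lintegral_limMass_le (by omega) hc h1
      _ = 2 := one_add_one_eq_two
  have hu0 : u ≠ 0 := by
    rw [hu, Ne, lintegral_eq_zero_iff (hYm.pow_const h)]
    intro hz
    have : ∀ᵐ w ∂treeLaw ℓ ν, False := by
      filter_upwards [hz, hY] with w hw hw1
      rcases ENNReal.rpow_eq_zero_iff.1 hw with h3 | h3
      · exact hw1 h3.1
      · exact lt_asymm hh0 h3.2
    simp [IsProbabilityMeasure.ne_zero] at this
  have hmain : u + ENNReal.ofReal (1 - h) * V ≤ scaling ℓ ν c h * u := by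
    have hpt : ∀ᵐ w ∂treeLaw ℓ ν, limMass c w ^ h
        + ENNReal.ofReal (1 - h) * min (min (A (sub i w)) (A (sub j w))) 1
        ≤ ∑ k : Fin ℓ, A (sub k w) ^ h := by
      filter_upwards [ae_converges (by omega) hc h1] with w hw
      rw [hw.limMass_eq_sum_weighted (by omega)]
      refine le_trans ?_ (sum_rpow_add_min_rpow_le (fun k => A (sub k w)) (Finset.mem_univ i)
        (Finset.mem_univ j) hij hh0 hh1.le)
      gcongr
      set m := min (A (sub i w)) (A (sub j w))
      calc min m 1 ≤ min m 1 ^ h := by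
            conv_lhs => rw [← ENNReal.rpow_one (min m 1)]
            exact ENNReal.rpow_le_rpow_of_exponent_ge (min_le_right _ _) hh1.le
        _ ≤ m ^ h := ENNReal.rpow_le_rpow (min_le_left _ _) hh0.le
    have hint := lintegral_mono_ae hpt
    rw [lintegral_add_left (hYm.pow_const h), lintegral_const_mul _ hVm,
      lintegral_finsetSum _ fun k _ => (hAs k).pow_const h] at hint
    refine hint.trans (le_of_eq ?_)
    have hk (k : Fin ℓ) : ∫⁻ w, A (sub k w) ^ h ∂treeLaw ℓ ν
        = (∫⁻ x, ((ℓ : ℝ≥0∞)⁻¹ * c x) ^ h ∂ν) * u :=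
      (lintegral_sub_comp k (hAm.pow_const h)).trans
        (lintegral_weighted_rpow (by omega) hc hpos hYm rootFree_limMass h)
    simp only [hk, Finset.sum_const, Finset.card_univ, Fintype.card_fin, nsmul_eq_mul, scaling]
    ring
  have hut : u ≠ ∞ := ne_top_of_le_ne_top (by simp) hu2
  rw [← ENNReal.mul_le_mul_iff_left hu0 hut]
  refine le_trans ?_ hmain
  rw [add_mul, one_mul]
  refine add_le_add_right ?_ _
  rw [ENNReal.ofReal_mul (by linarith), mul_assoc]
  refine mul_le_mul_right ?_ _
  rw [ENNReal.ofReal_div_of_pos two_pos, ENNReal.ofReal_toReal hVt, ENNReal.ofReal_ofNat]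
  calc V / 2 * u ≤ V / 2 * 2 := by gcongr
    _ = V := ENNReal.div_mul_cancel (by simp) (by simp)

/-! ### Moments of the masses of the cylinders -/

/-- The sum `ℓ E[(ℓ⁻¹ c₁) ^ a (ℓ⁻¹ c₂) ^ b]` of joint moments of the weights of the first
generation of two cascades. -/
noncomputable def jointScaling (ℓ : ℕ) (ν : Measure ℝ) (c₁ c₂ : ℝ → ℝ≥0) (a b : ℝ) : ℝ≥0∞ :=
  (ℓ : ℝ≥0∞) * ∫⁻ x, ((ℓ : ℝ≥0∞)⁻¹ * c₁ x) ^ a * ((ℓ : ℝ≥0∞)⁻¹ * c₂ x) ^ b ∂ν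

variable {c₁ c₂ : ℝ → ℝ≥0}

theorem lintegral_cyl_rpow_mul (hℓ : 0 < ℓ) (hc₁ : Measurable c₁) (hc₂ : Measurable c₂)
    (hp₁ : ∀ x, 0 < c₁ x) (hp₂ : ∀ x, 0 < c₂ x) {f₁ f₂ : Tree ℓ → ℝ≥0∞} (hf₁ : Measurable f₁)
    (hf₂ : Measurable f₂) (hr₁ : RootFree f₁) (hr₂ : RootFree f₂) (a b : ℝ) (ε : List (Fin ℓ)) :
    ∫⁻ w, cyl c₁ f₁ ε w ^ a * cyl c₂ f₂ ε w ^ b ∂treeLaw ℓ ν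
      = (∫⁻ x, ((ℓ : ℝ≥0∞)⁻¹ * c₁ x) ^ a * ((ℓ : ℝ≥0∞)⁻¹ * c₂ x) ^ b ∂ν) ^ ε.length
        * ∫⁻ w, f₁ w ^ a * f₂ w ^ b ∂treeLaw ℓ ν := by
  induction ε with
  | nil => simp [cyl]
  | cons i δ ih =>
    have hm₁ := measurable_cyl hc₁ hf₁ δ
    have hm₂ := measurable_cyl hc₂ hf₂ δ
    have e (w : Tree ℓ) : cyl c₁ f₁ (i :: δ) w ^ a * cyl c₂ f₂ (i :: δ) w ^ b
        = (fun w' : Tree ℓ => (((ℓ : ℝ≥0∞)⁻¹ * c₁ (w' [])) ^ a * ((ℓ : ℝ≥0∞)⁻¹ * c₂ (w' [])) ^ b)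
          * (cyl c₁ f₁ δ w' ^ a * cyl c₂ f₂ δ w' ^ b)) (sub i w) := by
      simp only [cyl]
      rw [mul_rpow_of_pos_of_finite (inv_mul_coe_ne_zero hp₁ _) (inv_mul_coe_ne_top hℓ _),
        mul_rpow_of_pos_of_finite (inv_mul_coe_ne_zero hp₂ _) (inv_mul_coe_ne_top hℓ _)]
      simp only [sub]
      ring
    refine (lintegral_congr e).trans ((lintegral_sub_comp i
      (f := fun w' : Tree ℓ => (((ℓ : ℝ≥0∞)⁻¹ * c₁ (w' [])) ^ a
        * ((ℓ : ℝ≥0∞)⁻¹ * c₂ (w' [])) ^ b) * (cyl c₁ f₁ δ w' ^ a * cyl c₂ f₂ δ w' ^ b))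
      (by fun_prop)).trans ?_)
    rw [lintegral_root_mul ν (K := fun x => ((ℓ : ℝ≥0∞)⁻¹ * c₁ x) ^ a * ((ℓ : ℝ≥0∞)⁻¹ * c₂ x) ^ b)
        (by fun_prop) (by fun_prop)
        (fun w => by rw [hr₁.cyl δ w, hr₂.cyl δ w]), ih, List.length_cons, pow_succ']
    ring

/-- The expected value of a partition function of generation `n` is a constant times the `n`-th
power of `jointScaling`, so its generating series converges almost surely at every `t` smaller than
the inverse of `jointScaling`. -/
theorem ae_tsum_sum_cyl_ne_top (hℓ : 0 < ℓ) (hc₁ : Measurable c₁) (hc₂ : Measurable c₂)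
    (hp₁ : ∀ x, 0 < c₁ x) (hp₂ : ∀ x, 0 < c₂ x) {a b : ℝ} {t : ℝ≥0∞}
    (ht : t * jointScaling ℓ ν c₁ c₂ a b < 1)
    (hE : ∫⁻ w, limMass c₁ w ^ a * limMass c₂ w ^ b ∂treeLaw ℓ ν ≠ ∞) :
    ∀ᵐ w ∂treeLaw ℓ ν, ∑' n : ℕ, t ^ n * ∑ ε : Fin n → Fin ℓ,
      cyl c₁ (limMass c₁) (List.ofFn ε) w ^ a * cyl c₂ (limMass c₂) (List.ofFn ε) w ^ b ≠ ∞ := by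
  have hm₁ := fun ε => measurable_cyl hc₁ (measurable_limMass (ℓ := ℓ) hc₁) ε
  have hm₂ := fun ε => measurable_cyl hc₂ (measurable_limMass (ℓ := ℓ) hc₂) ε
  have hmeas (n : ℕ) : Measurable fun w : Tree ℓ => t ^ n * ∑ ε : Fin n → Fin ℓ,
      cyl c₁ (limMass c₁) (List.ofFn ε) w ^ a * cyl c₂ (limMass c₂) (List.ofFn ε) w ^ b := by
    fun_prop
  have hfin : ∫⁻ w, ∑' n : ℕ, t ^ n * ∑ ε : Fin n → Fin ℓ,
      cyl c₁ (limMass c₁) (List.ofFn ε) w ^ a * cyl c₂ (limMass c₂) (List.ofFn ε) w ^ b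
        ∂treeLaw ℓ ν ≠ ∞ := by
    rw [lintegral_tsum fun n => (hmeas n).aemeasurable]
    have hterm (n : ℕ) : ∫⁻ w, t ^ n * ∑ ε : Fin n → Fin ℓ,
        cyl c₁ (limMass c₁) (List.ofFn ε) w ^ a * cyl c₂ (limMass c₂) (List.ofFn ε) w ^ b
          ∂treeLaw ℓ ν = (t * jointScaling ℓ ν c₁ c₂ a b) ^ n
            * ∫⁻ w, limMass c₁ w ^ a * limMass c₂ w ^ b ∂treeLaw ℓ ν := by
      rw [lintegral_const_mul _ (by fun_prop), lintegral_finsetSum _ fun ε _ => by fun_prop]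
      simp only [lintegral_cyl_rpow_mul hℓ hc₁ hc₂ hp₁ hp₂ (measurable_limMass hc₁)
        (measurable_limMass hc₂) rootFree_limMass rootFree_limMass, List.length_ofFn,
        Finset.sum_const, Finset.card_univ, Fintype.card_fun, Fintype.card_fin, nsmul_eq_mul,
        jointScaling]
      push_cast
      ring
    simp only [hterm]
    rw [ENNReal.tsum_mul_right, ENNReal.tsum_geometric]
    refine ENNReal.mul_ne_top ?_ hE
    simpa [tsub_eq_zero_iff_le] using ht
  filter_upwards [ae_lt_top (Measurable.tsum hmeas) hfin] with w hw
  exact hw.ne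

end

/-! ### The `ℓ`-adic intervals -/

section

variable {ℓ : ℕ}

/-- The words of length `n` enumerated from left to right: the word `ε` is sent to
`∑ ε_k ℓ^(n-k)`. -/
noncomputable def wordEquiv (ℓ n : ℕ) : (Fin n → Fin ℓ) ≃ Fin (ℓ ^ n) :=
  (Equiv.arrowCongr Fin.revPerm (Equiv.refl _)).trans finFunctionFinEquiv

theorem sum_div_pow_eq (hℓ : 0 < ℓ) {n : ℕ} (ε : Fin n → Fin ℓ) :
    ∑ k : Fin n, (ε k : ℝ) / (ℓ : ℝ) ^ ((k : ℕ) + 1)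
      = ((wordEquiv ℓ n ε : ℕ) : ℝ) / (ℓ : ℝ) ^ n := by
  have hℓ' : (ℓ : ℝ) ≠ 0 := by positivity
  have h : ((wordEquiv ℓ n ε : ℕ) : ℝ)
      = ∑ k : Fin n, (ε (Fin.rev k) : ℝ) * (ℓ : ℝ) ^ (k : ℕ) := by
    simp [wordEquiv]
  rw [h, Finset.sum_div]
  refine Eq.trans ?_ (Equiv.sum_comp Fin.revPerm
    fun k : Fin n => (ε (Fin.rev k) : ℝ) * (ℓ : ℝ) ^ (k : ℕ) / (ℓ : ℝ) ^ n)
  refine Finset.sum_congr rfl fun k _ => ?_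
  have hk : (Fin.rev k : ℕ) + ((k : ℕ) + 1) = n := by
    rw [Fin.val_rev]; omega
  rw [Fin.revPerm_apply, Fin.rev_rev, div_eq_div_iff (by positivity) (by positivity), mul_assoc,
    ← pow_add, hk]

theorem adicInterval_eq (hℓ : 0 < ℓ) {n : ℕ} (ε : Fin n → Fin ℓ) :
    adicInterval ℓ n ε = Set.Ico (((wordEquiv ℓ n ε : ℕ) : ℝ) / (ℓ : ℝ) ^ n)
      (((wordEquiv ℓ n ε : ℕ) + 1 : ℝ) / (ℓ : ℝ) ^ n) := by
  rw [adicInterval, sum_div_pow_eq hℓ, add_div]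

theorem mem_adicInterval_iff (hℓ : 0 < ℓ) {n : ℕ} (ε : Fin n → Fin ℓ) (x : ℝ) :
    x ∈ adicInterval ℓ n ε ↔ ⌊x * (ℓ : ℝ) ^ n⌋ = ((wordEquiv ℓ n ε : ℕ) : ℤ) := by
  have : (0 : ℝ) < (ℓ : ℝ) ^ n := by positivity
  rw [adicInterval_eq hℓ, Int.floor_eq_iff, Set.mem_Ico, div_le_iff₀ this, lt_div_iff₀ this]
  simp

theorem measurableSet_adicInterval (n : ℕ) (ε : Fin n → Fin ℓ) :
    MeasurableSet (adicInterval ℓ n ε) := measurableSet_Ico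

theorem eq_of_mem_adicInterval (hℓ : 0 < ℓ) {n : ℕ} {ε δ : Fin n → Fin ℓ} {x : ℝ}
    (h : x ∈ adicInterval ℓ n ε) (h' : x ∈ adicInterval ℓ n δ) : ε = δ := by
  rw [mem_adicInterval_iff hℓ] at h h'
  refine (wordEquiv ℓ n).injective (Fin.ext ?_)
  have := h.symm.trans h'
  exact_mod_cast this

theorem disjoint_adicInterval (hℓ : 0 < ℓ) {n : ℕ} {ε δ : Fin n → Fin ℓ} (h : ε ≠ δ) :
    Disjoint (adicInterval ℓ n ε) (adicInterval ℓ n δ) :=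
  Set.disjoint_left.2 fun _ h1 h2 => h (eq_of_mem_adicInterval hℓ h1 h2)

theorem exists_mem_adicInterval (hℓ : 0 < ℓ) (n : ℕ) {x : ℝ} (hx : x ∈ Set.Ico (0 : ℝ) 1) :
    ∃ ε : Fin n → Fin ℓ, x ∈ adicInterval ℓ n ε := by
  have hp : (0 : ℝ) < (ℓ : ℝ) ^ n := by positivity
  have h0 : 0 ≤ ⌊x * (ℓ : ℝ) ^ n⌋ := Int.floor_nonneg.2 (mul_nonneg hx.1 hp.le)
  have h1 : ⌊x * (ℓ : ℝ) ^ n⌋ < (ℓ ^ n : ℕ) := by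
    rw [Int.floor_lt]
    push_cast
    nlinarith [hx.2]
  refine ⟨(wordEquiv ℓ n).symm ⟨⌊x * (ℓ : ℝ) ^ n⌋.toNat, by omega⟩, ?_⟩
  rw [mem_adicInterval_iff hℓ, Equiv.apply_symm_apply]
  simp [h0]

theorem adicInterval_subset (hℓ : 0 < ℓ) {n : ℕ} (ε : Fin n → Fin ℓ) :
    adicInterval ℓ n ε ⊆ Set.Ico 0 1 := by
  have hp : (0 : ℝ) < (ℓ : ℝ) ^ n := by positivity
  rw [adicInterval_eq hℓ]
  refine Set.Ico_subset_Ico (by positivity) ?_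
  rw [div_le_one hp]
  exact_mod_cast (wordEquiv ℓ n ε).isLt

theorem adicInterval_zero (ε : Fin 0 → Fin ℓ) :
    adicInterval ℓ 0 ε = Set.Ico 0 1 := by
  simp [adicInterval]

theorem adicIntervalAt_eq (hℓ : 0 < ℓ) {n : ℕ} {ε : Fin n → Fin ℓ} {x : ℝ}
    (hx : x ∈ adicInterval ℓ n ε) : adicIntervalAt ℓ n x = adicInterval ℓ n ε := by
  ext y
  simp only [adicIntervalAt, Set.mem_iUnion, exists_prop]
  constructor
  · rintro ⟨δ, h1, h2⟩
    rwa [eq_of_mem_adicInterval hℓ hx h1]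
  · exact fun h => ⟨ε, hx, h⟩

theorem volume_adicInterval (n : ℕ) (ε : Fin n → Fin ℓ) :
    volume (adicInterval ℓ n ε) = ENNReal.ofReal (1 / (ℓ : ℝ) ^ n) := by
  rw [adicInterval, Real.volume_Ico]
  congr 1; ring

theorem ediam_adicInterval_le (n : ℕ) (ε : Fin n → Fin ℓ) :
    Metric.ediam (adicInterval ℓ n ε) ≤ ENNReal.ofReal (1 / (ℓ : ℝ) ^ n) := by
  rw [adicInterval]
  refine (Metric.ediam_mono Set.Ico_subset_Icc_self).trans ?_
  rw [Real.ediam_Icc]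
  exact ENNReal.ofReal_le_ofReal (by linarith)

/-- A set of diameter at most `ℓ⁻ⁿ` meets at most three `ℓ`-adic intervals of generation `n`. -/
theorem exists_adicInterval_cover (hℓ : 0 < ℓ) (n : ℕ) {U : Set ℝ}
    (hU : ∀ x ∈ U, ∀ y ∈ U, |x - y| ≤ 1 / (ℓ : ℝ) ^ n) :
    ∃ T : Finset (Fin n → Fin ℓ), T.card ≤ 3 ∧
      U ∩ Set.Ico 0 1 ⊆ ⋃ ε ∈ T, adicInterval ℓ n ε := by
  classical
  have hp : (0 : ℝ) < (ℓ : ℝ) ^ n := by positivity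
  rcases (U ∩ Set.Ico (0 : ℝ) 1).eq_empty_or_nonempty with h | ⟨x₀, hx₀⟩
  · exact ⟨∅, by simp, by simp [h]⟩
  set j : ℤ := ⌊x₀ * (ℓ : ℝ) ^ n⌋ with hj
  refine ⟨Finset.univ.filter fun ε => ((wordEquiv ℓ n ε : ℕ) : ℤ) ∈ Finset.Icc (j - 1) (j + 1),
    ?_, ?_⟩
  · have : (Finset.Icc (j - 1) (j + 1)).card = 3 := by
      rw [Int.card_Icc]; omega
    rw [← this]
    refine Finset.card_le_card_of_injOn (fun ε => ((wordEquiv ℓ n ε : ℕ) : ℤ)) ?_ ?_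
    · intro ε hε
      simpa using hε
    · intro ε _ δ _ h
      exact (wordEquiv ℓ n).injective (Fin.ext (Int.ofNat.inj h))
  · intro y hy
    obtain ⟨ε, hε⟩ := exists_mem_adicInterval hℓ n hy.2
    simp only [Set.mem_iUnion, Finset.mem_filter, Finset.mem_univ, true_and, exists_prop]
    refine ⟨ε, ?_, hε⟩
    rw [mem_adicInterval_iff hℓ] at hε
    rw [← hε, Finset.mem_Icc]
    have hd := abs_le.1 (hU y hy.1 x₀ hx₀.1)
    have h1 : (y - x₀) * (ℓ : ℝ) ^ n ≤ 1 := by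
      have := mul_le_mul_of_nonneg_right hd.2 hp.le
      rwa [div_mul_cancel₀ _ hp.ne'] at this
    have h2 : -1 ≤ (y - x₀) * (ℓ : ℝ) ^ n := by
      have := mul_le_mul_of_nonneg_right hd.1 hp.le
      rwa [neg_mul, div_mul_cancel₀ _ hp.ne'] at this
    constructor
    · rw [Int.le_floor, Int.cast_sub, Int.cast_one]
      have := Int.floor_le (x₀ * (ℓ : ℝ) ^ n)
      linarith
    · rw [← Int.floor_add_one, Int.le_floor]
      have := Int.floor_le (y * (ℓ : ℝ) ^ n)
      refine (Int.cast_le.2 (Int.floor_le_floor (a := y * (ℓ : ℝ) ^ n) ?_)).trans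
        (Int.floor_le _)
      linarith

theorem sum_div_pow_append {k r : ℕ} (ε : Fin k → Fin ℓ) (δ : Fin r → Fin ℓ) :
    ∑ i : Fin (k + r), ((Fin.append ε δ i : Fin ℓ) : ℝ) / (ℓ : ℝ) ^ ((i : ℕ) + 1)
      = ∑ i : Fin k, (ε i : ℝ) / (ℓ : ℝ) ^ ((i : ℕ) + 1)
        + (∑ i : Fin r, (δ i : ℝ) / (ℓ : ℝ) ^ ((i : ℕ) + 1)) / (ℓ : ℝ) ^ k := by
  rw [Fin.sum_univ_add, Finset.sum_div]
  congr 1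
  · simp
  · refine Finset.sum_congr rfl fun i _ => ?_
    simp only [Fin.append_right, Fin.val_natAdd]
    rw [div_div, ← pow_add]
    congr 2; ring

theorem adicInterval_append_subset (hℓ : 0 < ℓ) {k r : ℕ} (ε : Fin k → Fin ℓ)
    (δ : Fin r → Fin ℓ) : adicInterval ℓ (k + r) (Fin.append ε δ) ⊆ adicInterval ℓ k ε := by
  have hk : (0 : ℝ) < (ℓ : ℝ) ^ k := by positivity
  have hr : (0 : ℝ) < (ℓ : ℝ) ^ r := by positivity
  have h1 := (wordEquiv ℓ r δ).isLt
  have h2 : ((wordEquiv ℓ r δ : ℕ) : ℝ) + 1 ≤ (ℓ : ℝ) ^ r := by exact_mod_cast h1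
  have h3 : ((wordEquiv ℓ r δ : ℕ) : ℝ) / (ℓ : ℝ) ^ r + 1 / (ℓ : ℝ) ^ r ≤ 1 := by
    rw [← add_div, div_le_one hr]; exact h2
  unfold adicInterval
  rw [sum_div_pow_append, sum_div_pow_eq hℓ δ]
  refine Set.Ico_subset_Ico (le_add_of_nonneg_right (by positivity)) ?_
  have h4 : (((wordEquiv ℓ r δ : ℕ) : ℝ) / (ℓ : ℝ) ^ r) / (ℓ : ℝ) ^ k + 1 / (ℓ : ℝ) ^ (k + r)
      = (((wordEquiv ℓ r δ : ℕ) : ℝ) / (ℓ : ℝ) ^ r + 1 / (ℓ : ℝ) ^ r) / (ℓ : ℝ) ^ k := by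
    rw [pow_add]; field_simp
  rw [add_assoc, h4]
  gcongr

theorem adicInterval_eq_iUnion_append (hℓ : 0 < ℓ) {k : ℕ} (r : ℕ) (ε : Fin k → Fin ℓ) :
    adicInterval ℓ k ε = ⋃ δ : Fin r → Fin ℓ, adicInterval ℓ (k + r) (Fin.append ε δ) := by
  refine Set.Subset.antisymm (fun x hx => ?_)
    (Set.iUnion_subset fun δ => adicInterval_append_subset hℓ ε δ)
  obtain ⟨η, hη⟩ := exists_mem_adicInterval hℓ (k + r) (adicInterval_subset hℓ ε hx)
  obtain ⟨⟨ε', δ⟩, rfl⟩ := (Fin.appendEquiv k r).surjective η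
  have : ε = ε' := eq_of_mem_adicInterval hℓ hx (adicInterval_append_subset hℓ ε' δ hη)
  subst this
  exact Set.mem_iUnion.2 ⟨δ, hη⟩

end

/-! ### Weak limits of measures that converge on `ℓ`-adic intervals -/

section

variable {ℓ : ℕ}

/-- The distribution function at an `ℓ`-adic point is a finite sum of masses of `ℓ`-adic intervals.
-/
theorem measureReal_Iio_adic (hℓ : 0 < ℓ) (k : ℕ) (j : ℤ) {μ : Measure ℝ} [IsFiniteMeasure μ]
    (h0 : μ (Set.Ico 0 1)ᶜ = 0) :
    μ.real (Set.Iio ((j : ℝ) / (ℓ : ℝ) ^ k))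
      = ∑ ε : Fin k → Fin ℓ with ((wordEquiv ℓ k ε : ℕ) : ℤ) < j, μ.real (adicInterval ℓ k ε) := by
  have hp : (0 : ℝ) < (ℓ : ℝ) ^ k := by positivity
  rw [← measureReal_biUnion_finset (fun ε _ δ _ h => disjoint_adicInterval hℓ h)
    (fun ε _ => measurableSet_adicInterval k ε)]
  simp only [measureReal_def]
  congr 1
  rw [← measure_inter_conull h0]
  congr 1
  ext x
  simp only [Set.mem_inter_iff, Set.mem_Iio, Finset.mem_filter, Finset.mem_univ, true_and,
    Set.mem_iUnion, exists_prop]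
  constructor
  · rintro ⟨h1, h2⟩
    obtain ⟨ε, hε⟩ := exists_mem_adicInterval hℓ k h2
    refine ⟨ε, ?_, hε⟩
    rw [mem_adicInterval_iff hℓ] at hε
    rw [← hε, Int.floor_lt]
    rwa [lt_div_iff₀ hp] at h1
  · rintro ⟨ε, h1, hε⟩
    refine ⟨?_, adicInterval_subset hℓ ε hε⟩
    rw [mem_adicInterval_iff hℓ] at hε
    rwa [lt_div_iff₀ hp, ← Int.floor_lt, hε]

variable {μ : ℕ → FiniteMeasure ℝ} {M : ∀ k : ℕ, (Fin k → Fin ℓ) → ℝ≥0∞}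

/-- At a fine enough scale, sets of small diameter have mass at most `η` for all large `n`: they are
covered by three `ℓ`-adic intervals. -/
theorem exists_equicontinuity_scale (hℓ : 0 < ℓ) (h0 : ∀ n, (μ n : Measure ℝ) (Set.Ico 0 1)ᶜ = 0)
    (hM : ∀ k ε, Tendsto (fun n => (μ n : Measure ℝ) (adicInterval ℓ k ε)) atTop (𝓝 (M k ε)))
    (hsmall : ∀ η > 0, ∃ k, ∀ ε, M k ε < η) {η : ℝ} (hη : 0 < η) :
    ∃ k, ∀ᶠ n in atTop, ∀ U : Set ℝ, (∀ x ∈ U, ∀ y ∈ U, |x - y| ≤ 1 / (ℓ : ℝ) ^ k) →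
      (μ n : Measure ℝ).real U ≤ η := by
  have hη3 : (0 : ℝ≥0∞) < ENNReal.ofReal (η / 3) := ENNReal.ofReal_pos.2 (by positivity)
  obtain ⟨k, hk⟩ := hsmall _ hη3
  refine ⟨k, ?_⟩
  have : ∀ᶠ n in atTop, ∀ ε, (μ n : Measure ℝ) (adicInterval ℓ k ε) < ENNReal.ofReal (η / 3) :=
    eventually_all.2 fun ε => (hM k ε).eventually (gt_mem_nhds (hk ε))
  filter_upwards [this] with n hn U hU
  obtain ⟨T, hT, hcov⟩ := exists_adicInterval_cover hℓ k hU
  refine ENNReal.toReal_le_of_le_ofReal hη.le ?_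
  calc (μ n : Measure ℝ) U = (μ n : Measure ℝ) (U ∩ Set.Ico 0 1) :=
        (measure_inter_conull (h0 n)).symm
    _ ≤ (μ n : Measure ℝ) (⋃ ε ∈ T, adicInterval ℓ k ε) := measure_mono hcov
    _ ≤ ∑ ε ∈ T, (μ n : Measure ℝ) (adicInterval ℓ k ε) := measure_biUnion_finset_le _ _
    _ ≤ ∑ _ε ∈ T, ENNReal.ofReal (η / 3) := Finset.sum_le_sum fun ε _ => (hn ε).le
    _ ≤ 3 * ENNReal.ofReal (η / 3) := by
        rw [Finset.sum_const, nsmul_eq_mul]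
        gcongr
        exact_mod_cast hT
    _ = ENNReal.ofReal η := by
        rw [← ENNReal.ofReal_ofNat, ← ENNReal.ofReal_mul (by norm_num)]
        congr 1; ring

theorem measureReal_Iio_sub {ν : Measure ℝ} [IsFiniteMeasure ν] {a b : ℝ} (h : a ≤ b) :
    ν.real (Set.Iio b) - ν.real (Set.Iio a) = ν.real (Set.Ico a b) := by
  rw [← Set.Iio_union_Ico_eq_Iio h, measureReal_union (by
    rw [Set.disjoint_left]; intro x h1 h2; exact not_lt.2 h2.1 h1) measurableSet_Ico]
  ring

theorem abs_sub_le_of_mem_Ico {a b x y d : ℝ} (h : b - a ≤ d) (hx : x ∈ Set.Ico a b)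
    (hy : y ∈ Set.Ico a b) : |x - y| ≤ d := by
  rw [abs_le]
  constructor <;> linarith [hx.1, hx.2, hy.1, hy.2]

/-- The distribution functions converge at `ℓ`-adic points by hypothesis, and elsewhere because of
equicontinuity. -/
theorem exists_tendsto_measureReal_Iio (hℓ : 0 < ℓ)
    (h0 : ∀ n, (μ n : Measure ℝ) (Set.Ico 0 1)ᶜ = 0)
    (hM : ∀ k ε, Tendsto (fun n => (μ n : Measure ℝ) (adicInterval ℓ k ε)) atTop (𝓝 (M k ε)))
    (hfin : ∀ k ε, M k ε ≠ ∞) (hsmall : ∀ η > 0, ∃ k, ∀ ε, M k ε < η) (x : ℝ) :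
    ∃ y, Tendsto (fun n => (μ n : Measure ℝ).real (Set.Iio x)) atTop (𝓝 y) := by
  refine cauchySeq_tendsto_of_complete (Metric.cauchySeq_iff.2 fun η hη => ?_)
  obtain ⟨k, hk⟩ := exists_equicontinuity_scale hℓ h0 hM hsmall (show 0 < η / 4 by positivity)
  have hp : (0 : ℝ) < (ℓ : ℝ) ^ k := by positivity
  set y : ℝ := (⌊x * (ℓ : ℝ) ^ k⌋ : ℝ) / (ℓ : ℝ) ^ k with hy
  have hyx : y ≤ x := by
    rw [hy, div_le_iff₀ hp]; exact Int.floor_le _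
  have hxy : x - y ≤ 1 / (ℓ : ℝ) ^ k := by
    rw [hy, le_div_iff₀ hp, sub_mul, div_mul_cancel₀ _ hp.ne']
    linarith [Int.lt_floor_add_one (x * (ℓ : ℝ) ^ k)]
  have hconv : CauchySeq fun n => (μ n : Measure ℝ).real (Set.Iio y) := by
    have : Tendsto (fun n => (μ n : Measure ℝ).real (Set.Iio y)) atTop
        (𝓝 (∑ ε : Fin k → Fin ℓ with ((wordEquiv ℓ k ε : ℕ) : ℤ) < ⌊x * (ℓ : ℝ) ^ k⌋,
          (M k ε).toReal)) := by
      simp only [hy, measureReal_Iio_adic hℓ k _ (h0 _)]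
      exact tendsto_finsetSum _ fun ε _ => (ENNReal.tendsto_toReal (hfin k ε)).comp (hM k ε)
    exact this.cauchySeq
  obtain ⟨N₁, hN₁⟩ := eventually_atTop.1 hk
  obtain ⟨N₂, hN₂⟩ := Metric.cauchySeq_iff.1 hconv (η / 4) (by positivity)
  refine ⟨max N₁ N₂, fun m hm n hn => ?_⟩
  have e (i : ℕ) (hi : N₁ ≤ i) : |(μ i : Measure ℝ).real (Set.Iio x)
      - (μ i : Measure ℝ).real (Set.Iio y)| ≤ η / 4 := by
    rw [measureReal_Iio_sub hyx, abs_of_nonneg measureReal_nonneg]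
    exact hN₁ i hi _ fun a ha b hb => abs_sub_le_of_mem_Ico hxy ha hb
  have e1 := abs_le.1 (e m (le_trans (le_max_left _ _) hm))
  have e2 := abs_le.1 (e n (le_trans (le_max_left _ _) hn))
  have e3 := hN₂ m (le_trans (le_max_right _ _) hm) n (le_trans (le_max_right _ _) hn)
  rw [Real.dist_eq, abs_lt] at e3 ⊢
  constructor <;> linarith [e1.1, e1.2, e2.1, e2.2, e3.1, e3.2]

/-- The Stieltjes measure of a continuous distribution function carried by `[0, 1]`. -/
theorem exists_finiteMeasure_Ico {F : ℝ → ℝ} (hmono : Monotone F) (hcont : Continuous F)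
    (hF0 : ∀ x ≤ 0, F x = 0) (hF1 : ∀ x, 1 ≤ x → F x = F 1) :
    ∃ m : FiniteMeasure ℝ, (∀ a b, (m : Measure ℝ) (Set.Ico a b) = ENNReal.ofReal (F b - F a)) ∧
      (m : Measure ℝ) (Set.Ico 0 1)ᶜ = 0 := by
  obtain ⟨f, hf⟩ : ∃ f : StieltjesFunction ℝ, ∀ x, f x = F x :=
    ⟨⟨F, hmono, fun x => hcont.continuousWithinAt⟩, fun _ => rfl⟩
  have hff : (f : ℝ → ℝ) = F := funext hf
  have hleft (x : ℝ) : Function.leftLim f x = F x := by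
    rw [hff]
    exact ContinuousWithinAt.leftLim_eq hcont.continuousWithinAt
  have hbot : Tendsto f atBot (𝓝 0) := by
    rw [hff]
    exact tendsto_const_nhds.congr' ((eventually_le_atBot 0).mono fun x hx => (hF0 x hx).symm)
  have htop : Tendsto f atTop (𝓝 (F 1)) := by
    rw [hff]
    exact tendsto_const_nhds.congr' ((eventually_ge_atTop 1).mono fun x hx => (hF1 x hx).symm)
  have hmfin : IsFiniteMeasure f.measure := f.isFiniteMeasure hbot htop
  have hIco (a b : ℝ) : f.measure (Set.Ico a b) = ENNReal.ofReal (F b - F a) := by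
    rw [f.measure_Ico, hleft, hleft]
  refine ⟨⟨f.measure, hmfin⟩, hIco, ?_⟩
  change f.measure _ = 0
  rw [measure_compl measurableSet_Ico (measure_ne_top _ _), f.measure_univ hbot htop, hIco,
    hF0 0 le_rfl, tsub_self]

/-- Finite measures on `[0, 1)` whose values on all `ℓ`-adic intervals converge, with limits that
become uniformly small with the generation, converge weakly. The smallness excludes atoms in the
limit, so that the limit measure has the limit values on the `ℓ`-adic intervals. -/
theorem exists_tendsto_of_tendsto_adicInterval (hℓ : 0 < ℓ)
    (h0 : ∀ n, (μ n : Measure ℝ) (Set.Ico 0 1)ᶜ = 0)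
    (hM : ∀ k ε, Tendsto (fun n => (μ n : Measure ℝ) (adicInterval ℓ k ε)) atTop (𝓝 (M k ε)))
    (hfin : ∀ k ε, M k ε ≠ ∞) (hne : ∀ ε, M 0 ε ≠ 0)
    (hsmall : ∀ η > 0, ∃ k, ∀ ε, M k ε < η) :
    ∃ m : FiniteMeasure ℝ, Tendsto μ atTop (𝓝 m) ∧ (m : Measure ℝ) (Set.Ico 0 1)ᶜ = 0 ∧
      ∀ k ε, (m : Measure ℝ) (adicInterval ℓ k ε) = M k ε := by
  choose F hF using exists_tendsto_measureReal_Iio hℓ h0 hM hfin hsmall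
  have hFIco {a b : ℝ} (h : a ≤ b) :
      Tendsto (fun n => (μ n : Measure ℝ).real (Set.Ico a b)) atTop (𝓝 (F b - F a)) :=
    ((hF b).sub (hF a)).congr fun n => measureReal_Iio_sub h
  have hmono : Monotone F := fun a b h => by
    have := ge_of_tendsto' (hFIco h) fun n => measureReal_nonneg
    linarith
  have hcont : Continuous F := by
    rw [Metric.continuous_iff]
    intro x η hη
    obtain ⟨k, hk⟩ := exists_equicontinuity_scale hℓ h0 hM hsmall (show 0 < η / 2 by positivity)
    have key {a b : ℝ} (hab : a ≤ b) (hd : b - a ≤ 1 / (ℓ : ℝ) ^ k) : F b - F a ≤ η / 2 :=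
      le_of_tendsto (hFIco hab) (hk.mono fun n hn =>
        hn _ fun x hx y hy => abs_sub_le_of_mem_Ico hd hx hy)
    refine ⟨1 / (ℓ : ℝ) ^ k, by positivity, fun y hy => ?_⟩
    rw [Real.dist_eq, abs_lt] at hy ⊢
    rcases le_total x y with h | h
    · have := key h hy.2.le
      have := hmono h
      constructor <;> linarith
    · have := key h (by linarith [hy.1])
      have := hmono h
      constructor <;> linarith
  have hF0 {x : ℝ} (hx : x ≤ 0) : F x = 0 := by
    refine tendsto_nhds_unique (hF x) ?_
    refine tendsto_const_nhds.congr fun n => ?_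
    rw [measureReal_def, measure_mono_null _ (h0 n), ENNReal.toReal_zero]
    intro y hy h
    exact absurd (lt_of_lt_of_le hy hx) (not_lt.2 h.1)
  have hF1 {x : ℝ} (hx : 1 ≤ x) : F x = F 1 := by
    have h1 := hFIco hx
    have h2 : Tendsto (fun n => (μ n : Measure ℝ).real (Set.Ico 1 x)) atTop (𝓝 0) := by
      refine tendsto_const_nhds.congr fun n => ?_
      rw [measureReal_def, measure_mono_null _ (h0 n), ENNReal.toReal_zero]
      intro y hy h
      exact absurd h.2 (not_lt.2 hy.1)
    linarith [tendsto_nhds_unique h1 h2]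
  obtain ⟨m, hmIco, hcompl⟩ :=
    exists_finiteMeasure_Ico hmono hcont (fun x hx => hF0 hx) fun x hx => hF1 hx
  have hIco {a b : ℝ} (h : a ≤ b) :
      Tendsto (fun n => (μ n : Measure ℝ) (Set.Ico a b)) atTop
        (𝓝 ((m : Measure ℝ) (Set.Ico a b))) := by
    rw [hmIco]
    refine (ENNReal.tendsto_ofReal (hFIco h)).congr fun n => ?_
    rw [measureReal_def, ENNReal.ofReal_toReal (measure_ne_top _ _)]
  have hmM (k : ℕ) (ε : Fin k → Fin ℓ) : (m : Measure ℝ) (adicInterval ℓ k ε) = M k ε :=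
    tendsto_nhds_unique (hIco (by simp)) (hM k ε)
  have hmass : Tendsto (fun n => (μ n).mass) atTop (𝓝 m.mass) := by
    rw [← ENNReal.tendsto_coe]
    have h1 := hIco (zero_le_one' ℝ)
    have e (ν : FiniteMeasure ℝ) (hν : (ν : Measure ℝ) (Set.Ico 0 1)ᶜ = 0) :
        (ν.mass : ℝ≥0∞) = (ν : Measure ℝ) (Set.Ico 0 1) := by
      rw [FiniteMeasure.ennreal_mass, ← measure_inter_conull hν, Set.univ_inter]
    rw [e m hcompl]
    exact h1.congr fun n => (e _ (h0 n)).symm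
  have hm0 : m ≠ 0 := by
    intro h
    refine hne (fun i => i.elim0) ?_
    rw [← hmM, h]
    simp
  have hmass0 : m.mass ≠ 0 := m.mass_nonzero_iff.2 hm0
  refine ⟨m, ?_, hcompl, hmM⟩
  -- Weak convergence is tested on the intervals `[a, b)`, after normalising to probability
  -- measures.
  refine (FiniteMeasure.tendsto_normalize_iff_tendsto hm0).1 ⟨?_, hmass⟩
  refine (isPiSystem_Ico (id : ℝ → ℝ) id).tendsto_probabilityMeasure_of_tendsto_of_mem ?_ ?_ ?_
  · rintro s ⟨a, b, -, rfl⟩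
    exact measurableSet_Ico
  · intro u hu x hx
    obtain ⟨a, b, hab, hsub⟩ := mem_nhds_iff_exists_Ioo_subset.1 (hu.mem_nhds hx)
    obtain ⟨a', ha1, ha2⟩ := exists_between hab.1
    exact ⟨Set.Ico a' b, ⟨a', b, ha2.trans hab.2, rfl⟩, Ico_mem_nhds ha2 hab.2,
      (Set.Ico_subset_Ioo_left ha1).trans hsub⟩
  · rintro s ⟨a, b, hab, rfl⟩
    have h1 : Tendsto (fun n => (μ n).mass⁻¹ * μ n (Set.Ico a b)) atTop
        (𝓝 (m.mass⁻¹ * m (Set.Ico a b))) := by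
      refine (hmass.inv₀ hmass0).mul ?_
      exact (ENNReal.tendsto_toNNReal (measure_ne_top _ _)).comp (hIco hab.le)
    rw [← m.normalize_eq_of_nonzero hm0] at h1
    refine h1.congr' ?_
    filter_upwards [hmass.eventually_ne hmass0] with n hn
    exact ((μ n).normalize_eq_of_nonzero ((μ n).mass_nonzero_iff.1 hn) _).symm

end

/-! ### The cascade measure on the tree -/

section Spec

variable {ℓ : ℕ} {c : ℝ → ℝ≥0}

/-- The family of weights `c (w ε)`, as random variables on the space of trees. -/
noncomputable def weightField (c : ℝ → ℝ≥0) (ε : List (Fin ℓ)) (w : Tree ℓ) : ℝ := c (w ε)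

theorem weightField_nonneg (ε : List (Fin ℓ)) (w : Tree ℓ) : 0 ≤ weightField c ε w :=
  NNReal.coe_nonneg _

/-- The mass of `I_l` in its own generation: the density times the length `ℓ⁻ⁿ`. -/
theorem ofReal_prod_mul_inv_pow (l : List (Fin ℓ)) (w : Tree ℓ) :
    ENNReal.ofReal (∏ k ∈ Finset.range l.length, weightField c (l.take (k + 1)) w)
      * (ℓ : ℝ≥0∞)⁻¹ ^ l.length = cyl c 1 l w := by
  induction l generalizing w with
  | nil => simp [cyl]
  | cons i δ ih =>
    rw [List.length_cons, Finset.prod_range_succ', ENNReal.ofReal_mul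
      (Finset.prod_nonneg fun _ _ => weightField_nonneg _ _), cyl, ← ih (sub i w), pow_succ]
    have e : ENNReal.ofReal (weightField c ((i :: δ).take (0 + 1)) w) = c (w [i]) := by
      simp [weightField]
    rw [e]
    simp only [List.take_succ_cons]
    change ENNReal.ofReal (∏ k ∈ Finset.range δ.length, weightField c (δ.take (k + 1)) (sub i w))
      * _ * _ = _
    ring

theorem density_eq_prefixProd {Ω : Type*} (hℓ : 0 < ℓ) (W : List (Fin ℓ) → Ω → ℝ) {n : ℕ}
    (ω : Ω) {ε : Fin n → Fin ℓ} {x : ℝ} (hx : x ∈ adicInterval ℓ n ε) :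
    density W n ω x = prefixProd W n ε ω := by
  rw [density, Finset.sum_eq_single ε]
  · rw [Set.indicator_of_mem hx]
  · intro δ _ hδ
    exact Set.indicator_of_notMem (fun h => hδ (eq_of_mem_adicInterval hℓ h hx)) _
  · simp

theorem approx_adicInterval (hℓ : 0 < ℓ) (n : ℕ) (ε : Fin n → Fin ℓ) (w : Tree ℓ) :
    (approx (weightField c) n w : Measure ℝ) (adicInterval ℓ n ε)
      = cyl c 1 (List.ofFn ε) w := by
  change (volume.withDensity fun x => ENNReal.ofReal (density (weightField c) n w x)) _ = _
  rw [withDensity_apply _ (measurableSet_adicInterval n ε),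
    setLIntegral_congr_fun (measurableSet_adicInterval n ε)
      (g := fun _ => ENNReal.ofReal (prefixProd (weightField c) n ε w))
      fun x hx => by simp only [density_eq_prefixProd hℓ _ w hx],
    setLIntegral_const, volume_adicInterval, ← ofReal_prod_mul_inv_pow, List.length_ofFn]
  congr 1
  rw [one_div, ENNReal.ofReal_inv_of_pos (by positivity), ENNReal.ofReal_pow (by positivity),
    ENNReal.ofReal_natCast, ENNReal.inv_pow]

theorem cyl_append (f : Tree ℓ → ℝ≥0∞) (ε δ : List (Fin ℓ)) (w : Tree ℓ) :
    cyl c f (ε ++ δ) w = cyl c (cyl c f δ) ε w := by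
  induction ε generalizing w with
  | nil => rfl
  | cons i ε ih => simp only [List.cons_append, cyl, ih]

/-- An interval of generation `k` has, in generation `k + r`, its own weight times the mass of
generation `r` of its subtree. -/
theorem approx_add_adicInterval (hℓ : 0 < ℓ) (k r : ℕ) (ε : Fin k → Fin ℓ) (w : Tree ℓ) :
    (approx (weightField c) (k + r) w : Measure ℝ) (adicInterval ℓ k ε)
      = cyl c (mass c r) (List.ofFn ε) w := by
  rw [adicInterval_eq_iUnion_append hℓ r ε, measure_iUnion]
  rotate_left
  · intro δ δ' h
    refine disjoint_adicInterval hℓ fun h' => h ?_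
    funext j
    simpa using congrFun h' (Fin.natAdd k j)
  · exact fun δ => measurableSet_adicInterval _ _
  rw [tsum_fintype]
  simp only [approx_adicInterval hℓ, List.ofFn_fin_append, cyl_append]
  rw [cyl_eq_mul c (mass c r)]
  simp only [cyl_eq_mul c (cyl c 1 _) (List.ofFn ε)]
  rw [← Finset.mul_sum]
  congr 1
  exact (mass_add c r 0 _).symm

theorem approx_compl_Ico (hℓ : 0 < ℓ) {Ω : Type*} (W : List (Fin ℓ) → Ω → ℝ) (n : ℕ) (ω : Ω) :
    (approx W n ω : Measure ℝ) (Set.Ico 0 1)ᶜ = 0 := by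
  change (volume.withDensity fun x => ENNReal.ofReal (density W n ω x)) _ = _
  rw [withDensity_apply _ measurableSet_Ico.compl,
    setLIntegral_congr_fun measurableSet_Ico.compl (g := fun _ => 0), lintegral_zero]
  intro x hx
  simp only
  rw [density, Finset.sum_eq_zero, ENNReal.ofReal_zero]
  intro ε _
  exact Set.indicator_of_notMem (fun h => hx (adicInterval_subset hℓ ε h)) _

theorem cyl_one_ne_top (hℓ : 0 < ℓ) (ε : List (Fin ℓ)) (w : Tree ℓ) : cyl c 1 ε w ≠ ∞ := by
  induction ε generalizing w with
  | nil => simp [cyl]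
  | cons i ε ih => exact ENNReal.mul_ne_top (inv_mul_coe_ne_top hℓ _) (ih _)

theorem cyl_one_ne_zero (hpos : ∀ x, 0 < c x) (ε : List (Fin ℓ)) (w : Tree ℓ) :
    cyl c 1 ε w ≠ 0 := by
  induction ε generalizing w with
  | nil => simp [cyl]
  | cons i ε ih => exact mul_ne_zero (inv_mul_coe_ne_zero hpos _) (ih _)

theorem Converges.tendsto_approx (hℓ : 0 < ℓ) {w : Tree ℓ} (h : Converges c w) (k : ℕ)
    (ε : Fin k → Fin ℓ) :
    Tendsto (fun n => (approx (weightField c) n w : Measure ℝ) (adicInterval ℓ k ε)) atTop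
      (𝓝 (cyl c (limMass c) (List.ofFn ε) w)) := by
  rw [← tendsto_add_atTop_iff_nat k]
  simp only [Nat.add_comm _ k, approx_add_adicInterval hℓ]
  simp only [cyl_eq_mul c (mass c _), cyl_eq_mul c (limMass c)]
  exact ENNReal.Tendsto.const_mul (h _).2 (Or.inr (cyl_one_ne_top hℓ _ _))

/-- The cascade with weights `c (w ε)` at the tree `w` is the weak limit of its approximations, is
carried by `[0, 1)`, and gives the interval of the word `ε` the positive finite mass
`cyl c (limMass c) ε w`. -/
structure IsRegular (c : ℝ → ℝ≥0) (w : Tree ℓ) : Prop where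
  compl_Ico : (cascade (weightField c) w : Measure ℝ) (Set.Ico 0 1)ᶜ = 0
  apply_adicInterval : ∀ k ε, (cascade (weightField c) w : Measure ℝ) (adicInterval ℓ k ε)
    = cyl c (limMass c) (List.ofFn ε) w
  ne_zero : ∀ ε, cyl c (limMass c) ε w ≠ 0
  ne_top : ∀ ε, cyl c (limMass c) ε w ≠ ∞

variable {ν : Measure ℝ} [IsProbabilityMeasure ν]

/-- The hypothesis `scaling ℓ ν c p < 1` makes `∑ m(I_ε) ^ p` over the words of length `n` tend to
`0`, so that the masses are uniformly small and the limit measure has no atoms; the `ℓ`-adic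
intervals, whose end points might otherwise carry mass, then keep their limit masses. -/
theorem ae_isRegular (hℓ : 2 ≤ ℓ) (hc : Measurable c) (hpos : ∀ x, 0 < c x)
    (h1 : ∫⁻ x, c x ∂ν = 1) (h0 : ¬∀ᵐ w ∂treeLaw ℓ ν, limMass c w = 0) {p : ℝ} (hp : 0 < p)
    (hY : ∫⁻ w, limMass c w ^ p ∂treeLaw ℓ ν ≠ ∞) (hρ : scaling ℓ ν c p < 1) :
    ∀ᵐ w ∂treeLaw ℓ ν, IsRegular c w := by
  have hℓ0 : 0 < ℓ := by omega
  have hne : ∀ᵐ w ∂treeLaw ℓ ν, ∀ ε, limMass c (subAt ε w) ≠ 0 := ae_all_iff.2 fun ε =>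
    (measurePreserving_subAt ν ε).quasiMeasurePreserving.ae (ae_limMass_ne_zero hℓ hc hpos h1 h0)
  have hsum := ae_tsum_sum_cyl_ne_top (t := 1) (a := p) (b := 0) (ν := ν) hℓ0 hc hc hpos hpos
    (by simpa [jointScaling, scaling] using hρ) (by simpa using hY)
  filter_upwards [ae_converges hℓ0 hc h1, hne, hsum] with w hw hne hsum
  have hz (ε) : cyl c (limMass c) ε w ≠ 0 := by
    rw [cyl_eq_mul]; exact mul_ne_zero (cyl_one_ne_zero hpos _ _) (hne _)
  have ht (ε) : cyl c (limMass c) ε w ≠ ∞ := by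
    rw [cyl_eq_mul]; exact ENNReal.mul_ne_top (cyl_one_ne_top hℓ0 _ _) (hw _).1
  have hsmall : ∀ η > 0, ∃ k, ∀ ε : Fin k → Fin ℓ, cyl c (limMass c) (List.ofFn ε) w < η := by
    intro η hη
    have h2 := ENNReal.tendsto_atTop_zero_of_tsum_ne_top hsum
    obtain ⟨k, hk⟩ := (h2.eventually (gt_mem_nhds (ENNReal.rpow_pos_of_nonneg hη hp.le))).exists
    refine ⟨k, fun ε => (ENNReal.rpow_lt_rpow_iff hp).1 (lt_of_le_of_lt ?_ hk)⟩
    simp only [one_pow, one_mul, ENNReal.rpow_zero, mul_one]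
    exact Finset.single_le_sum (f := fun ε : Fin k → Fin ℓ =>
      cyl c (limMass c) (List.ofFn ε) w ^ p) (fun _ _ => zero_le) (Finset.mem_univ ε)
  obtain ⟨m, hm, hm0, hmM⟩ := exists_tendsto_of_tendsto_adicInterval hℓ0
    (fun n => approx_compl_Ico hℓ0 (weightField c) n w) (fun k ε => hw.tendsto_approx hℓ0 k ε)
    (fun k ε => ht _) (fun ε => hz _) hsmall
  have hcas : cascade (weightField c) w = m := hm.limUnder_eq
  exact ⟨by rw [hcas]; exact hm0, fun k ε => by rw [hcas]; exact hmM k ε, hz, ht⟩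

/-- If the total masses tend to `0`, so do the approximations. -/
theorem cascade_eq_zero (hℓ : 0 < ℓ) {w : Tree ℓ} (hw : Converges c w) (h0 : limMass c w = 0) :
    cascade (weightField c) w = 0 := by
  refine Tendsto.limUnder_eq (FiniteMeasure.tendsto_zero_of_tendsto_zero_mass ?_)
  rw [← ENNReal.tendsto_coe]
  have h := hw.tendsto_approx hℓ 0 Fin.elim0
  simp only [List.ofFn_zero, cyl, h0, adicInterval_zero] at h
  refine h.congr fun n => ?_
  rw [FiniteMeasure.ennreal_mass,
    ← measure_inter_conull (s := Set.univ) (approx_compl_Ico hℓ _ n w), Set.univ_inter]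

end Spec

/-! ### Hausdorff dimension of the level sets of a measure -/

section Dimension

variable {ℓ : ℕ}

/-- Bounds of the form `ℓ^{-na} ≤ M ^ q` as bounds on the exponent `log M / log ℓ⁻ⁿ`. -/
theorem rpow_pow_le_rpow_iff (hℓ : 2 ≤ ℓ) {M : ℝ≥0∞} (h0 : M ≠ 0) (ht : M ≠ ∞) {n : ℕ} (hn : n ≠ 0)
    (a q : ℝ) : ((ℓ : ℝ≥0∞) ^ (-a)) ^ n ≤ M ^ q ↔
      q * (Real.log M.toReal / Real.log (1 / (ℓ : ℝ) ^ n)) ≤ a := by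
  have hℓ0 : (0 : ℝ) < ℓ := by positivity
  have hL : 0 < Real.log ℓ := Real.log_pos (by exact_mod_cast hℓ)
  have hn' : (0 : ℝ) < n := by positivity
  have hM : 0 < M.toReal := ENNReal.toReal_pos h0 ht
  have e1 : ((ℓ : ℝ≥0∞) ^ (-a)) ^ n = ENNReal.ofReal (Real.exp (-a * n * Real.log ℓ)) := by
    rw [← ENNReal.rpow_mul_natCast, ← ENNReal.ofReal_natCast ℓ,
      ENNReal.ofReal_rpow_of_pos hℓ0, Real.rpow_def_of_pos hℓ0]
    congr 2; ring
  have e2 : M ^ q = ENNReal.ofReal (Real.exp (q * Real.log M.toReal)) := by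
    rw [← ENNReal.ofReal_toReal ht, ENNReal.ofReal_rpow_of_pos hM, Real.rpow_def_of_pos hM,
      ENNReal.toReal_ofReal hM.le, mul_comm]
  rw [e1, e2, ENNReal.ofReal_le_ofReal_iff (Real.exp_nonneg _), Real.exp_le_exp, one_div,
    Real.log_inv, Real.log_pow, div_neg, mul_neg, neg_le, ← mul_div_assoc,
    le_div_iff₀ (by positivity), ← mul_assoc]

theorem natCast_rpow_ne_top (hℓ : 0 < ℓ) (a : ℝ) : (ℓ : ℝ≥0∞) ^ a ≠ ∞ :=
  ENNReal.rpow_ne_top_of_ne_zero (by simp; omega) (ENNReal.natCast_ne_top ℓ)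

theorem natCast_rpow_add (hℓ : 0 < ℓ) (a b : ℝ) :
    (ℓ : ℝ≥0∞) ^ (a + b) = (ℓ : ℝ≥0∞) ^ a * (ℓ : ℝ≥0∞) ^ b :=
  ENNReal.rpow_add a b (by simp; omega) (ENNReal.natCast_ne_top ℓ)

theorem ofReal_one_div_pow (hℓ : 0 < ℓ) (n : ℕ) :
    ENNReal.ofReal (1 / (ℓ : ℝ) ^ n) = (ℓ : ℝ≥0∞)⁻¹ ^ n := by
  rw [one_div, ENNReal.ofReal_inv_of_pos (by positivity), ENNReal.ofReal_pow (by positivity),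
    ENNReal.ofReal_natCast, ENNReal.inv_pow]

theorem inv_pow_rpow (n : ℕ) (d : ℝ) :
    ((ℓ : ℝ≥0∞)⁻¹ ^ n) ^ d = ((ℓ : ℝ≥0∞) ^ (-d)) ^ n := by
  rw [ENNReal.rpow_neg, ← ENNReal.inv_rpow, ← ENNReal.rpow_natCast, ← ENNReal.rpow_natCast,
    ← ENNReal.rpow_mul, ← ENNReal.rpow_mul, mul_comm]

theorem localExponent_eq (hℓ : 0 < ℓ) {m : Measure ℝ} {n : ℕ} {ε : Fin n → Fin ℓ} {x : ℝ}
    (hx : x ∈ adicInterval ℓ n ε) :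
    Real.log (m (adicIntervalAt ℓ n x)).toReal / Real.log (volume (adicIntervalAt ℓ n x)).toReal
      = Real.log (m (adicInterval ℓ n ε)).toReal / Real.log (1 / (ℓ : ℝ) ^ n) := by
  rw [adicIntervalAt_eq hℓ hx, volume_adicInterval, ENNReal.toReal_ofReal (by positivity)]

/-- The upper bound in the multifractal formalism: on the level set of `β` the masses `m (I_ε)` are
about `ℓ^{-nβ}`, so that a partition function `∑ m (I_ε) ^ q` of order `ℓ^{nσ}` bounds the number of
intervals of generation `n` that meet the level set by `ℓ^{n (q β + σ)}`. -/
theorem dimH_levelSet_le (hℓ : 2 ≤ ℓ) {m : Measure ℝ} (h0 : ∀ n ε, m (adicInterval ℓ n ε) ≠ 0)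
    (ht : ∀ n ε, m (adicInterval ℓ n ε) ≠ ∞) {q σ β : ℝ}
    (hsum : ∀ δ > 0, ∃ s < σ + δ,
      ∑' n, ((ℓ : ℝ≥0∞) ^ (-s)) ^ n * ∑ ε, m (adicInterval ℓ n ε) ^ q ≠ ∞) :
    dimH (levelSet ℓ m β) ≤ ENNReal.ofReal (q * β + σ) := by
  classical
  have hℓ0 : 0 < ℓ := by omega
  refine ENNReal.le_of_forall_pos_le_add fun e he _ => ?_
  obtain ⟨d, hd⟩ : ∃ d : ℝ≥0, d = Real.toNNReal (q * β + σ) + e := ⟨_, rfl⟩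
  have hd0 : (0 : ℝ) < d := by
    have : 0 < d := by rw [hd]; positivity
    exact_mod_cast this
  have hds : q * β + σ + e ≤ d := by
    rw [hd, NNReal.coe_add]
    gcongr
    exact Real.le_coe_toNNReal _
  have hgoal : ENNReal.ofReal (q * β + σ) + e = d := by rw [hd]; push_cast; rfl
  rw [hgoal]
  obtain ⟨s, hs, hsum⟩ := hsum e (by exact_mod_cast he)
  -- With `a = d - s` the exponents satisfy `-d = -s - a`, and on the level set
  -- `ℓ^{-na} ≤ m(I_ε) ^ q` holds eventually.
  set a := d - s with ha
  have haq : q * β < a := by rw [ha]; linarith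
  -- The cover of generation `n` consists of the intervals that satisfy this bound. The others are
  -- replaced by the empty set, which does not contribute because `d > 0`.
  let t (n : ℕ) (ε : Fin n → Fin ℓ) : Set ℝ :=
    if ((ℓ : ℝ≥0∞) ^ (-a)) ^ n ≤ m (adicInterval ℓ n ε) ^ q then adicInterval ℓ n ε else ∅
  let L (N : ℕ) : Set ℝ := {x | ∀ n ≥ N, x ∈ ⋃ ε, t n ε}
  have hsub : levelSet ℓ m β ⊆ ⋃ N, L N := by
    rintro x ⟨hx, -, hlim⟩
    obtain ⟨N, hN⟩ := eventually_atTop.1 ((hlim.const_mul q).eventually (gt_mem_nhds haq))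
    refine Set.mem_iUnion.2 ⟨N + 1, fun n hn => ?_⟩
    obtain ⟨ε, hε⟩ := exists_mem_adicInterval hℓ0 n hx
    refine Set.mem_iUnion.2 ⟨ε, ?_⟩
    have h1 := hN n (by omega)
    rw [localExponent_eq hℓ0 hε] at h1
    simp only [t]
    rwa [if_pos ((rpow_pow_le_rpow_iff hℓ (h0 n ε) (ht n ε) (by omega) a q).2 h1.le)]
  refine (dimH_mono hsub).trans ?_
  rw [dimH_iUnion]
  refine iSup_le fun N => dimH_le_of_hausdorffMeasure_ne_top ?_
  have hinv : (ℓ : ℝ≥0∞)⁻¹ < 1 := by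
    rw [ENNReal.inv_lt_one]; exact_mod_cast hℓ
  have hdiam (n : ℕ) (ε : Fin n → Fin ℓ) :
      Metric.ediam (t n ε) ≤ (ℓ : ℝ≥0∞)⁻¹ ^ n := by
    simp only [t]
    split_ifs
    · exact (ediam_adicInterval_le n ε).trans_eq (ofReal_one_div_pow hℓ0 n)
    · simp
  have hterm (n : ℕ) (ε : Fin n → Fin ℓ) : Metric.ediam (t n ε) ^ (d : ℝ)
      ≤ ((ℓ : ℝ≥0∞) ^ (-s)) ^ n * m (adicInterval ℓ n ε) ^ q := by
    by_cases h : ((ℓ : ℝ≥0∞) ^ (-a)) ^ n ≤ m (adicInterval ℓ n ε) ^ q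
    · calc Metric.ediam (t n ε) ^ (d : ℝ) ≤ ((ℓ : ℝ≥0∞)⁻¹ ^ n) ^ (d : ℝ) :=
            ENNReal.rpow_le_rpow (hdiam n ε) hd0.le
        _ = ((ℓ : ℝ≥0∞) ^ (-s)) ^ n * ((ℓ : ℝ≥0∞) ^ (-a)) ^ n := by
            rw [inv_pow_rpow, ← mul_pow, ← natCast_rpow_add hℓ0]
            congr 2; rw [ha]; ring
        _ ≤ _ := by gcongr
    · simp only [t, if_neg h, Metric.ediam_empty, ENNReal.zero_rpow_of_pos hd0, zero_le]
  have hlim := ENNReal.tendsto_atTop_zero_of_tsum_ne_top hsum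
  have hle := Measure.hausdorffMeasure_le_liminf_sum (d : ℝ) (L N) (l := atTop)
    (fun n => (ℓ : ℝ≥0∞)⁻¹ ^ n) (ENNReal.tendsto_pow_atTop_nhds_zero_of_lt_one hinv) t
    (Eventually.of_forall hdiam)
    ((eventually_ge_atTop N).mono fun n hn x hx => hx n hn)
  have hzero : liminf (fun n => ∑ ε, Metric.ediam (t n ε) ^ (d : ℝ)) atTop ≤ 0 := by
    rw [← hlim.liminf_eq]
    refine liminf_le_liminf (Eventually.of_forall fun n => ?_)
    simp only [Finset.mul_sum]
    exact Finset.sum_le_sum fun ε _ => hterm n ε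
  exact ne_top_of_le_ne_top ENNReal.zero_ne_top (hle.trans hzero)

/-- A form of the Borel–Cantelli lemma for quantities attached to the `ℓ`-adic intervals. -/
theorem ae_eventually_le_one {μ : Measure ℝ} (hμ : μ (Set.Ico 0 1)ᶜ = 0)
    {F : ∀ n, (Fin n → Fin ℓ) → ℝ≥0∞}
    (hF : ∑' n, ∑ ε, F n ε * μ (adicInterval ℓ n ε) ≠ ∞) :
    ∀ᵐ x ∂μ, x ∈ Set.Ico 0 1 ∧ ∀ᶠ n in atTop, ∀ ε, x ∈ adicInterval ℓ n ε → F n ε ≤ 1 := by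
  classical
  let s (n : ℕ) : Set ℝ := ⋃ ε ∈ Finset.univ.filter (fun ε => 1 < F n ε), adicInterval ℓ n ε
  have hs (n : ℕ) : μ (s n) ≤ ∑ ε, F n ε * μ (adicInterval ℓ n ε) := by
    refine (measure_biUnion_finset_le _ _).trans ?_
    rw [Finset.sum_filter]
    refine Finset.sum_le_sum fun ε _ => ?_
    split_ifs with h
    · exact le_mul_of_one_le_left (by simp) h.le
    · simp
  have hbc := ae_eventually_notMem (μ := μ) (s := s)
    (ne_top_of_le_ne_top hF (ENNReal.tsum_le_tsum hs))
  have hI : ∀ᵐ x ∂μ, x ∈ Set.Ico (0 : ℝ) 1 := by rw [ae_iff]; exact hμ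
  filter_upwards [hbc, hI] with x hx hxI
  refine ⟨hxI, hx.mono fun n hn ε hε => ?_⟩
  by_contra! h
  exact hn (Set.mem_iUnion₂.2 ⟨ε, by simpa using h, hε⟩)

theorem rpow_pow_mul_le_one_iff (hℓ : 0 < ℓ) (a : ℝ) (n : ℕ) (x : ℝ≥0∞) :
    ((ℓ : ℝ≥0∞) ^ a) ^ n * x ≤ 1 ↔ x ≤ ((ℓ : ℝ≥0∞) ^ (-a)) ^ n := by
  have h0 : ((ℓ : ℝ≥0∞) ^ a) ^ n ≠ 0 := pow_ne_zero _ (by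
    simp only [ne_eq, ENNReal.rpow_eq_zero_iff, ENNReal.natCast_ne_top, false_and, or_false,
      Nat.cast_eq_zero]
    omega)
  have ht : ((ℓ : ℝ≥0∞) ^ a) ^ n ≠ ∞ := ENNReal.pow_ne_top (natCast_rpow_ne_top hℓ a)
  rw [mul_comm, ← ENNReal.le_div_iff_mul_le (Or.inl h0) (Or.inl ht), one_div, ENNReal.rpow_neg,
    ENNReal.inv_pow]

theorem ae_eventually_le_localExponent (hℓ : 2 ≤ ℓ) {m μ : Measure ℝ}
    (h0 : ∀ n ε, m (adicInterval ℓ n ε) ≠ 0) (ht : ∀ n ε, m (adicInterval ℓ n ε) ≠ ∞)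
    (hμ : μ (Set.Ico 0 1)ᶜ = 0) {a q : ℝ}
    (hsum : ∑' n, ((ℓ : ℝ≥0∞) ^ a) ^ n *
      ∑ ε, m (adicInterval ℓ n ε) ^ q * μ (adicInterval ℓ n ε) ^ (1 : ℝ) ≠ ∞) :
    ∀ᵐ x ∂μ, ∀ᶠ n in atTop, a ≤ q * (Real.log (m (adicIntervalAt ℓ n x)).toReal /
      Real.log (volume (adicIntervalAt ℓ n x)).toReal) := by
  have hℓ0 : 0 < ℓ := by omega
  have := ae_eventually_le_one hμ
    (F := fun n ε => ((ℓ : ℝ≥0∞) ^ a) ^ n * m (adicInterval ℓ n ε) ^ q)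
    (by simpa only [Finset.mul_sum, ENNReal.rpow_one, mul_assoc] using hsum)
  filter_upwards [this] with x hx
  filter_upwards [hx.2, eventually_ge_atTop 1] with n hn hn1
  obtain ⟨ε, hε⟩ := exists_mem_adicInterval hℓ0 n hx.1
  have h1 := (rpow_pow_mul_le_one_iff hℓ0 a n _).1 (hn ε hε)
  rw [localExponent_eq hℓ0 hε]
  have h2 : ((ℓ : ℝ≥0∞) ^ (- -a)) ^ n ≤ m (adicInterval ℓ n ε) ^ (-q) := by
    rw [ENNReal.rpow_neg, ENNReal.rpow_neg _ q, ← ENNReal.inv_pow]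
    exact ENNReal.inv_le_inv.2 h1
  have h3 := (rpow_pow_le_rpow_iff hℓ (h0 n ε) (ht n ε) (by omega) _ _).1 h2
  linarith

/-- The mass distribution principle for `ℓ`-adic intervals. -/
theorem le_dimH_of_ae_eventually_le (hℓ : 2 ≤ ℓ) {μ : Measure ℝ} (hμ0 : μ ≠ 0) {d : ℝ≥0}
    (hd : 0 < d) {E : Set ℝ} (hE : ∀ᵐ x ∂μ, x ∈ E)
    (h : ∀ᵐ x ∂μ, x ∈ Set.Ico 0 1 ∧ ∀ᶠ n in atTop, ∀ ε, x ∈ adicInterval ℓ n ε →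
      μ (adicInterval ℓ n ε) ≤ ((ℓ : ℝ≥0∞) ^ (-(d : ℝ))) ^ n) :
    (d : ℝ≥0∞) ≤ dimH E := by
  classical
  have hℓ0 : 0 < ℓ := by omega
  have hd' : (0 : ℝ) < d := hd
  -- `A N` is the set of the points all of whose intervals from generation `N` on obey the bound.
  let G (n : ℕ) : Set ℝ := ⋃ ε ∈ Finset.univ.filter
    (fun ε => μ (adicInterval ℓ n ε) ≤ ((ℓ : ℝ≥0∞) ^ (-(d : ℝ))) ^ n), adicInterval ℓ n ε
  let A (N : ℕ) : Set ℝ := ⋂ n ≥ N, G n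
  have hA (N : ℕ) : MeasurableSet (A N) :=
    MeasurableSet.iInter fun n => MeasurableSet.iInter fun _ =>
      Finset.measurableSet_biUnion _ fun ε _ => measurableSet_adicInterval n ε
  obtain ⟨N, hN⟩ : ∃ N, μ (E ∩ A N) ≠ 0 := by
    by_contra! hcon
    have h1 : μ (⋃ N, E ∩ A N) = 0 := measure_iUnion_null hcon
    have h2 : ∀ᵐ x ∂μ, x ∉ ⋃ N, E ∩ A N := measure_eq_zero_iff_ae_notMem.1 h1
    have h3 : ∀ᵐ _x ∂μ, False := by
      filter_upwards [h2, hE, h] with x hx hxE hx'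
      obtain ⟨N, hN⟩ := eventually_atTop.1 hx'.2
      refine hx (Set.mem_iUnion.2 ⟨N, hxE, Set.mem_iInter₂.2 fun n hn => ?_⟩)
      obtain ⟨ε, hε⟩ := exists_mem_adicInterval hℓ0 n hx'.1
      exact Set.mem_iUnion₂.2 ⟨ε, by simpa using hN n hn ε hε, hε⟩
    exact hμ0 (ae_eq_bot.1 (eventually_false_iff_eq_bot.1 h3))
  have hAsub : A N ⊆ Set.Ico 0 1 := fun x hx => by
    obtain ⟨ε, -, hε⟩ := Set.mem_iUnion₂.1 (Set.mem_iInter₂.1 hx N le_rfl)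
    exact adicInterval_subset hℓ0 ε hε
  have hcov {n : ℕ} (hn : N ≤ n) {s : Set ℝ}
      (hs : Metric.ediam s ≤ ENNReal.ofReal (1 / (ℓ : ℝ) ^ n)) :
      μ (s ∩ A N) ≤ 3 * ((ℓ : ℝ≥0∞) ^ (-(d : ℝ))) ^ n := by
    obtain ⟨T, hT, hsT⟩ := exists_adicInterval_cover hℓ0 n (U := s) fun x hx y hy => by
      have h1 := (Metric.edist_le_ediam_of_mem hx hy).trans hs
      rw [edist_dist, ENNReal.ofReal_le_ofReal_iff (by positivity), Real.dist_eq] at h1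
      exact h1
    have hgood : s ∩ A N ⊆ ⋃ ε ∈ T.filter
        (fun ε => μ (adicInterval ℓ n ε) ≤ ((ℓ : ℝ≥0∞) ^ (-(d : ℝ))) ^ n),
        adicInterval ℓ n ε := by
      rintro x ⟨hxs, hxA⟩
      obtain ⟨ε, hεT, hε⟩ := Set.mem_iUnion₂.1 (hsT ⟨hxs, hAsub hxA⟩)
      obtain ⟨δ, hδG, hδ⟩ := Set.mem_iUnion₂.1 (Set.mem_iInter₂.1 hxA n hn)
      obtain rfl := eq_of_mem_adicInterval hℓ0 hε hδ
      exact Set.mem_iUnion₂.2 ⟨ε, Finset.mem_filter.2 ⟨hεT, (Finset.mem_filter.1 hδG).2⟩, hε⟩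
    refine (measure_mono hgood).trans ((measure_biUnion_finset_le _ _).trans ?_)
    refine (Finset.sum_le_card_nsmul _ _ _ fun ε hε => (Finset.mem_filter.1 hε).2).trans ?_
    rw [nsmul_eq_mul]
    gcongr
    exact_mod_cast (Finset.card_filter_le _ _).trans hT
  have hinv : (ℓ : ℝ≥0∞)⁻¹ < 1 := by
    rw [ENNReal.inv_lt_one]; exact_mod_cast hℓ
  obtain ⟨C, hC⟩ : ∃ C : ℝ≥0∞, C = 3 * (ℓ : ℝ≥0∞) ^ (d : ℝ) := ⟨_, rfl⟩
  have hCt : C ≠ ∞ := by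
    rw [hC]; exact ENNReal.mul_ne_top (by simp) (natCast_rpow_ne_top hℓ0 _)
  have hC0 : C ≠ 0 := by
    rw [hC]
    refine mul_ne_zero (by simp) ?_
    simp only [ne_eq, ENNReal.rpow_eq_zero_iff, ENNReal.natCast_ne_top, false_and, or_false,
      Nat.cast_eq_zero]
    omega
  have hbound (s : Set ℝ) (hs : Metric.ediam s ≤ ENNReal.ofReal (1 / (ℓ : ℝ) ^ N)) :
      μ (s ∩ A N) ≤ C * Metric.ediam s ^ (d : ℝ) := by
    rcases eq_or_ne (Metric.ediam s) 0 with hz | hz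
    · rw [hz, ENNReal.zero_rpow_of_pos hd', mul_zero]
      have hlt : (ℓ : ℝ≥0∞) ^ (-(d : ℝ)) < 1 :=
        ENNReal.rpow_lt_one_of_one_lt_of_neg (by exact_mod_cast hℓ) (by simpa using hd)
      have hlim := ENNReal.Tendsto.const_mul (a := 3)
        (ENNReal.tendsto_pow_atTop_nhds_zero_of_lt_one hlt) (Or.inr (by simp))
      rw [mul_zero] at hlim
      refine ge_of_tendsto hlim ((eventually_ge_atTop N).mono fun n hn => hcov hn ?_)
      rw [hz]; exact zero_le
    · have hst : Metric.ediam s ≠ ∞ := ne_top_of_le_ne_top ENNReal.ofReal_ne_top hs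
      have hr0 : 0 < (Metric.ediam s).toReal := ENNReal.toReal_pos hz hst
      have hrN : (Metric.ediam s).toReal ≤ (1 / (ℓ : ℝ)) ^ N := by
        rw [one_div_pow]
        exact ENNReal.toReal_le_of_le_ofReal (by positivity) hs
      have hl1 : 1 / (ℓ : ℝ) < 1 := by
        rw [div_lt_one (by positivity)]; exact_mod_cast hℓ
      obtain ⟨n, hn1, hn2⟩ := exists_nat_pow_near_of_lt_one hr0
        (hrN.trans (pow_le_one₀ (by positivity) hl1.le)) (by positivity) hl1
      have hNn : N ≤ n := by
        by_contra! hlt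
        exact absurd (hn1.trans_le hrN)
          (not_lt.2 (pow_le_pow_of_le_one (by positivity) hl1.le hlt))
      have hcov' := hcov hNn (s := s) (by
        rw [← one_div_pow]
        exact (ENNReal.le_ofReal_iff_toReal_le hst (by positivity)).2 hn2)
      have h4 : (ℓ : ℝ≥0∞)⁻¹ ^ (n + 1) ≤ Metric.ediam s := by
        rw [← ofReal_one_div_pow hℓ0, ← one_div_pow]
        exact ENNReal.ofReal_le_of_le_toReal hn1.le
      have h5 : ((ℓ : ℝ≥0∞) ^ (-(d : ℝ))) ^ (n + 1) ≤ Metric.ediam s ^ (d : ℝ) := by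
        rw [← inv_pow_rpow]
        exact ENNReal.rpow_le_rpow h4 hd'.le
      calc μ (s ∩ A N) ≤ 3 * ((ℓ : ℝ≥0∞) ^ (-(d : ℝ))) ^ n := hcov'
        _ = C * ((ℓ : ℝ≥0∞) ^ (-(d : ℝ))) ^ (n + 1) := by
            rw [hC, pow_succ', mul_assoc, ← mul_assoc ((ℓ : ℝ≥0∞) ^ (d : ℝ)),
              ← natCast_rpow_add hℓ0, add_neg_cancel, ENNReal.rpow_zero, one_mul]
        _ ≤ _ := by gcongr
  have hle : C⁻¹ • μ.restrict (A N) ≤ Measure.hausdorffMeasure (d : ℝ) := by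
    refine Measure.le_hausdorffMeasure _ _ (ENNReal.ofReal (1 / (ℓ : ℝ) ^ N))
      (ENNReal.ofReal_pos.2 (by positivity)) fun s hs => ?_
    rw [Measure.smul_apply, Measure.restrict_apply' (hA N), smul_eq_mul,
      ENNReal.inv_mul_le_iff hC0 hCt]
    exact hbound s hs
  refine le_dimH_of_hausdorffMeasure_ne_zero fun h0 => ?_
  have h1 := le_antisymm ((hle E).trans_eq h0) zero_le
  rw [Measure.smul_apply, Measure.restrict_apply' (hA N), smul_eq_mul, mul_eq_zero] at h1
  exact h1.elim (ENNReal.inv_ne_zero.2 hCt) hN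

/-- The lower bound in the multifractal formalism: an auxiliary measure `μ` for which the masses
`m (I_ε)` are typically about `ℓ^{-nβ}` and the masses `μ (I_ε)` are at most about `ℓ^{-ng}` forces
the level set of `β` to have dimension at least `g`. -/
theorem le_dimH_levelSet (hℓ : 2 ≤ ℓ) {m μ : Measure ℝ}
    (h0 : ∀ n ε, m (adicInterval ℓ n ε) ≠ 0) (ht : ∀ n ε, m (adicInterval ℓ n ε) ≠ ∞)
    (hμ : μ (Set.Ico 0 1)ᶜ = 0) (hμ0 : μ ≠ 0) {g β : ℝ}
    (hsum : ∀ k : ℕ, ∃ η : ℝ, 0 < η ∧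
      ∑' n, ((ℓ : ℝ≥0∞) ^ (η * (β - 1 / (k + 1)))) ^ n *
        ∑ ε, m (adicInterval ℓ n ε) ^ η * μ (adicInterval ℓ n ε) ^ (1 : ℝ) ≠ ∞ ∧
      ∑' n, ((ℓ : ℝ≥0∞) ^ (-η * (β + 1 / (k + 1)))) ^ n *
        ∑ ε, m (adicInterval ℓ n ε) ^ (-η) * μ (adicInterval ℓ n ε) ^ (1 : ℝ) ≠ ∞ ∧
      ∑' n, ((ℓ : ℝ≥0∞) ^ (η * (g - 1 / (k + 1)))) ^ n *
        ∑ ε, m (adicInterval ℓ n ε) ^ (0 : ℝ) * μ (adicInterval ℓ n ε) ^ (1 + η) ≠ ∞) :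
    ENNReal.ofReal g ≤ dimH (levelSet ℓ m β) := by
  have hℓ0 : 0 < ℓ := by omega
  choose η hη hs1 hs2 hs3 using hsum
  have hk (k : ℕ) : (0 : ℝ) < 1 / (k + 1) := by positivity
  have hI : ∀ᵐ x ∂μ, x ∈ Set.Ico (0 : ℝ) 1 := by rw [ae_iff]; exact hμ
  have hE : ∀ᵐ x ∂μ, x ∈ levelSet ℓ m β := by
    filter_upwards [hI, ae_all_iff.2 fun k => ae_eventually_le_localExponent hℓ h0 ht hμ (hs1 k),
      ae_all_iff.2 fun k => ae_eventually_le_localExponent hℓ h0 ht hμ (hs2 k)] with x hx h1 h2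
    refine ⟨hx, fun n => ?_, Metric.tendsto_nhds.2 fun e he => ?_⟩
    · obtain ⟨ε, hε⟩ := exists_mem_adicInterval hℓ0 n hx
      rw [adicIntervalAt_eq hℓ0 hε]
      exact h0 n ε
    · obtain ⟨k, hke⟩ := exists_nat_one_div_lt he
      filter_upwards [h1 k, h2 k] with n hn1 hn2
      have e1 := le_of_mul_le_mul_left hn1 (hη k)
      rw [neg_mul, neg_mul, neg_le_neg_iff] at hn2
      have e2 := le_of_mul_le_mul_left hn2 (hη k)
      rw [Real.dist_eq, abs_lt]
      constructor <;> linarith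
  refine le_of_forall_lt fun b hb => ?_
  obtain ⟨d, hbd, hdg⟩ := ENNReal.lt_iff_exists_nnreal_btwn.1 hb
  refine hbd.trans_le (le_dimH_of_ae_eventually_le hℓ hμ0 (by
    have := (zero_le (a := b)).trans_lt hbd
    exact_mod_cast this) hE ?_)
  have hdg' : (d : ℝ) < g := by
    rw [← ENNReal.ofReal_coe_nnreal] at hdg
    exact (ENNReal.ofReal_lt_ofReal_iff_of_nonneg d.coe_nonneg).1 hdg
  obtain ⟨k, hke⟩ := exists_nat_one_div_lt (sub_pos.2 hdg')
  have h3 := ae_eventually_le_one hμ (F := fun n ε =>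
    ((ℓ : ℝ≥0∞) ^ (η k * (g - 1 / (k + 1)))) ^ n * μ (adicInterval ℓ n ε) ^ η k) (by
      refine ne_of_eq_of_ne (tsum_congr fun n => ?_) (hs3 k)
      rw [Finset.mul_sum]
      refine Finset.sum_congr rfl fun ε _ => ?_
      rw [ENNReal.rpow_zero, one_mul, add_comm 1 (η k),
        ENNReal.rpow_add_of_nonneg _ _ (hη k).le zero_le_one, ENNReal.rpow_one, mul_assoc])
  filter_upwards [h3] with x hx
  refine ⟨hx.1, hx.2.mono fun n hn ε hε => ?_⟩
  have h4 := (rpow_pow_mul_le_one_iff hℓ0 _ n _).1 (hn ε hε)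
  rw [← inv_pow_rpow, mul_comm, ENNReal.rpow_mul, ENNReal.rpow_le_rpow_iff (hη k),
    inv_pow_rpow] at h4
  refine h4.trans ?_
  gcongr 1
  exact ENNReal.rpow_le_rpow_of_exponent_le (by exact_mod_cast hℓ0) (by linarith)

end Dimension

/-! ### Convex structure functions and their Legendre transforms -/

section Calculus

theorem eventually_le_add_mul_of_hasDerivAt {f : ℝ → ℝ} {f' a c : ℝ} (hf : HasDerivAt f f' a)
    (hc : f' < c) : ∀ᶠ h in 𝓝[>] (0 : ℝ), f (a + h) < f a + c * h := by
  have h1 := hf.tendsto_slope_zero_right.eventually (gt_mem_nhds hc)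
  filter_upwards [h1, self_mem_nhdsWithin] with h hh (hpos : 0 < h)
  rw [smul_eq_mul, inv_mul_lt_iff₀ hpos] at hh
  linarith

variable {τ : ℝ → ℝ}

theorem add_deriv_mul_sub_le (hconv : ConvexOn ℝ Set.univ τ) (hd : Differentiable ℝ τ) (q t : ℝ) :
    τ q + deriv τ q * (t - q) ≤ τ t := by
  rcases lt_trichotomy q t with h | rfl | h
  · have := hconv.deriv_le_slope (Set.mem_univ q) (Set.mem_univ t) h (hd q)
    rw [slope_def_field, le_div_iff₀ (sub_pos.2 h)] at this
    linarith
  · simp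
  · have := hconv.slope_le_deriv (Set.mem_univ t) (Set.mem_univ q) h (hd q)
    rw [slope_def_field, div_le_iff₀ (sub_pos.2 h)] at this
    linarith

theorem monotone_deriv_of_convexOn (hconv : ConvexOn ℝ Set.univ τ) (hd : Differentiable ℝ τ) :
    Monotone (deriv τ) :=
  monotoneOn_univ.1 (hconv.monotoneOn_deriv fun x _ => hd x)

/-- For a convex function the infimum over `t` of `-t τ'(q) + τ(t)` is attained at `q`. -/
theorem legendre_neg_deriv (hconv : ConvexOn ℝ Set.univ τ) (hd : Differentiable ℝ τ) (q : ℝ) :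
    legendre τ (-deriv τ q) = ((τ q - q * deriv τ q : ℝ) : EReal) := by
  refine le_antisymm ((iInf_le _ q).trans_eq ?_) (le_iInf fun t => ?_)
  · congr 1; ring
  · rw [EReal.coe_le_coe_iff]
    linarith [add_deriv_mul_sub_le hconv hd q t]

theorem mem_qSet_iff (hconv : ConvexOn ℝ Set.univ τ) (hd : Differentiable ℝ τ) {q : ℝ} :
    q ∈ qSet τ ↔ 0 < τ q - q * deriv τ q := by
  rw [qSet, Set.mem_ofPred_eq, legendre_neg_deriv hconv hd]
  exact EReal.coe_pos

/-- The set `{q ; τ*(-τ'(q)) > 0}` is star-shaped about `0`. -/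
theorem mem_qSet_of_le (hconv : ConvexOn ℝ Set.univ τ) (hd : Differentiable ℝ τ) {a b : ℝ}
    (hb : b ∈ qSet τ) (h : 0 ≤ a ∧ a ≤ b ∨ b ≤ a ∧ a ≤ 0) : a ∈ qSet τ := by
  rw [mem_qSet_iff hconv hd] at hb ⊢
  have h1 := add_deriv_mul_sub_le hconv hd b a
  have hm := monotone_deriv_of_convexOn hconv hd
  have h2 : 0 ≤ a * (deriv τ b - deriv τ a) := by
    rcases h with ⟨h0, h⟩ | ⟨h, h0⟩
    · exact mul_nonneg h0 (sub_nonneg.2 (hm h))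
    · exact mul_nonneg_of_nonpos_of_nonpos h0 (sub_nonpos.2 (hm h))
  nlinarith

theorem exists_mem_qSet_deriv_lt (hconv : ConvexOn ℝ Set.univ τ) (hd : Differentiable ℝ τ)
    (hc : Continuous (deriv τ)) (h0 : (0 : ℝ) ∈ qSet τ) {b : ℝ}
    (hb : extDeriv τ (qMin τ) < (b : EReal)) : ∃ q ∈ qSet τ, deriv τ q < b := by
  have hm := monotone_deriv_of_convexOn hconv hd
  have hex {a : EReal} (ha : qMin τ < a) : ∃ q ∈ qSet τ, (q : EReal) < a := by
    simpa [qMin, iInf_lt_iff] using ha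
  induction hq : qMin τ using EReal.rec with
  | bot =>
    rw [hq] at hb
    obtain ⟨q', hq'⟩ := iInf_lt_iff.1 hb
    obtain ⟨q, hqS, hqlt⟩ := hex (a := q') (by rw [hq]; exact EReal.bot_lt_coe q')
    exact ⟨q, hqS, (hm (EReal.coe_lt_coe_iff.1 hqlt).le).trans_lt (EReal.coe_lt_coe_iff.1 hq')⟩
  | top =>
    exact absurd (iInf₂_le (f := fun q (_ : q ∈ qSet τ) => (q : EReal)) 0 h0)
      (not_le.2 (by rw [← qMin, hq]; exact EReal.coe_lt_top 0))
  | coe a =>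
    rw [hq] at hb
    have hb' : deriv τ a < b := EReal.coe_lt_coe_iff.1 hb
    obtain ⟨u, hu, hau⟩ := exists_Ico_subset_of_mem_nhds
      (hc.continuousAt.eventually (gt_mem_nhds hb')) (exists_gt a)
    obtain ⟨q, hqS, hqlt⟩ := hex (a := u) (by rw [hq]; exact_mod_cast hu)
    refine ⟨q, hqS, hau ⟨?_, EReal.coe_lt_coe_iff.1 hqlt⟩⟩
    have := iInf₂_le (f := fun q (_ : q ∈ qSet τ) => (q : EReal)) q hqS
    rw [← qMin, hq] at this
    exact_mod_cast this

theorem exists_mem_qSet_lt_deriv (hconv : ConvexOn ℝ Set.univ τ) (hd : Differentiable ℝ τ)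
    (hc : Continuous (deriv τ)) (h0 : (0 : ℝ) ∈ qSet τ) {b : ℝ}
    (hb : (b : EReal) < extDeriv τ (qMax τ)) : ∃ q ∈ qSet τ, b < deriv τ q := by
  have hm := monotone_deriv_of_convexOn hconv hd
  have hex {a : EReal} (ha : a < qMax τ) : ∃ q ∈ qSet τ, a < (q : EReal) := by
    simpa [qMax, lt_iSup_iff] using ha
  induction hq : qMax τ using EReal.rec with
  | top =>
    rw [hq] at hb
    obtain ⟨q', hq'⟩ := lt_iSup_iff.1 hb
    obtain ⟨q, hqS, hqlt⟩ := hex (a := q') (by rw [hq]; exact EReal.coe_lt_top q')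
    exact ⟨q, hqS, (EReal.coe_lt_coe_iff.1 hq').trans_le (hm (EReal.coe_lt_coe_iff.1 hqlt).le)⟩
  | bot =>
    exact absurd (le_iSup₂ (f := fun q (_ : q ∈ qSet τ) => (q : EReal)) 0 h0)
      (not_le.2 (by rw [← qMax, hq]; exact EReal.bot_lt_coe 0))
  | coe a =>
    rw [hq] at hb
    have hb' : b < deriv τ a := EReal.coe_lt_coe_iff.1 hb
    obtain ⟨u, hu, hau⟩ := exists_Ioc_subset_of_mem_nhds
      (hc.continuousAt.eventually (lt_mem_nhds hb')) (exists_lt a)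
    obtain ⟨q, hqS, hqlt⟩ := hex (a := u) (by rw [hq]; exact_mod_cast hu)
    refine ⟨q, hqS, hau ⟨EReal.coe_lt_coe_iff.1 hqlt, ?_⟩⟩
    have := le_iSup₂ (f := fun q (_ : q ∈ qSet τ) => (q : EReal)) q hqS
    rw [← qMax, hq] at this
    exact_mod_cast this

/-- By the intermediate value theorem, every `β` strictly between `-τ'(q_max)` and `-τ'(q_min)` is
`-τ'(q)` for a point `q` of the interval `(q_min, q_max)`. -/
theorem exists_mem_qSet_eq_neg_deriv (hconv : ConvexOn ℝ Set.univ τ) (hd : Differentiable ℝ τ)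
    (hc : Continuous (deriv τ)) (h0 : (0 : ℝ) ∈ qSet τ) {β : ℝ}
    (hβ_left : -extDeriv τ (qMax τ) < (β : EReal)) (hβ_right : (β : EReal) < -extDeriv τ (qMin τ)) :
    ∃ q ∈ qSet τ, β = -deriv τ q := by
  have hm := monotone_deriv_of_convexOn hconv hd
  obtain ⟨q₁, hq₁, h1⟩ := exists_mem_qSet_deriv_lt hconv hd hc h0 (b := -β)
    (by rw [EReal.coe_neg]; exact EReal.lt_neg_comm.1 hβ_right)
  obtain ⟨q₂, hq₂, h2⟩ := exists_mem_qSet_lt_deriv hconv hd hc h0 (b := -β)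
    (by rw [EReal.coe_neg]; exact EReal.neg_lt_comm.1 hβ_left)
  have h12 : q₁ ≤ q₂ := le_of_not_gt fun h => absurd (hm h.le) (by linarith)
  obtain ⟨q, hq, hqβ⟩ := intermediate_value_Icc h12 hc.continuousOn ⟨h1.le, h2.le⟩
  refine ⟨q, ?_, by linarith⟩
  rcases le_total 0 q with h | h
  · exact mem_qSet_of_le hconv hd hq₂ (Or.inl ⟨h, hq.2⟩)
  · exact mem_qSet_of_le hconv hd hq₁ (Or.inr ⟨hq.1, h⟩)

/-- The tangent at `s` lies below `τ(1) = 0` at the point `1`, and `τ(s) > s τ'(s)`; together these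
force `τ'(s) < 0`. -/
theorem neg_of_mem_qSet (hconv : ConvexOn ℝ Set.univ τ) (hd : Differentiable ℝ τ)
    (h1 : τ 1 = 0) {q s : ℝ} (hq : q ∈ qSet τ) (hs : 1 < s) (hsq : s ≤ q) : τ s < 0 := by
  have h2 := (mem_qSet_iff hconv hd).1
    (mem_qSet_of_le hconv hd hq (Or.inl ⟨by linarith, hsq⟩))
  have h3 := add_deriv_mul_sub_le hconv hd s 1
  have h4 : deriv τ s < 0 := by nlinarith
  nlinarith

end Calculus

/-! ### Tilted weights -/

section Tilt

variable {ℓ : ℕ} {ν : Measure ℝ}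

/-- The structure function of a law `ν` on the positive reals. -/
noncomputable def tauLaw (ℓ : ℕ) (ν : Measure ℝ) (q : ℝ) : ℝ :=
  cgf Real.log ν q / Real.log ℓ - (q - 1)

/-- The tilted weight `x ^ q / E[x ^ q]`. It is written with `exp (q * log x)`, which is positive
for every real `x` and agrees with `x ^ q` for `x > 0`. -/
noncomputable def tilt (ν : Measure ℝ) (q x : ℝ) : ℝ≥0 :=
  Real.toNNReal (Real.exp (q * Real.log x - cgf Real.log ν q))

@[fun_prop]
theorem measurable_tilt (q : ℝ) : Measurable (tilt ν q) := by
  unfold tilt; fun_prop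

theorem tilt_pos (q x : ℝ) : 0 < tilt ν q x := by
  simp [tilt, Real.exp_pos]

theorem coe_tilt (q x : ℝ) :
    (tilt ν q x : ℝ≥0∞) = ENNReal.ofReal (Real.exp (q * Real.log x - cgf Real.log ν q)) := rfl

theorem mem_interior_integrableExpSet
    (hint : ∀ t : ℝ, Integrable (fun x => Real.exp (t * Real.log x)) ν) (t : ℝ) :
    t ∈ interior (integrableExpSet Real.log ν) := by
  have : integrableExpSet Real.log ν = Set.univ := Set.eq_univ_of_forall hint
  simp [this]

theorem ofReal_exp_rpow (y a : ℝ) :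
    ENNReal.ofReal (Real.exp y) ^ a = ENNReal.ofReal (Real.exp (a * y)) := by
  rw [ENNReal.ofReal_rpow_of_pos (Real.exp_pos y), ← Real.exp_mul, mul_comm]

theorem natCast_rpow_eq_ofReal_exp (hℓ : 0 < ℓ) (a : ℝ) :
    (ℓ : ℝ≥0∞) ^ a = ENNReal.ofReal (Real.exp (a * Real.log ℓ)) := by
  rw [← ofReal_exp_rpow, Real.exp_log (by positivity), ENNReal.ofReal_natCast]

theorem inv_mul_tilt (hℓ : 0 < ℓ) (q x : ℝ) : (ℓ : ℝ≥0∞)⁻¹ * tilt ν q x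
    = ENNReal.ofReal (Real.exp (q * Real.log x - cgf Real.log ν q - Real.log ℓ)) := by
  rw [coe_tilt, ← ENNReal.rpow_neg_one, natCast_rpow_eq_ofReal_exp hℓ,
    ← ENNReal.ofReal_mul (Real.exp_nonneg _), ← Real.exp_add]
  congr 2; ring

theorem natCast_rpow_lt_one_iff (hℓ : 2 ≤ ℓ) {a : ℝ} : (ℓ : ℝ≥0∞) ^ a < 1 ↔ a < 0 := by
  have hL : 0 < Real.log ℓ := Real.log_pos (by exact_mod_cast hℓ)
  rw [natCast_rpow_eq_ofReal_exp (by omega), ENNReal.ofReal_lt_one, Real.exp_lt_one_iff]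
  exact ⟨fun h => neg_of_mul_neg_left h hL.le, fun h => mul_neg_of_neg_of_pos h hL⟩

theorem analyticAt_tauLaw
    (hint : ∀ t : ℝ, Integrable (fun x => Real.exp (t * Real.log x)) ν) (t : ℝ) :
    AnalyticAt ℝ (tauLaw ℓ ν) t := by
  have := analyticAt_cgf (mem_interior_integrableExpSet hint t)
  unfold tauLaw
  fun_prop

theorem differentiable_tauLaw
    (hint : ∀ t : ℝ, Integrable (fun x => Real.exp (t * Real.log x)) ν) :
    Differentiable ℝ (tauLaw ℓ ν) :=
  fun t => (analyticAt_tauLaw hint t).differentiableAt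

theorem continuous_deriv_tauLaw
    (hint : ∀ t : ℝ, Integrable (fun x => Real.exp (t * Real.log x)) ν) :
    Continuous (deriv (tauLaw ℓ ν)) :=
  continuous_iff_continuousAt.2 fun t => (analyticAt_tauLaw hint t).deriv.continuousAt

theorem convexOn_tauLaw
    (hint : ∀ t : ℝ, Integrable (fun x => Real.exp (t * Real.log x)) ν) :
    ConvexOn ℝ Set.univ (tauLaw ℓ ν) := by
  have hmem := mem_interior_integrableExpSet hint
  have han (t : ℝ) := analyticAt_cgf (hmem t)
  have hconv : ConvexOn ℝ Set.univ (cgf Real.log ν) := by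
    refine convexOn_univ_of_deriv2_nonneg (fun t => (han t).differentiableAt)
      (fun t => (han t).deriv.differentiableAt) fun t => ?_
    rw [← iteratedDeriv_eq_iterate, iteratedDeriv_two_cgf_eq_integral (hmem t)]
    exact div_nonneg (integral_nonneg fun x => by positivity) mgf_nonneg
  have h1 : ConvexOn ℝ Set.univ fun t : ℝ => (Real.log ℓ)⁻¹ * cgf Real.log ν t :=
    hconv.smul (inv_nonneg.2 (Real.log_natCast_nonneg ℓ))
  have h2 : ConvexOn ℝ Set.univ fun t : ℝ => -(t - 1) :=
    ⟨convex_univ, fun x _ y _ a b _ _ hab => le_of_eq (by simp only [smul_eq_mul]; linarith)⟩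
  have e : tauLaw ℓ ν = (fun t : ℝ => (Real.log ℓ)⁻¹ * cgf Real.log ν t) + fun t => -(t - 1) := by
    funext t
    simp [tauLaw, div_eq_inv_mul, sub_eq_add_neg]
  rw [e]
  exact h1.add h2

variable [IsProbabilityMeasure ν]

theorem lintegral_ofReal_exp (hint : ∀ t : ℝ, Integrable (fun x => Real.exp (t * Real.log x)) ν)
    (t a : ℝ) : ∫⁻ x, ENNReal.ofReal (Real.exp (t * Real.log x + a)) ∂ν
      = ENNReal.ofReal (Real.exp (cgf Real.log ν t + a)) := by
  simp only [Real.exp_add]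
  rw [← ofReal_integral_eq_lintegral_ofReal ((hint t).mul_const _)
    (Eventually.of_forall fun x => by positivity), integral_mul_const, exp_cgf (hint t), mgf]

theorem lintegral_tilt (hint : ∀ t : ℝ, Integrable (fun x => Real.exp (t * Real.log x)) ν)
    (q : ℝ) : ∫⁻ x, tilt ν q x ∂ν = 1 := by
  simp only [coe_tilt, sub_eq_add_neg]
  rw [lintegral_ofReal_exp hint]
  simp

theorem lintegral_tilt_rpow_ne_top
    (hint : ∀ t : ℝ, Integrable (fun x => Real.exp (t * Real.log x)) ν) (q s : ℝ) :
    ∫⁻ x, (tilt ν q x : ℝ≥0∞) ^ s ∂ν ≠ ∞ := by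
  simp only [coe_tilt, ofReal_exp_rpow, sub_eq_add_neg, mul_add, ← mul_assoc]
  rw [lintegral_ofReal_exp hint]
  exact ENNReal.ofReal_ne_top

/-- In terms of `τ`, the joint moments of two tilted weights are powers of `ℓ`. -/
theorem jointScaling_tilt (hℓ : 2 ≤ ℓ)
    (hint : ∀ t : ℝ, Integrable (fun x => Real.exp (t * Real.log x)) ν) (q₁ q₂ a b : ℝ) :
    jointScaling ℓ ν (tilt ν q₁) (tilt ν q₂) a b
      = (ℓ : ℝ≥0∞) ^ (tauLaw ℓ ν (a * q₁ + b * q₂) - a * tauLaw ℓ ν q₁ - b * tauLaw ℓ ν q₂) := by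
  have hℓ0 : 0 < ℓ := by omega
  have hL : Real.log ℓ ≠ 0 := (Real.log_pos (by exact_mod_cast hℓ)).ne'
  have e (x : ℝ) : ((ℓ : ℝ≥0∞)⁻¹ * tilt ν q₁ x) ^ a * ((ℓ : ℝ≥0∞)⁻¹ * tilt ν q₂ x) ^ b
      = ENNReal.ofReal (Real.exp ((a * q₁ + b * q₂) * Real.log x
        + -(a * (cgf Real.log ν q₁ + Real.log ℓ) + b * (cgf Real.log ν q₂ + Real.log ℓ)))) := by
    rw [inv_mul_tilt hℓ0, inv_mul_tilt hℓ0, ofReal_exp_rpow, ofReal_exp_rpow,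
      ← ENNReal.ofReal_mul (Real.exp_nonneg _), ← Real.exp_add]
    congr 2; ring
  simp only [jointScaling, e]
  rw [lintegral_ofReal_exp hint]
  conv_lhs => rw [← ENNReal.rpow_one (ℓ : ℝ≥0∞)]
  rw [natCast_rpow_eq_ofReal_exp hℓ0, natCast_rpow_eq_ofReal_exp hℓ0,
    ← ENNReal.ofReal_mul (Real.exp_nonneg _), ← Real.exp_add]
  congr 2
  simp only [tauLaw]
  field_simp
  ring

theorem scaling_tilt (hℓ : 2 ≤ ℓ)
    (hint : ∀ t : ℝ, Integrable (fun x => Real.exp (t * Real.log x)) ν) (q r : ℝ) :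
    scaling ℓ ν (tilt ν q) r = (ℓ : ℝ≥0∞) ^ (tauLaw ℓ ν (r * q) - r * tauLaw ℓ ν q) := by
  have := jointScaling_tilt hℓ hint q q r 0
  simpa [jointScaling, scaling] using this

theorem tauLaw_zero : tauLaw ℓ ν 0 = 1 := by simp [tauLaw]

theorem zero_mem_qSet (hint : ∀ t : ℝ, Integrable (fun x => Real.exp (t * Real.log x)) ν) :
    (0 : ℝ) ∈ qSet (tauLaw ℓ ν) := by
  rw [mem_qSet_iff (convexOn_tauLaw hint) (differentiable_tauLaw hint), tauLaw_zero]
  simp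

/-- A weight with non-degenerate cascade has `τ'(1) < 0`. -/
theorem one_mem_qSet (hℓ : 2 ≤ ℓ)
    (hint : ∀ t : ℝ, Integrable (fun x => Real.exp (t * Real.log x)) ν)
    (h1 : cgf Real.log ν 1 = 0) (h0 : ¬∀ᵐ w ∂treeLaw ℓ ν, limMass (tilt ν 1) w = 0) :
    (1 : ℝ) ∈ qSet (tauLaw ℓ ν) := by
  have hL : 0 < Real.log ℓ := Real.log_pos (by exact_mod_cast hℓ)
  have hτ1 : tauLaw ℓ ν 1 = 0 := by simp [tauLaw, h1]
  rw [mem_qSet_iff (convexOn_tauLaw hint) (differentiable_tauLaw hint), hτ1]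
  obtain ⟨v, hv, hle⟩ := exists_one_add_le_scaling hℓ (measurable_tilt 1) (tilt_pos 1)
    (lintegral_tilt hint 1) h0
  have hexp (h : ℝ) (hh0 : 0 < h) (hh1 : h < 1) :
      1 + (1 - h) * v ≤ Real.exp (tauLaw ℓ ν h * Real.log ℓ) := by
    have h2 := hle h hh0 hh1
    rw [scaling_tilt hℓ hint, hτ1, mul_one, mul_zero, sub_zero,
      natCast_rpow_eq_ofReal_exp (by omega), ← ENNReal.ofReal_one,
      ← ENNReal.ofReal_add zero_le_one (by nlinarith)] at h2
    exact (ENNReal.ofReal_le_ofReal_iff (Real.exp_nonneg _)).1 h2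
  by_contra! hcon
  have hd : HasDerivAt (tauLaw ℓ ν) (deriv (tauLaw ℓ ν) 1) ((fun h : ℝ => 1 - h) 0) := by
    simpa using (differentiable_tauLaw hint 1).hasDerivAt
  -- The function `exp (τ(1 - h) log ℓ)` has derivative `-τ'(1) log ℓ ≤ 0 < v` at `0`.
  have hd2 := ((hd.comp (0 : ℝ) ((hasDerivAt_id (0 : ℝ)).const_sub 1)).mul_const
    (Real.log ℓ)).exp
  have hev := eventually_le_add_mul_of_hasDerivAt (c := v) hd2 (by
    simp only [Function.comp, sub_zero, hτ1, zero_mul, Real.exp_zero, one_mul]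
    nlinarith)
  obtain ⟨h, hlt, hh⟩ := (hev.and (Ioo_mem_nhdsGT (zero_lt_one' ℝ))).exists
  simp only [Function.comp, zero_add, sub_zero, hτ1, zero_mul, Real.exp_zero] at hlt
  have := hexp (1 - h) (by linarith [hh.2]) (by linarith [hh.1])
  rw [sub_sub_cancel] at this
  linarith

end Tilt

/-! ### The level sets of the cascade on the tree -/

section TreeDimension

variable {ℓ : ℕ} {ν : Measure ℝ}

theorem hasDerivAt_tauLaw_mul_sub
    (hint : ∀ t : ℝ, Integrable (fun x => Real.exp (t * Real.log x)) ν) (q : ℝ) :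
    HasDerivAt (fun s : ℝ => tauLaw ℓ ν (s * q) - s * tauLaw ℓ ν q)
      (-(tauLaw ℓ ν q - q * deriv (tauLaw ℓ ν) q)) 1 := by
  have h1 : HasDerivAt (tauLaw ℓ ν) (deriv (tauLaw ℓ ν) q) ((fun s : ℝ => s * q) 1) := by
    simpa using (differentiable_tauLaw hint q).hasDerivAt
  have h2 := (h1.comp (1 : ℝ) (hasDerivAt_mul_const q)).sub
    (hasDerivAt_mul_const (x := (1 : ℝ)) (tauLaw ℓ ν q))
  refine h2.congr_deriv ?_
  ring

variable [IsProbabilityMeasure ν]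

/-- The cascade of the weight tilted by `q` has a finite moment of order larger than `1` when
`τ*(-τ'(q)) > 0`: this is minus the derivative at `1` of its structure function. -/
theorem exists_scaling_tilt_lt_one (hℓ : 2 ≤ ℓ)
    (hint : ∀ t : ℝ, Integrable (fun x => Real.exp (t * Real.log x)) ν) {q : ℝ}
    (hq : q ∈ qSet (tauLaw ℓ ν)) :
    ∃ p : ℝ, 1 < p ∧ ∀ s, 1 < s → s ≤ p → scaling ℓ ν (tilt ν q) s < 1 := by
  have hg := (mem_qSet_iff (convexOn_tauLaw hint) (differentiable_tauLaw hint)).1 hq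
  have h := eventually_le_add_mul_of_hasDerivAt (hasDerivAt_tauLaw_mul_sub (ℓ := ℓ) hint q)
    (neg_lt_zero.2 hg)
  obtain ⟨u, hu, hsub⟩ := (mem_nhdsGT_iff_exists_Ioc_subset (a := (0 : ℝ))).1 h
  refine ⟨1 + u, by simpa using hu, fun s hs hsu => ?_⟩
  have h1 : tauLaw ℓ ν ((1 + (s - 1)) * q) - (1 + (s - 1)) * tauLaw ℓ ν q
      < tauLaw ℓ ν (1 * q) - 1 * tauLaw ℓ ν q + 0 * (s - 1) :=
    hsub (show s - 1 ∈ Set.Ioc 0 u from ⟨by linarith, by linarith⟩)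
  rw [scaling_tilt hℓ hint, natCast_rpow_lt_one_iff hℓ]
  simpa using h1

theorem ae_isRegular_tilt (hℓ : 2 ≤ ℓ)
    (hint : ∀ t : ℝ, Integrable (fun x => Real.exp (t * Real.log x)) ν) {q : ℝ}
    (hq : q ∈ qSet (tauLaw ℓ ν)) : ∀ᵐ w ∂treeLaw ℓ ν, IsRegular (tilt ν q) w := by
  have hℓ0 : 0 < ℓ := by omega
  obtain ⟨p, hp, hρ⟩ := exists_scaling_tilt_lt_one hℓ hint hq
  exact ae_isRegular hℓ (measurable_tilt q) (tilt_pos q) (lintegral_tilt hint q)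
    (not_ae_limMass_eq_zero hℓ0 (measurable_tilt q) (tilt_pos q) (lintegral_tilt hint q) hp hρ)
    (by linarith) (lintegral_limMass_rpow_ne_top hℓ0 (measurable_tilt q) (tilt_pos q)
      (lintegral_tilt hint q) (by linarith) hρ) (hρ p hp le_rfl)

theorem lintegral_limMass_tilt_one_rpow_ne_top (hℓ : 2 ≤ ℓ)
    (hint : ∀ t : ℝ, Integrable (fun x => Real.exp (t * Real.log x)) ν)
    (h1 : tauLaw ℓ ν 1 = 0) (h1q : (1 : ℝ) ∈ qSet (tauLaw ℓ ν)) {q : ℝ}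
    (hq : q ≤ 1 ∨ q ∈ qSet (tauLaw ℓ ν)) :
    ∫⁻ w, limMass (tilt ν 1) w ^ q ∂treeLaw ℓ ν ≠ ∞ := by
  have hℓ0 : 0 < ℓ := by omega
  rcases le_or_gt 0 q with h0 | h0
  · refine lintegral_limMass_rpow_ne_top hℓ0 (measurable_tilt 1) (tilt_pos 1)
      (lintegral_tilt hint 1) h0 fun s hs hsq => ?_
    rw [scaling_tilt hℓ hint, natCast_rpow_lt_one_iff hℓ, h1, mul_one, mul_zero, sub_zero]
    exact neg_of_mem_qSet (convexOn_tauLaw hint) (differentiable_tauLaw hint) h1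
      (hq.resolve_left (by linarith)) hs hsq
  · obtain ⟨p, hp, hρ⟩ := exists_scaling_tilt_lt_one hℓ hint h1q
    have hY := ae_limMass_ne_zero hℓ (measurable_tilt 1) (tilt_pos 1) (lintegral_tilt hint 1)
      (not_ae_limMass_eq_zero hℓ0 (measurable_tilt 1) (tilt_pos 1) (lintegral_tilt hint 1) hp hρ)
    simpa using lintegral_limMass_rpow_neg_ne_top hℓ (measurable_tilt 1) (tilt_pos 1)
      (lintegral_tilt hint 1) (lintegral_tilt_rpow_ne_top hint 1) hY (s := -q) (by linarith)

theorem lintegral_rpow_mul_ne_top {α : Type*} [MeasurableSpace α] {μ : Measure α}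
    {f g : α → ℝ≥0∞} (hf : Measurable f) (hg : Measurable g) {p p' a : ℝ}
    (hp : p'.HolderConjugate p) (h1 : ∫⁻ x, f x ^ (a * p') ∂μ ≠ ∞) (h2 : ∫⁻ x, g x ^ p ∂μ ≠ ∞) :
    ∫⁻ x, f x ^ a * g x ^ (1 : ℝ) ∂μ ≠ ∞ := by
  have h := ENNReal.lintegral_mul_le_Lp_mul_Lq μ hp (hf.pow_const a).aemeasurable hg.aemeasurable
  simp only [ENNReal.rpow_one]
  refine ne_top_of_le_ne_top (ENNReal.mul_ne_top ?_ ?_) h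
  · refine ENNReal.rpow_ne_top_of_nonneg (by have := hp.nonneg; positivity) ?_
    simpa only [← ENNReal.rpow_mul] using h1
  · exact ENNReal.rpow_ne_top_of_nonneg (by have := hp.symm.nonneg; positivity) h2

/-- Convergence of the generating series of the joint partition function of two tilted cascades. -/
theorem ae_tsum_adicInterval_ne_top (hℓ : 2 ≤ ℓ)
    (hint : ∀ t : ℝ, Integrable (fun x => Real.exp (t * Real.log x)) ν) {q₁ q₂ : ℝ}
    (hq₁ : q₁ ∈ qSet (tauLaw ℓ ν)) (hq₂ : q₂ ∈ qSet (tauLaw ℓ ν)) {a b s : ℝ}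
    (hs : s + (tauLaw ℓ ν (a * q₁ + b * q₂) - a * tauLaw ℓ ν q₁ - b * tauLaw ℓ ν q₂) < 0)
    (hE : ∫⁻ w, limMass (tilt ν q₁) w ^ a * limMass (tilt ν q₂) w ^ b ∂treeLaw ℓ ν ≠ ∞) :
    ∀ᵐ w ∂treeLaw ℓ ν, ∑' n : ℕ, ((ℓ : ℝ≥0∞) ^ s) ^ n * ∑ ε : Fin n → Fin ℓ,
      (cascade (weightField (tilt ν q₁)) w : Measure ℝ) (adicInterval ℓ n ε) ^ a *
        (cascade (weightField (tilt ν q₂)) w : Measure ℝ) (adicInterval ℓ n ε) ^ b ≠ ∞ := by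
  have hℓ0 : 0 < ℓ := by omega
  have := ae_tsum_sum_cyl_ne_top hℓ0 (measurable_tilt q₁) (measurable_tilt q₂) (tilt_pos q₁)
    (tilt_pos q₂) (t := (ℓ : ℝ≥0∞) ^ s) (a := a) (b := b) (ν := ν) (by
      rw [jointScaling_tilt hℓ hint, ← natCast_rpow_add hℓ0, natCast_rpow_lt_one_iff hℓ]
      exact hs) hE
  filter_upwards [this, ae_isRegular_tilt hℓ hint hq₁, ae_isRegular_tilt hℓ hint hq₂]
    with w hw hr₁ hr₂
  simpa only [hr₁.apply_adicInterval, hr₂.apply_adicInterval] using hw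

theorem ae_dimH_levelSet_le (hℓ : 2 ≤ ℓ)
    (hint : ∀ t : ℝ, Integrable (fun x => Real.exp (t * Real.log x)) ν)
    (h1 : tauLaw ℓ ν 1 = 0) (h1q : (1 : ℝ) ∈ qSet (tauLaw ℓ ν)) {q : ℝ}
    (hq : q ∈ qSet (tauLaw ℓ ν)) (β : ℝ) :
    ∀ᵐ w ∂treeLaw ℓ ν, dimH (levelSet ℓ (cascade (weightField (tilt ν 1)) w : Measure ℝ) β)
      ≤ ENNReal.ofReal (q * β + tauLaw ℓ ν q) := by
  have hsum : ∀ᵐ w ∂treeLaw ℓ ν, ∀ k : ℕ,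
      ∑' n : ℕ, ((ℓ : ℝ≥0∞) ^ (-(tauLaw ℓ ν q + 1 / (k + 1)))) ^ n * ∑ ε : Fin n → Fin ℓ,
        (cascade (weightField (tilt ν 1)) w : Measure ℝ) (adicInterval ℓ n ε) ^ q *
          (cascade (weightField (tilt ν 1)) w : Measure ℝ) (adicInterval ℓ n ε) ^ (0 : ℝ) ≠ ∞ := by
    refine ae_all_iff.2 fun k => ae_tsum_adicInterval_ne_top hℓ hint h1q h1q ?_ ?_
    · have : (0 : ℝ) < 1 / (k + 1) := by positivity
      simp only [mul_one, add_zero, h1, mul_zero, sub_zero]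
      linarith
    · simpa using lintegral_limMass_tilt_one_rpow_ne_top hℓ hint h1 h1q (Or.inr hq)
  filter_upwards [hsum, ae_isRegular_tilt hℓ hint h1q] with w hw hr
  refine dimH_levelSet_le hℓ (fun n ε => ?_) (fun n ε => ?_) fun δ hδ => ?_
  · rw [hr.apply_adicInterval]; exact hr.ne_zero _
  · rw [hr.apply_adicInterval]; exact hr.ne_top _
  · obtain ⟨k, hk⟩ := exists_nat_one_div_lt hδ
    exact ⟨tauLaw ℓ ν q + 1 / (k + 1), by linarith,
      by simpa only [ENNReal.rpow_zero, mul_one] using hw k⟩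

/-- The cascade tilted by `q` plays the part of the auxiliary measure carried by the level set of
`-τ'(q)`. The three exponents that occur are differences of values of `τ` at points close to `q`,
and the derivative of `τ` gives their signs for small `η`; Hölder's inequality bounds the mixed
moments. -/
theorem ae_le_dimH_levelSet (hℓ : 2 ≤ ℓ)
    (hint : ∀ t : ℝ, Integrable (fun x => Real.exp (t * Real.log x)) ν)
    (h1 : tauLaw ℓ ν 1 = 0) (h1q : (1 : ℝ) ∈ qSet (tauLaw ℓ ν)) {q : ℝ}
    (hq : q ∈ qSet (tauLaw ℓ ν)) :
    ∀ᵐ w ∂treeLaw ℓ ν, ENNReal.ofReal (tauLaw ℓ ν q - q * deriv (tauLaw ℓ ν) q) ≤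
      dimH (levelSet ℓ (cascade (weightField (tilt ν 1)) w : Measure ℝ)
        (-deriv (tauLaw ℓ ν) q)) := by
  have hℓ0 : 0 < ℓ := by omega
  set τ := tauLaw ℓ ν with hτ
  have hd : HasDerivAt τ (deriv τ q) q := (differentiable_tauLaw hint q).hasDerivAt
  have hd' : HasDerivAt (fun h : ℝ => τ (q - h)) (-deriv τ q) 0 := by
    have : HasDerivAt τ (deriv τ q) ((fun h : ℝ => q - h) 0) := by simpa using hd
    refine (this.comp (0 : ℝ) ((hasDerivAt_id (0 : ℝ)).const_sub q)).congr_deriv ?_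
    ring
  obtain ⟨p, hp, hρ⟩ := exists_scaling_tilt_lt_one hℓ hint hq
  have hpp : p.conjExponent.HolderConjugate p := (Real.HolderConjugate.conjExponent hp).symm
  have hp'0 : 0 < p.conjExponent := hpp.pos
  have hmom {r : ℝ} (h0 : 0 ≤ r) (hr : r ≤ p) :
      ∫⁻ w, limMass (tilt ν q) w ^ r ∂treeLaw ℓ ν ≠ ∞ :=
    lintegral_limMass_rpow_ne_top hℓ0 (measurable_tilt q) (tilt_pos q) (lintegral_tilt hint q) h0
      fun s hs hsr => hρ s hs (hsr.trans hr)
  have hjoint {a : ℝ} (ha : a * p.conjExponent ≤ 1) :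
      ∫⁻ w, limMass (tilt ν 1) w ^ a * limMass (tilt ν q) w ^ (1 : ℝ) ∂treeLaw ℓ ν ≠ ∞ :=
    lintegral_rpow_mul_ne_top (measurable_limMass (measurable_tilt 1))
      (measurable_limMass (measurable_tilt q)) hpp
      (lintegral_limMass_tilt_one_rpow_ne_top hℓ hint h1 h1q (Or.inl ha))
      (hmom (by linarith) le_rfl)
  -- For small `η` the first order expansions of the three exponents hold up to `δ η`, and the
  -- moments of order `1 + η` and `±η p / (p - 1)` that are needed are finite.
  have hη (δ : ℝ) (hδ : 0 < δ) : ∃ η : ℝ, 0 < η ∧ η ≤ p - 1 ∧ η * p.conjExponent ≤ 1 ∧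
      τ (q + η) < τ q + (deriv τ q + δ) * η ∧ τ (q - η) < τ q + (-deriv τ q + δ) * η ∧
      τ ((1 + η) * q) - (1 + η) * τ q < (-(τ q - q * deriv τ q) + δ) * η := by
    have e1 := eventually_le_add_mul_of_hasDerivAt hd (lt_add_of_pos_right _ hδ)
    have e2 := eventually_le_add_mul_of_hasDerivAt hd' (lt_add_of_pos_right _ hδ)
    have e3 := eventually_le_add_mul_of_hasDerivAt (hasDerivAt_tauLaw_mul_sub (ℓ := ℓ) hint q)
      (lt_add_of_pos_right _ hδ)
    have e4 : ∀ᶠ η in 𝓝[>] (0 : ℝ), η ∈ Set.Ioo 0 (min (p - 1) (1 / p.conjExponent)) :=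
      Ioo_mem_nhdsGT (lt_min (by linarith) (by positivity))
    obtain ⟨η, h1, h2, h3, h4⟩ := (e1.and (e2.and (e3.and e4))).exists
    refine ⟨η, h4.1, (h4.2.le.trans (min_le_left _ _)),
      (le_div_iff₀ hp'0).1 (h4.2.le.trans (min_le_right _ _)), h1, ?_, ?_⟩
    · simpa using h2
    · simpa [← hτ] using h3
  have hk (k : ℕ) : (0 : ℝ) < 1 / (k + 1) := by positivity
  choose η hη0 hηp hηp' hηa hηb hηc using fun k : ℕ => hη _ (hk k)
  have hs1 := ae_all_iff.2 fun k : ℕ => ae_tsum_adicInterval_ne_top hℓ hint h1q hq (a := η k)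
    (b := 1) (s := η k * (-deriv τ q - 1 / (k + 1))) (by
      have := hηa k
      rw [← hτ, h1, mul_zero, sub_zero, mul_one, one_mul, one_mul, add_comm (η k)]
      linarith) (hjoint (hηp' k))
  have hs2 := ae_all_iff.2 fun k : ℕ => ae_tsum_adicInterval_ne_top hℓ hint h1q hq (a := -η k)
    (b := 1) (s := -η k * (-deriv τ q + 1 / (k + 1))) (by
      have := hηb k
      rw [← hτ, h1, mul_zero, sub_zero, mul_one, one_mul, one_mul, add_comm (-η k) q,
        ← sub_eq_add_neg q]
      linarith) (hjoint (by nlinarith [hη0 k]))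
  have hs3 := ae_all_iff.2 fun k : ℕ => ae_tsum_adicInterval_ne_top hℓ hint h1q hq (a := 0)
    (b := 1 + η k) (s := η k * (τ q - q * deriv τ q - 1 / (k + 1))) (by
      have := hηc k
      rw [← hτ, zero_mul, zero_mul, sub_zero, zero_add]
      linarith) (by
      simpa using hmom (r := 1 + η k) (by linarith [hη0 k]) (by linarith [hηp k]))
  filter_upwards [hs1, hs2, hs3, ae_isRegular_tilt hℓ hint h1q, ae_isRegular_tilt hℓ hint hq]
    with w hw1 hw2 hw3 hr hrq
  refine le_dimH_levelSet (μ := (cascade (weightField (tilt ν q)) w : Measure ℝ)) hℓ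
    (fun n ε => ?_) (fun n ε => ?_) hrq.compl_Ico ?_
    fun k => ⟨η k, hη0 k, hw1 k, hw2 k, hw3 k⟩
  · rw [hr.apply_adicInterval]; exact hr.ne_zero _
  · rw [hr.apply_adicInterval]; exact hr.ne_top _
  · intro h0
    refine hrq.ne_zero (List.ofFn (Fin.elim0 : Fin 0 → Fin ℓ)) ?_
    rw [← hrq.apply_adicInterval, h0, Measure.coe_zero, Pi.zero_apply]

end TreeDimension

/-! ### Transfer to independent copies of a weight -/

section Transfer

/-- The cascade at a sample point only depends on the values of the weights there. -/
theorem cascade_congr {Ω Ω' : Type*} {ℓ : ℕ} {W : List (Fin ℓ) → Ω → ℝ}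
    {W' : List (Fin ℓ) → Ω' → ℝ} {ω : Ω} {ω' : Ω'} (h : ∀ ε, W ε ω = W' ε ω') :
    cascade W ω = cascade W' ω' := by
  have hd (n : ℕ) : density W n ω = density W' n ω' := by
    funext x
    simp only [density, prefixProd, h]
  have ha (n : ℕ) : approx W n ω = approx W' n ω' :=
    Subtype.ext (by simp only [approx, hd])
  simp only [cascade, ha]

variable {Ω Ω' : Type*} [MeasurableSpace Ω] [MeasurableSpace Ω'] {P : Measure Ω} {P' : Measure Ω'}
  {ℓ : ℕ} {W : Ω' → ℝ} {Wε : List (Fin ℓ) → Ω → ℝ}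

theorem rpow_ae_eq_exp_mul_log (hpos : ∀ᵐ ω ∂P', 0 < W ω) (t : ℝ) :
    (fun ω => W ω ^ t) =ᵐ[P'] fun ω => Real.exp (t * Real.log (W ω)) := by
  filter_upwards [hpos] with ω hω
  rw [Real.rpow_def_of_pos hω, mul_comm]

theorem integrable_exp_mul_log_map (hW : AEMeasurable W P') (hpos : ∀ᵐ ω ∂P', 0 < W ω)
    (hmom : ∀ q : ℝ, Integrable (fun ω => W ω ^ q) P') (t : ℝ) :
    Integrable (fun x => Real.exp (t * Real.log x)) (P'.map W) := by
  rw [integrable_map_measure (by fun_prop) hW]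
  exact (hmom t).congr (rpow_ae_eq_exp_mul_log hpos t)

theorem cgf_log_map (hW : AEMeasurable W P') (hpos : ∀ᵐ ω ∂P', 0 < W ω) (t : ℝ) :
    cgf Real.log (P'.map W) t = Real.log (∫ ω, W ω ^ t ∂P') := by
  rw [cgf, mgf, integral_map hW (by fun_prop),
    integral_congr_ae (rpow_ae_eq_exp_mul_log hpos t)]

theorem tau_eq_tauLaw (hW : AEMeasurable W P') (hpos : ∀ᵐ ω ∂P', 0 < W ω) :
    tau P' ℓ W = tauLaw ℓ (P'.map W) := by
  funext q
  rw [tau, tauLaw, cgf_log_map hW hpos, Real.logb]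

/-- Independent copies of `W` form a random tree with law `treeLaw`. -/
theorem map_eq_treeLaw (hindep : iIndepFun Wε P) (hcopy : ∀ ε, IdentDistrib (Wε ε) W P P') :
    P.map (fun ω ε => Wε ε ω) = treeLaw ℓ (P'.map W) := by
  rw [hindep.map_fun_eq_infinitePi_map₀' fun ε => (hcopy ε).aemeasurable_fst, treeLaw]
  simp only [(hcopy _).map_eq]

theorem coe_tilt_one {ν : Measure ℝ} (h1 : cgf Real.log ν 1 = 0) {x : ℝ} (hx : 0 < x) :
    (tilt ν 1 x : ℝ) = x := by
  rw [tilt, h1, sub_zero, one_mul, Real.exp_log hx, Real.coe_toNNReal _ hx.le]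

/-- For a positive weight of mean `1` the tilt by `1` changes nothing. -/
theorem ae_cascade_eq (hpos : ∀ᵐ ω ∂P', 0 < W ω) (hcopy : ∀ ε, IdentDistrib (Wε ε) W P P')
    (h1 : cgf Real.log (P'.map W) 1 = 0) :
    ∀ᵐ ω ∂P, cascade Wε ω = cascade (weightField (tilt (P'.map W) 1)) fun ε => Wε ε ω := by
  have h : ∀ᵐ ω ∂P, ∀ ε, 0 < Wε ε ω := ae_all_iff.2 fun ε =>
    (hcopy ε).symm.ae_snd measurableSet_Ioi hpos
  filter_upwards [h] with ω hω
  exact cascade_congr fun ε => (coe_tilt_one h1 (hω ε)).symm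

end Transfer

end MandelbrotCascade

open MandelbrotCascade in
theorem mainTheorem1
    {Ω Ω' : Type*} [MeasurableSpace Ω] [MeasurableSpace Ω']
    (P : Measure Ω) [IsProbabilityMeasure P] (P' : Measure Ω') [IsProbabilityMeasure P']
    (ℓ : ℕ) (hℓ : 2 ≤ ℓ)
    -- the weight
    (W : Ω' → ℝ) (hW_nonneg : ∀ᵐ ω ∂P', 0 ≤ W ω) (hW_mean : ∫ ω, W ω ∂P' = 1)
    -- independent copies of the weight, indexed by the finite words over `{0, …, ℓ - 1}`
    (Wε : List (Fin ℓ) → Ω → ℝ) (hindep : iIndepFun Wε P)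
    (hcopy : ∀ ε, IdentDistrib (Wε ε) W P P')
    -- `P[W = 0] = 0` and `E[W^q] < ∞` for every real `q`
    (hW_zero : P' {ω | W ω = 0} = 0)
    (hW_moments : ∀ q : ℝ, Integrable (fun ω => W ω ^ q) P')
    -- the cascade is non-degenerate
    (hnondeg : MandelbrotCascade.Nondegenerate P Wε)
    -- `β ∈ (-τ'(q_max), -τ'(q_min))`
    (β : ℝ)
    (hβ_left : -MandelbrotCascade.extDeriv (MandelbrotCascade.tau P' ℓ W)
        (MandelbrotCascade.qMax (MandelbrotCascade.tau P' ℓ W)) < (β : EReal))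
    (hβ_right : (β : EReal) < -MandelbrotCascade.extDeriv (MandelbrotCascade.tau P' ℓ W)
        (MandelbrotCascade.qMin (MandelbrotCascade.tau P' ℓ W))) :
    ∀ᵐ ω ∂P,
      ((dimH (MandelbrotCascade.levelSet ℓ
          (MandelbrotCascade.cascade Wε ω : Measure ℝ) β) : ENNReal) : EReal) =
        MandelbrotCascade.legendre (MandelbrotCascade.tau P' ℓ W) β := by
  have hℓ0 : 0 < ℓ := by omega
  have hWm : AEMeasurable W P' := (hcopy []).aemeasurable_snd
  have hpos : ∀ᵐ ω ∂P', 0 < W ω := by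
    have h0 : ∀ᵐ ω ∂P', W ω ≠ 0 := by simpa [ae_iff] using hW_zero
    filter_upwards [hW_nonneg, h0] with ω h1 h2
    exact lt_of_le_of_ne h1 h2.symm
  have hν : IsProbabilityMeasure (P'.map W) := Measure.isProbabilityMeasure_map hWm
  have hint := integrable_exp_mul_log_map hWm hpos hW_moments
  have hcgf : cgf Real.log (P'.map W) 1 = 0 := by
    rw [cgf_log_map hWm hpos]
    simp [hW_mean]
  have hτ1 : tauLaw ℓ (P'.map W) 1 = 0 := by simp [tauLaw, hcgf]
  have hΦ : AEMeasurable (fun ω ε => Wε ε ω) P :=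
    aemeasurable_pi_iff.2 fun ε => (hcopy ε).aemeasurable_fst
  have hlaw := map_eq_treeLaw hindep hcopy
  have hcas := ae_cascade_eq hpos hcopy hcgf
  have hne : ¬∀ᵐ w ∂treeLaw ℓ (P'.map W), limMass (tilt (P'.map W) 1) w = 0 := by
    intro h0
    refine hnondeg.ne' ((lintegral_congr_ae ?_).trans lintegral_zero)
    have h2 : ∀ᵐ w ∂treeLaw ℓ (P'.map W), cascade (weightField (tilt (P'.map W) 1)) w = 0 := by
      filter_upwards [h0, ae_converges hℓ0 (measurable_tilt 1) (lintegral_tilt hint 1)]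
        with w hw hconv
      exact cascade_eq_zero hℓ0 hconv hw
    rw [← hlaw] at h2
    filter_upwards [ae_of_ae_map hΦ h2, hcas] with ω hω hω'
    rw [hω', hω]
    simp
  have h1q := one_mem_qSet hℓ hint hcgf hne
  rw [tau_eq_tauLaw hWm hpos] at hβ_left hβ_right ⊢
  have hconv := convexOn_tauLaw (ℓ := ℓ) hint
  have hdiff := differentiable_tauLaw (ℓ := ℓ) hint
  obtain ⟨q, hq, rfl⟩ := exists_mem_qSet_eq_neg_deriv hconv hdiff (continuous_deriv_tauLaw hint)
    (zero_mem_qSet hint) hβ_left hβ_right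
  have hdim : ∀ᵐ w ∂treeLaw ℓ (P'.map W),
      dimH (levelSet ℓ (cascade (weightField (tilt (P'.map W) 1)) w : Measure ℝ)
        (-deriv (tauLaw ℓ (P'.map W)) q))
      = ENNReal.ofReal (tauLaw ℓ (P'.map W) q - q * deriv (tauLaw ℓ (P'.map W)) q) := by
    filter_upwards [ae_dimH_levelSet_le hℓ hint hτ1 h1q hq (-deriv (tauLaw ℓ (P'.map W)) q),
      ae_le_dimH_levelSet hℓ hint hτ1 h1q hq] with w hle hge
    refine le_antisymm (hle.trans_eq ?_) hge
    congr 1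
    ring
  rw [← hlaw] at hdim
  filter_upwards [ae_of_ae_map hΦ hdim, hcas] with ω hω hω'
  rw [hω', hω, legendre_neg_deriv hconv hdiff, EReal.coe_ennreal_ofReal,
    max_eq_left ((mem_qSet_iff hconv hdiff).1 hq).le]
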